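/- Let $n\in\mathbb N$. On the Fock space of $2n$ harmonic oscillators $A_1,\dots,A_n,B_1,\dots,B_n$ ($[A_a,A_b^\dagger]=[B_a,B_b^\dagger]=\delta_{ab}$, all other commutators zero) with orthonormal occupation number basis $|\mu,\nu\rangle$, $\mu,\nu\in\mathbb N_0^n$, and vacuum $|0\rangle$, put $$E_{ab}=A_a^\dagger A_b+B_a^\dagger B_b+\delta_{ab},\qquad F_{ab}=B_aA_b-A_aB_b,\qquad \widetilde F_{ab}=B_a^\dagger A_b^\dagger-A_a^\dagger B_b^\dagger,$$ $E_\alpha=\sum_{a,b}\alpha_{ab}E_{ab}$, $F_z=\sum_{a,b}\overline{z_{ab}}F_{ab}$, $\widetilde F_z=\sum_{a,b}z_{ab}\widetilde F_{ab}$. Let $\mathcal H_n$ be the Hilbert space of $n$-valent $\mathrm{SU}(2)$ intertwiners, i.e. the Fock vectors annihilated by $J_z=\frac12\sum_a(A_a^\dagger A_a-B_a^\dagger B_a)$, $J_+=\sum_aA_a^\dagger B_a$ and $J_-=\sum_aB_a^\dagger A_a$. Let $\mathrm{SO}^*(2n)$ be the group of $g\in \mathrm{SL}(2n,\mathbb C)$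 with $g^*\begin{pmatrix}1&0\\0&-1\end{pmatrix}g=\begin{pmatrix}1&0\\0&-1\end{pmatrix}$ and $g^T\begin{pmatrix}0&1\\1&0\end{pmatrix}g=\begin{pmatrix}0&1\\1&0\end{pmatrix}$; its Lie algebra consists of the matrices $V_{X,Y}=\begin{pmatrix}X&Y\\-\overline Y&\overline X\end{pmatrix}$ with $X^*=-X$, $Y^T=-Y$. Let $$\Omega_n=\{\zeta\in M_n(\mathbb C):\zeta^T=-\zeta,\ \zeta^*\zeta<1\},\qquad |\zeta\rangle=\det(1-\zeta^*\zeta)^{1/2}\exp\!\big(\tfrac12\widetilde F_\zeta\big)|0\rangle\quad(\zeta\in\Omega_n).$$ (1) For $\zeta\in\Omega_n$ the exponential series $\sum_k\frac1{k!}(\frac12\widetilde F_\zeta)^k|0\rangle$ converges in the Fock space, and $|\zeta\rangle\in\mathcal H_n$. (2) The $|\zeta\rangle$ are the Perelomov coherent states of the vacuum: there is a strongly continuous unitary representation $\pi$ of $\mathrm{SO}^*(2n)$ on $\mathcal H_n$ with $\frac{d}{dt}\big|_{t=0}\pi(e^{tV_{X,Y}})\psi=(E_X+\frac12\widetilde F_Y-\frac12F_Y)\psi$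 for all $X,Y$ as above and all $\psi\in\mathcal H_n$ with finitely many non-zero coefficients, such that $|\zeta\rangle=\pi(g_\zeta)|0\rangle$ for all $\zeta\in\Omega_n$, where $$g_\zeta=\begin{pmatrix}X_\zeta&\zeta\overline{X_\zeta}\\ \zeta^*X_\zeta&\overline{X_\zeta}\end{pmatrix}\in\mathrm{SO}^*(2n),\qquad X_\zeta=\sqrt{(1-\zeta\zeta^*)^{-1}},$$ and such that for all $g=\begin{pmatrix}A&B\\C&D\end{pmatrix}\in\mathrm{SO}^*(2n)$ and $\zeta\in\Omega_n$ the matrix $C\zeta+D$ is invertible, $g(\zeta):=(A\zeta+B)(C\zeta+D)^{-1}\in\Omega_n$, and $\pi(g)|\zeta\rangle=e^{i\theta}|g(\zeta)\rangle$ for some $\theta\in\mathbb R$. (3) For $\omega,\zeta\in\Omega_n$ one has $\det(1-\omega^*\zeta)\neq0$ and $$\langle\omega|\zeta\rangle=\frac{\det(1-\zeta^*\zeta)^{1/2}\det(1-\omega^*\omega)^{1/2}}{\det(1-\omega^*\zeta)},\qquad|\langle\omega|\zeta\rangle|\le1,$$ with $|\langle\omega|\zeta\rangle|=1$ if and only if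 $\omega=\zeta$. (4) For $\omega,\zeta\in\Omega_n$ and $1\le a,b\le n$ the vector $|\zeta\rangle$ lies in the domains of $E_{ab},F_{ab},\widetilde F_{ab}$, and $$\langle\omega|E_{ab}|\zeta\rangle=\langle\omega|\zeta\rangle\big[1+2\omega^*\zeta(1-\omega^*\zeta)^{-1}\big]_{ab},$$ $$\langle\omega|F_{ab}|\zeta\rangle=\langle\omega|\zeta\rangle\big[2\zeta(1-\omega^*\zeta)^{-1}\big]_{ab},\qquad\langle\omega|\widetilde F_{ab}|\zeta\rangle=\langle\omega|\zeta\rangle\big[2(1-\omega^*\zeta)^{-1}\overline\omega\big]_{ab}.$$ -/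

import Mathlib

open scoped Matrix ComplexConjugate ComplexOrder

noncomputable section

namespace SOStarCoherent

/-- Occupation numbers `(μ, ν)` of the `2 n` oscillators `A_1, …, A_n, B_1, …, B_n`. -/
abbrev Occ (n : ℕ) : Type := (Fin n → ℕ) × (Fin n → ℕ)

/-- Arbitrary (not necessarily square-summable) families of coefficients in the orthonormal
occupation number basis `|μ, ν⟩`. -/
abbrev Coeff (n : ℕ) : Type := Occ n → ℂ

/-- The Hilbert space of the `2 n` oscillators: square-summable coefficients. -/
abbrev Fock (n : ℕ) : Type := lp (fun _ : Occ n => ℂ) 2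

/-- The annihilation operator `A_a`: `A_a |μ, ν⟩ = √μ_a |μ - e_a, ν⟩`. This operator, and all those
below, are given by their action on coefficients; on the Hilbert space they are unbounded, and
`T ψ` makes sense there when the coefficients of `T ψ` are square-summable. -/
def opA {n : ℕ} (a : Fin n) : Module.End ℂ (Coeff n) where
  toFun f := fun i => (Real.sqrt (i.1 a + 1) : ℂ) * f (i.1 + Pi.single a 1, i.2)
  map_add' f g := by ext i; simp [mul_add]
  map_smul' c f := by ext i; simp [mul_left_comm]

/-- The creation operator `A†_a`: `A†_a |μ, ν⟩ = √(μ_a + 1) |μ + e_a, ν⟩`. -/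
def opAdag {n : ℕ} (a : Fin n) : Module.End ℂ (Coeff n) where
  toFun f := fun i => (Real.sqrt (i.1 a) : ℂ) * f (i.1 - Pi.single a 1, i.2)
  map_add' f g := by ext i; simp [mul_add]
  map_smul' c f := by ext i; simp [mul_left_comm]

/-- The annihilation operator `B_a`. -/
def opB {n : ℕ} (a : Fin n) : Module.End ℂ (Coeff n) where
  toFun f := fun i => (Real.sqrt (i.2 a + 1) : ℂ) * f (i.1, i.2 + Pi.single a 1)
  map_add' f g := by ext i; simp [mul_add]
  map_smul' c f := by ext i; simp [mul_left_comm]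

/-- The creation operator `B†_a`. -/
def opBdag {n : ℕ} (a : Fin n) : Module.End ℂ (Coeff n) where
  toFun f := fun i => (Real.sqrt (i.2 a) : ℂ) * f (i.1, i.2 - Pi.single a 1)
  map_add' f g := by ext i; simp [mul_add]
  map_smul' c f := by ext i; simp [mul_left_comm]

/-- `E_ab = A†_a A_b + B†_a B_b + δ_ab`. -/
def opE {n : ℕ} (a b : Fin n) : Module.End ℂ (Coeff n) :=
  opAdag a * opA b + opBdag a * opB b + if a = b then 1 else 0

/-- `F_ab = B_a A_b - A_a B_b`. -/
def opF {n : ℕ} (a b : Fin n) : Module.End ℂ (Coeff n) :=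
  opB a * opA b - opA a * opB b

/-- `F̃_ab = B†_a A†_b - A†_a B†_b`. -/
def opFt {n : ℕ} (a b : Fin n) : Module.End ℂ (Coeff n) :=
  opBdag a * opAdag b - opAdag a * opBdag b

/-- `E_α = ∑ α_ab E_ab`. -/
def opESum {n : ℕ} (α : Matrix (Fin n) (Fin n) ℂ) : Module.End ℂ (Coeff n) :=
  ∑ a, ∑ b, α a b • opE a b

/-- `F_z = ∑ conj(z_ab) F_ab`. -/
def opFSum {n : ℕ} (z : Matrix (Fin n) (Fin n) ℂ) : Module.End ℂ (Coeff n) :=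
  ∑ a, ∑ b, conj (z a b) • opF a b

/-- `F̃_z = ∑ z_ab F̃_ab`. -/
def opFtSum {n : ℕ} (z : Matrix (Fin n) (Fin n) ℂ) : Module.End ℂ (Coeff n) :=
  ∑ a, ∑ b, z a b • opFt a b

/-- Total angular momentum, `J_z = ½ ∑ (A†_a A_a - B†_a B_a)`. -/
def opJz (n : ℕ) : Module.End ℂ (Coeff n) :=
  (1 / 2 : ℂ) • ∑ a, (opAdag a * opA a - opBdag a * opB a)

/-- Total angular momentum, `J_+ = ∑ A†_a B_a`. -/
def opJplus (n : ℕ) : Module.End ℂ (Coeff n) := ∑ a, opAdag a * opB a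

/-- Total angular momentum, `J_- = ∑ B†_a A_a`. -/
def opJminus (n : ℕ) : Module.End ℂ (Coeff n) := ∑ a, opBdag a * opA a

/-- The Hilbert space of all `n`-valent `SU(2)` intertwiners: the vectors annihilated by the total
angular momentum. -/
def intertwiners (n : ℕ) : Submodule ℂ (Fock n) where
  carrier := {ψ | opJz n ψ = 0 ∧ opJplus n ψ = 0 ∧ opJminus n ψ = 0}
  add_mem' := by
    rintro ψ φ ⟨h1, h2, h3⟩ ⟨k1, k2, k3⟩
    refine ⟨?_, ?_, ?_⟩ <;> rw [lp.coeFn_add, map_add] <;> simp [*]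
  zero_mem' := by
    refine ⟨?_, ?_, ?_⟩ <;> rw [lp.coeFn_zero, map_zero]
  smul_mem' := by
    rintro c ψ ⟨h1, h2, h3⟩
    refine ⟨?_, ?_, ?_⟩ <;> rw [lp.coeFn_smul, map_smul] <;> simp [*]

open Classical in
/-- The vector with the given coefficients. It is meant for square-summable `f` only (the value is
`0` for all others). -/
def toFock {n : ℕ} (f : Coeff n) : Fock n :=
  if h : Memℓp f 2 then ⟨f, h⟩ else 0

/-- Coefficients of the vacuum `|0⟩ = |0, 0⟩`. -/
def vacuum (n : ℕ) : Coeff n := Pi.single 0 1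

/-- The bounded symmetric domain `Ω_n` of antisymmetric `ζ` with `ζ* ζ < 1`. -/
def domain (n : ℕ) : Set (Matrix (Fin n) (Fin n) ℂ) :=
  {ζ | ζᵀ = -ζ ∧ (1 - ζᴴ * ζ).PosDef}

/-- Coefficients of `(½ F̃_ζ)^k |0⟩` (only finitely many are non-zero). -/
def expTerm {n : ℕ} (ζ : Matrix (Fin n) (Fin n) ℂ) (k : ℕ) : Coeff n :=
  (((1 / 2 : ℂ) • opFtSum ζ) ^ k) (vacuum n)

/-- `det (1 - ζ* ζ)^{1/2}` (the determinant is a positive real number for `ζ ∈ Ω_n`). -/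
def normFactor {n : ℕ} (ζ : Matrix (Fin n) (Fin n) ℂ) : ℝ :=
  Real.sqrt (1 - ζᴴ * ζ).det.re

/-- The state `|ζ⟩ = det (1 - ζ* ζ)^{1/2} exp (½ F̃_ζ) |0⟩`, the exponential being the norm
convergent series `∑ (1 / k!) (½ F̃_ζ)^k |0⟩`. -/
def ket {n : ℕ} (ζ : Matrix (Fin n) (Fin n) ℂ) : Fock n :=
  (normFactor ζ : ℂ) • ∑' k : ℕ, ((k.factorial : ℂ)⁻¹) • toFock (expTerm ζ k)

/-- The Hermitian form of signature `(n, n)`. -/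
def hermForm (n : ℕ) : Matrix (Fin n ⊕ Fin n) (Fin n ⊕ Fin n) ℂ :=
  Matrix.fromBlocks 1 0 0 (-1)

/-- The symmetric bilinear form `∑ (x_a y_{n+a} + y_a x_{n+a})`. -/
def symmForm (n : ℕ) : Matrix (Fin n ⊕ Fin n) (Fin n ⊕ Fin n) ℂ :=
  Matrix.fromBlocks 0 1 1 0

/-- The group `SO*(2n)`: determinant `1`, preserving both forms. -/
def SOStar (n : ℕ) : Subgroup (Matrix.SpecialLinearGroup (Fin n ⊕ Fin n) ℂ) where
  carrier := {g | g.1ᴴ * hermForm n * g.1 = hermForm n ∧ g.1ᵀ * symmForm n * g.1 = symmForm n}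
  mul_mem' := by
    rintro g h ⟨g1, g2⟩ ⟨h1, h2⟩
    refine ⟨?_, ?_⟩
    · calc (g * h).1ᴴ * hermForm n * (g * h).1
          = h.1ᴴ * (g.1ᴴ * hermForm n * g.1) * h.1 := by
            simp [Matrix.SpecialLinearGroup.coe_mul, Matrix.conjTranspose_mul, Matrix.mul_assoc]
        _ = hermForm n := by rw [g1, h1]
    · calc (g * h).1ᵀ * symmForm n * (g * h).1
          = h.1ᵀ * (g.1ᵀ * symmForm n * g.1) * h.1 := by
            simp [Matrix.SpecialLinearGroup.coe_mul, Matrix.transpose_mul, Matrix.mul_assoc]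
        _ = symmForm n := by rw [g2, h2]
  one_mem' := by simp
  inv_mem' := by
    rintro g ⟨g1, g2⟩
    have hg : g.1 * (g⁻¹).1 = 1 := by
      rw [← Matrix.SpecialLinearGroup.coe_mul, mul_inv_cancel, Matrix.SpecialLinearGroup.coe_one]
    refine ⟨?_, ?_⟩
    · calc (g⁻¹).1ᴴ * hermForm n * (g⁻¹).1
          = (g⁻¹).1ᴴ * (g.1ᴴ * hermForm n * g.1) * (g⁻¹).1 := by rw [g1]
        _ = (g.1 * (g⁻¹).1)ᴴ * hermForm n * (g.1 * (g⁻¹).1) := by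
            simp only [Matrix.conjTranspose_mul, Matrix.mul_assoc]
        _ = hermForm n := by rw [hg]; simp
    · calc (g⁻¹).1ᵀ * symmForm n * (g⁻¹).1
          = (g⁻¹).1ᵀ * (g.1ᵀ * symmForm n * g.1) * (g⁻¹).1 := by rw [g2]
        _ = (g.1 * (g⁻¹).1)ᵀ * symmForm n * (g.1 * (g⁻¹).1) := by
            simp only [Matrix.transpose_mul, Matrix.mul_assoc]
        _ = symmForm n := by rw [hg]; simp

/-- The matrix of an element of `SO*(2n)`. -/
def mat {n : ℕ} (g : SOStar n) : Matrix (Fin n ⊕ Fin n) (Fin n ⊕ Fin n) ℂ := g.1.1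

/-- The element of the Lie algebra `so*(2n)` with blocks `X`, `Y`, `-conj Y`, `conj X`, where
`X* = -X` and `Yᵀ = -Y`. -/
def lieMat {n : ℕ} (X Y : Matrix (Fin n) (Fin n) ℂ) :
    Matrix (Fin n ⊕ Fin n) (Fin n ⊕ Fin n) ℂ :=
  Matrix.fromBlocks X Y (-(Y.map conj)) (X.map conj)

/-- The operator that represents `lieMat X Y`: since this matrix is
`E_X + ½ F̃_Y - ½ F_Y` in terms of the matrices `E_ab = (Δ_ab, 0; 0, -Δ_ba)`,
`F_ab = (0, 0; Δ_ab - Δ_ba, 0)`, `F̃_ab = (0, Δ_ab - Δ_ba; 0, 0)`, it is the same combination of the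
oscillator operators. -/
def lieOp {n : ℕ} (X Y : Matrix (Fin n) (Fin n) ℂ) : Module.End ℂ (Coeff n) :=
  opESum X + (1 / 2 : ℂ) • opFtSum Y - (1 / 2 : ℂ) • opFSum Y

/-- `π` is a (strongly continuous) unitary representation of `SO*(2n)` on the Hilbert space of
intertwiners whose infinitesimal action, on the intertwiners with finitely many non-zero
coefficients, is the one of the oscillator operators `E_ab`, `F_ab`, `F̃_ab`. -/
structure IsIntertwinerRep {n : ℕ} (π : SOStar n →* (intertwiners n ≃ₗᵢ[ℂ] intertwiners n)) :
    Prop where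
  continuous : ∀ ψ : intertwiners n, Continuous fun g : SOStar n => π g ψ
  hasDerivAt : ∀ X Y : Matrix (Fin n) (Fin n) ℂ, Xᴴ = -X → Yᵀ = -Y →
    ∀ γ : ℝ → SOStar n, (∀ t : ℝ, mat (γ t) = NormedSpace.exp ((t : ℂ) • lieMat X Y)) →
    ∀ ψ : intertwiners n, (Function.support (ψ : Fock n)).Finite →
      HasDerivAt (fun t : ℝ => ((π (γ t) ψ : intertwiners n) : Fock n))
        (toFock (lieOp X Y (ψ : Fock n))) 0

/-- `g = g_ζ`, the matrix with blocks `X`, `ζ conj X`, `ζ* X`, `conj X`, where `X` is the positive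
semi-definite square root of `(1 - ζ ζ*)⁻¹`; it represents the coset of `ζ` in `SO*(2n) / U(n)`. -/
def IsSection {n : ℕ} (ζ : Matrix (Fin n) (Fin n) ℂ) (g : SOStar n) : Prop :=
  ∃ X : Matrix (Fin n) (Fin n) ℂ, X.PosSemidef ∧ X * X = (1 - ζ * ζᴴ)⁻¹ ∧
    mat g = Matrix.fromBlocks X (ζ * X.map conj) (ζᴴ * X) (X.map conj)

/-- The denominator `C ζ + D` of the action of `g = (A, B; C, D)` on `ζ`. -/
def denom {n : ℕ} (g : SOStar n) (ζ : Matrix (Fin n) (Fin n) ℂ) : Matrix (Fin n) (Fin n) ℂ :=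
  (mat g).toBlocks₂₁ * ζ + (mat g).toBlocks₂₂

/-- The action `g(ζ) = (A ζ + B) (C ζ + D)⁻¹`. -/
def act {n : ℕ} (g : SOStar n) (ζ : Matrix (Fin n) (Fin n) ℂ) : Matrix (Fin n) (Fin n) ℂ :=
  ((mat g).toBlocks₁₁ * ζ + (mat g).toBlocks₁₂) * (denom g ζ)⁻¹

/-- `⟨ω|T|ζ⟩ = c`: the state `|ζ⟩` lies in the domain of `T`, and the inner product of `|ω⟩` with
`T |ζ⟩` is `c`. -/
def MatrixElementEq {n : ℕ} (ω : Matrix (Fin n) (Fin n) ℂ) (T : Module.End ℂ (Coeff n))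
    (ζ : Matrix (Fin n) (Fin n) ℂ) (c : ℂ) : Prop :=
  Memℓp (T (ket ζ)) 2 ∧ inner ℂ (ket ω) (toFock (T (ket ζ))) = c

end SOStarCoherent

end

open SOStarCoherent

open scoped Matrix ComplexConjugate ComplexOrder

noncomputable section

namespace SOStarCoherent

variable {n : ℕ}

/-! ### Canonical commutation relations on families of coefficients -/

/-! For antisymmetric `ζ` the operator `½ F̃_ζ` is `raise ζ = ∑ ζ_cd B†_c A†_d`. Its commutators
with `A_a` and `B_a` are linear in the creation operators and commute with `raise ζ`, so the
exponential vector `e_ζ = exp(raise ζ)|0⟩` satisfies `A_a e_ζ = ∑ ζ_ca B†_c e_ζ` and `B_a e_ζ = ∑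
ζ_ad A†_d e_ζ` (`opA_expFam`, `opB_expFam`). Everything else is extracted from these two relations.

Overlaps. Let `K_k` be the overlap of the degree `k` parts of `e_ω` and `e_ζ`, and `P_k` the matrix
of overlaps of these parts raised by `A†_a`, `A†_b`. The relations give `P_{k+1} = K_{k+1} + P_k
ζω*`. The trace of `P_k ζω*` is an expectation of the number operator, whence `(k+1) K_{k+1} =
∑_{i+j=k} K_i tr (ζω*)^{j+1}`. This is the recursion for the coefficients of `1 / det(1 - X ζω*)`,
by Jacobi's formula (`mk_mul_charpolyRev`), and setting `X = 1` gives the kernel `1 / det(1 - ω*ζ)`.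
Convergence follows from `(k+1)‖u_{k+1}‖² ≤ ρ (k+n)‖u_k‖²` with `ρ < 1`, where `u_k` is the degree
`k` part of `e_ζ`.

Matrix elements. Every generator maps `e_ζ` to `raise M e_ζ + x e_ζ`, so only the matrix `⟨ω|B†_c
A†_d|ζ⟩` is needed; it is obtained by summing the recursion for `P_k` (`raisedOverlap_mul`).

Representation. Let `g` send `e_ζ` to `det(Cζ+D)⁻¹ e_{g(ζ)}`. Invariance of the Hermitian form gives
`1 - ω*ζ = (Cω+D)* (1 - g(ω)* g(ζ)) (Cζ+D)`, so Gram matrices are preserved (`inner_transVec`).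
Since the `e_ζ` are total in the intertwiners, this extends to a unitary operator, and the cocycle
law of the denominators makes it a homomorphism. Totality (`eq_zero_of_inner_expFock`) is proved
degree by degree with the Capelli-type identity `sum_opFt_mul_opF`.

The infinitesimal action is first computed coefficient by coefficient on `e_ζ`, then moved to
finitely supported `ψ` by formal skew-adjointness. This yields a weak derivative that is continuous
in `t`, hence a strong one (`hasDerivAt_of_inner`). -/

lemma opA_apply (a : Fin n) (f : Coeff n) (i : Occ n) :
    opA a f i = (Real.sqrt (i.1 a + 1) : ℂ) * f (i.1 + Pi.single a 1, i.2) := rfl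

lemma opAdag_apply (a : Fin n) (f : Coeff n) (i : Occ n) :
    opAdag a f i = (Real.sqrt (i.1 a) : ℂ) * f (i.1 - Pi.single a 1, i.2) := rfl

lemma opB_apply (a : Fin n) (f : Coeff n) (i : Occ n) :
    opB a f i = (Real.sqrt (i.2 a + 1) : ℂ) * f (i.1, i.2 + Pi.single a 1) := rfl

lemma opBdag_apply (a : Fin n) (f : Coeff n) (i : Occ n) :
    opBdag a f i = (Real.sqrt (i.2 a) : ℂ) * f (i.1, i.2 - Pi.single a 1) := rfl

lemma sqrt_mul_self_natCast (k : ℕ) : (Real.sqrt k : ℂ) * (Real.sqrt k : ℂ) = k := by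
  rw [← Complex.ofReal_mul, Real.mul_self_sqrt (Nat.cast_nonneg k), Complex.ofReal_natCast]

lemma sqrt_mul_self_natCast_add_one (k : ℕ) :
    (Real.sqrt (k + 1) : ℂ) * (Real.sqrt (k + 1) : ℂ) = k + 1 := by
  have := sqrt_mul_self_natCast (k + 1)
  push_cast at this
  exact this

lemma add_single_sub_single_comm (μ : Fin n → ℕ) {a b : Fin n} (h : a ≠ b) :
    μ + Pi.single a 1 - Pi.single b 1 = μ - Pi.single b 1 + Pi.single a 1 := by
  ext c
  by_cases hca : c = a
  · subst hca; simp [h]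
  · simp [hca]

/-- Subtraction of occupation numbers is truncated, so the mode has to be occupied. An unoccupied
mode does no harm in the creation operators, because the factor `√0` kills the junk index. -/
lemma sub_single_add_single (μ : Fin n → ℕ) {a : Fin n} (h : μ a ≠ 0) :
    μ - Pi.single a 1 + Pi.single a 1 = μ := by
  ext c
  by_cases hca : c = a
  · subst hca; simp; omega
  · simp [hca]

lemma add_single_sub_single (μ : Fin n → ℕ) (a : Fin n) :
    μ + Pi.single a 1 - Pi.single a 1 = μ := by
  ext c; simp

lemma opAdag_mul_opA_apply (a : Fin n) (f : Coeff n) (i : Occ n) :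
    opAdag a (opA a f) i = i.1 a * f i := by
  rw [opAdag_apply, opA_apply]
  by_cases h : i.1 a = 0
  · simp [h]
  · have h1 : (((i.1 - Pi.single a 1 : Fin n → ℕ) a : ℕ) : ℝ) + 1 = i.1 a := by
      have : (i.1 - Pi.single a 1 : Fin n → ℕ) a + 1 = i.1 a := by simp; omega
      exact_mod_cast this
    simp only [h1, sub_single_add_single _ h]
    rw [← mul_assoc, sqrt_mul_self_natCast]

lemma opBdag_mul_opB_apply (a : Fin n) (f : Coeff n) (i : Occ n) :
    opBdag a (opB a f) i = i.2 a * f i := by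
  rw [opBdag_apply, opB_apply]
  by_cases h : i.2 a = 0
  · simp [h]
  · have h1 : (((i.2 - Pi.single a 1 : Fin n → ℕ) a : ℕ) : ℝ) + 1 = i.2 a := by
      have : (i.2 - Pi.single a 1 : Fin n → ℕ) a + 1 = i.2 a := by simp; omega
      exact_mod_cast this
    simp only [h1, sub_single_add_single _ h]
    rw [← mul_assoc, sqrt_mul_self_natCast]

lemma opA_mul_opAdag (a b : Fin n) :
    opA a * opAdag b = opAdag b * opA a + if a = b then 1 else 0 := by
  ext f i
  by_cases h : a = b
  · subst h
    simp only [if_true, LinearMap.add_apply, Module.End.mul_apply, Pi.add_apply,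
      opAdag_mul_opA_apply, Module.End.one_apply]
    rw [opA_apply, opAdag_apply]
    simp only [add_single_sub_single, Pi.add_apply, Pi.single_eq_same, Nat.cast_add, Nat.cast_one]
    rw [← mul_assoc, sqrt_mul_self_natCast_add_one]
    ring
  · simp only [if_neg h, add_zero, Module.End.mul_apply]
    rw [opA_apply, opAdag_apply, opAdag_apply, opA_apply]
    simp only [add_single_sub_single_comm _ h, Pi.add_apply, Pi.sub_apply, Pi.single_eq_of_ne h,
      Pi.single_eq_of_ne (Ne.symm h), Nat.sub_zero, Nat.add_zero]
    ring

lemma opB_mul_opBdag (a b : Fin n) :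
    opB a * opBdag b = opBdag b * opB a + if a = b then 1 else 0 := by
  ext f i
  by_cases h : a = b
  · subst h
    simp only [if_true, LinearMap.add_apply, Module.End.mul_apply, Pi.add_apply,
      opBdag_mul_opB_apply, Module.End.one_apply]
    rw [opB_apply, opBdag_apply]
    simp only [add_single_sub_single, Pi.add_apply, Pi.single_eq_same, Nat.cast_add, Nat.cast_one]
    rw [← mul_assoc, sqrt_mul_self_natCast_add_one]
    ring
  · simp only [if_neg h, add_zero, Module.End.mul_apply]
    rw [opB_apply, opBdag_apply, opBdag_apply, opB_apply]
    simp only [add_single_sub_single_comm _ h, Pi.add_apply, Pi.sub_apply, Pi.single_eq_of_ne h,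
      Pi.single_eq_of_ne (Ne.symm h), Nat.sub_zero, Nat.add_zero]
    ring

lemma commute_opA_opB (a b : Fin n) : Commute (opA a) (opB b) := by
  ext f i
  simp only [Module.End.mul_apply, opA_apply, opB_apply]
  ring

lemma commute_opA_opBdag (a b : Fin n) : Commute (opA a) (opBdag b) := by
  ext f i
  simp only [Module.End.mul_apply, opA_apply, opBdag_apply]
  ring

lemma commute_opAdag_opB (a b : Fin n) : Commute (opAdag a) (opB b) := by
  ext f i
  simp only [Module.End.mul_apply, opAdag_apply, opB_apply]
  ring

lemma commute_opAdag_opBdag (a b : Fin n) : Commute (opAdag a) (opBdag b) := by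
  ext f i
  simp only [Module.End.mul_apply, opAdag_apply, opBdag_apply]
  ring

lemma commute_opA_opA (a b : Fin n) : Commute (opA a) (opA b) := by
  by_cases h : a = b
  · subst h; rfl
  ext f i
  simp only [Module.End.mul_apply, opA_apply, Pi.add_apply, Pi.single_eq_of_ne h,
    Pi.single_eq_of_ne (Ne.symm h), Nat.add_zero, add_right_comm i.1 (Pi.single a 1)]
  ring

lemma commute_opB_opB (a b : Fin n) : Commute (opB a) (opB b) := by
  by_cases h : a = b
  · subst h; rfl
  ext f i
  simp only [Module.End.mul_apply, opB_apply, Pi.add_apply, Pi.single_eq_of_ne h,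
    Pi.single_eq_of_ne (Ne.symm h), Nat.add_zero, add_right_comm i.2 (Pi.single a 1)]
  ring

lemma commute_opAdag_opAdag (a b : Fin n) : Commute (opAdag a) (opAdag b) := by
  by_cases h : a = b
  · subst h; rfl
  ext f i
  simp only [Module.End.mul_apply, opAdag_apply, Pi.sub_apply, Pi.single_eq_of_ne h,
    Pi.single_eq_of_ne (Ne.symm h), Nat.sub_zero, tsub_right_comm (b := Pi.single a 1)]
  ring

lemma commute_opBdag_opBdag (a b : Fin n) : Commute (opBdag a) (opBdag b) := by
  by_cases h : a = b
  · subst h; rfl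
  ext f i
  simp only [Module.End.mul_apply, opBdag_apply, Pi.sub_apply, Pi.single_eq_of_ne h,
    Pi.single_eq_of_ne (Ne.symm h), Nat.sub_zero, tsub_right_comm (b := Pi.single a 1)]
  ring

lemma opA_vacuum (a : Fin n) : opA a (vacuum n) = 0 := by
  ext i
  rw [opA_apply, vacuum, Pi.single_eq_of_ne]
  · simp
  · intro h
    have := congrFun (congrArg Prod.fst h) a
    simp at this

lemma opB_vacuum (a : Fin n) : opB a (vacuum n) = 0 := by
  ext i
  rw [opB_apply, vacuum, Pi.single_eq_of_ne]
  · simp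
  · intro h
    have := congrFun (congrArg Prod.snd h) a
    simp at this

/-! ### The raising operator of a matrix -/

/-- `∑ Z_cd B†_c A†_d`; it equals `½ F̃_Z` when `Z` is antisymmetric. -/
def raise (Z : Matrix (Fin n) (Fin n) ℂ) : Module.End ℂ (Coeff n) :=
  ∑ c, ∑ d, Z c d • (opBdag c * opAdag d)

/-- Relabelling the indices and using antisymmetry, both halves of `F̃_ab` contribute the same sum;
this accounts for the factor `½`. -/
lemma half_opFtSum {Z : Matrix (Fin n) (Fin n) ℂ} (hZ : Zᵀ = -Z) :
    (1 / 2 : ℂ) • opFtSum Z = raise Z := by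
  have h : opFtSum Z = raise Z + raise Z := by
    have hs : ∑ a, ∑ b, Z a b • (opAdag a * opBdag b : Module.End ℂ (Coeff n)) = - raise Z := by
      rw [Finset.sum_comm, raise]
      simp only [← Finset.sum_neg_distrib]
      refine Finset.sum_congr rfl fun c _ => Finset.sum_congr rfl fun d _ => ?_
      have : Z d c = - Z c d := congrFun (congrFun hZ c) d
      rw [this, (commute_opAdag_opBdag d c).eq]
      exact neg_smul (Z c d) (opBdag c * opAdag d : Module.End ℂ (Coeff n))
    unfold opFtSum opFt
    simp only [smul_sub, Finset.sum_sub_distrib]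
    rw [hs, sub_neg_eq_add, raise]
  rw [h, ← two_smul ℂ (raise Z), smul_smul]
  norm_num

lemma raise_add (Z W : Matrix (Fin n) (Fin n) ℂ) : raise (Z + W) = raise Z + raise W := by
  simp [raise, add_smul, Finset.sum_add_distrib]

lemma raise_smul (s : ℂ) (Z : Matrix (Fin n) (Fin n) ℂ) : raise (s • Z) = s • raise Z := by
  simp [raise, Finset.smul_sum, mul_smul]

lemma commute_raise {T : Module.End ℂ (Coeff n)} (Z : Matrix (Fin n) (Fin n) ℂ)
    (hA : ∀ a, Commute T (opAdag a)) (hB : ∀ a, Commute T (opBdag a)) : Commute T (raise Z) :=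
  Commute.sum_right _ _ _ fun c _ => Commute.sum_right _ _ _ fun d _ =>
    ((hB c).mul_right (hA d)).smul_right _

lemma commute_opAdag_raise (a : Fin n) (Z : Matrix (Fin n) (Fin n) ℂ) :
    Commute (opAdag a) (raise Z) :=
  commute_raise Z (commute_opAdag_opAdag a) (commute_opAdag_opBdag a)

lemma commute_opBdag_raise (a : Fin n) (Z : Matrix (Fin n) (Fin n) ℂ) :
    Commute (opBdag a) (raise Z) :=
  commute_raise Z (fun b => (commute_opAdag_opBdag b a).symm) (commute_opBdag_opBdag a)

lemma commute_raise_raise (Z W : Matrix (Fin n) (Fin n) ℂ) : Commute (raise Z) (raise W) :=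
  commute_raise W (fun a => (commute_opAdag_raise a Z).symm)
    (fun a => (commute_opBdag_raise a Z).symm)

/-- Only the commutator of `A_a` with `A†_d` survives. What remains consists of creation operators,
which again commute with `raise Z`; this is what makes the exponential computable. -/
lemma opA_mul_raise (a : Fin n) (Z : Matrix (Fin n) (Fin n) ℂ) :
    opA a * raise Z = raise Z * opA a + ∑ c, Z c a • opBdag c := by
  have h : ∀ c d, opA a * (opBdag c * opAdag d)
      = (opBdag c * opAdag d) * opA a + if a = d then opBdag c else 0 := by
    intro c d
    rw [← mul_assoc, (commute_opA_opBdag a c).eq, mul_assoc, opA_mul_opAdag, mul_add, mul_assoc]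
    split_ifs <;> simp
  simp only [raise, Finset.mul_sum, Finset.sum_mul, mul_smul_comm, smul_mul_assoc, h, smul_add,
    Finset.sum_add_distrib]
  simp

lemma opB_mul_raise (a : Fin n) (Z : Matrix (Fin n) (Fin n) ℂ) :
    opB a * raise Z = raise Z * opB a + ∑ d, Z a d • opAdag d := by
  have h : ∀ c d, opB a * (opBdag c * opAdag d)
      = (opBdag c * opAdag d) * opB a + if a = c then opAdag d else 0 := by
    intro c d
    rw [← mul_assoc, opB_mul_opBdag, add_mul, mul_assoc, ← (commute_opAdag_opB d a).eq, mul_assoc]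
    split_ifs <;> simp
  simp only [raise, Finset.mul_sum, Finset.sum_mul, mul_smul_comm, smul_mul_assoc, h, smul_add,
    Finset.sum_add_distrib]
  rw [Finset.sum_comm (f := fun c d => Z c d • if a = c then opAdag d else 0)]
  simp

/-- The Leibniz rule `[x, y^{k+1}] = (k+1) y^k [x, y]`, valid because the commutator commutes with
`y`. -/
lemma mul_pow_succ_of_commutator {R : Type*} [Ring R] {x y z : R} (h : x * y = y * x + z)
    (hz : Commute z y) (k : ℕ) :
    x * y ^ (k + 1) = y ^ (k + 1) * x + (k + 1) • (y ^ k * z) := by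
  induction k with
  | zero => simp [h]
  | succ k ih =>
    rw [pow_succ y (k + 1), ← mul_assoc, ih, add_mul, mul_assoc, h, mul_add, smul_mul_assoc,
      mul_assoc, hz.eq, ← mul_assoc, ← mul_assoc, ← pow_succ, ← pow_succ, add_smul (k + 1) 1,
      one_smul]
    abel

/-- The term of degree `k` of the exponential series applied to the vacuum. -/
def expCoeff (Z : Matrix (Fin n) (Fin n) ℂ) (k : ℕ) : Coeff n :=
  (k.factorial : ℂ)⁻¹ • (raise Z ^ k) (vacuum n)

lemma expCoeff_zero (Z : Matrix (Fin n) (Fin n) ℂ) : expCoeff Z 0 = vacuum n := by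
  simp [expCoeff]

lemma expTerm_eq {Z : Matrix (Fin n) (Fin n) ℂ} (hZ : Zᵀ = -Z) (k : ℕ) :
    (k.factorial : ℂ)⁻¹ • expTerm Z k = expCoeff Z k := by
  rw [expTerm, half_opFtSum hZ, expCoeff]

lemma raise_expCoeff (Z : Matrix (Fin n) (Fin n) ℂ) (k : ℕ) :
    raise Z (expCoeff Z k) = ((k : ℂ) + 1) • expCoeff Z (k + 1) := by
  rw [expCoeff, expCoeff, map_smul, ← Module.End.mul_apply, ← pow_succ', smul_smul]
  congr 1
  rw [Nat.factorial_succ]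
  have : ((k : ℂ) + 1) ≠ 0 := by exact_mod_cast k.succ_ne_zero
  push_cast
  field_simp

/-- The Leibniz factor `k + 1` cancels against the factorial, and the term in which `T` reaches the
vacuum drops out. -/
lemma lower_expCoeff {T S : Module.End ℂ (Coeff n)} {Z : Matrix (Fin n) (Fin n) ℂ}
    (h : T * raise Z = raise Z * T + S) (hS : Commute S (raise Z)) (hT : T (vacuum n) = 0)
    (k : ℕ) : T (expCoeff Z (k + 1)) = S (expCoeff Z k) := by
  rw [expCoeff, expCoeff, map_smul, map_smul, ← Module.End.mul_apply,
    mul_pow_succ_of_commutator h hS, ← (hS.pow_right k).eq, LinearMap.add_apply,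
    Module.End.mul_apply, hT, map_zero, zero_add, LinearMap.smul_apply, Module.End.mul_apply,
    ← Nat.cast_smul_eq_nsmul ℂ, smul_smul]
  congr 1
  rw [Nat.factorial_succ]
  have : ((k : ℂ) + 1) ≠ 0 := by exact_mod_cast k.succ_ne_zero
  push_cast
  field_simp

lemma opA_expCoeff_succ (a : Fin n) (Z : Matrix (Fin n) (Fin n) ℂ) (k : ℕ) :
    opA a (expCoeff Z (k + 1)) = ∑ c, Z c a • opBdag c (expCoeff Z k) := by
  rw [lower_expCoeff (opA_mul_raise a Z) _ (opA_vacuum a)]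
  · simp
  · exact Commute.sum_left _ _ _ fun c _ => (commute_opBdag_raise c Z).smul_left _

lemma opB_expCoeff_succ (a : Fin n) (Z : Matrix (Fin n) (Fin n) ℂ) (k : ℕ) :
    opB a (expCoeff Z (k + 1)) = ∑ d, Z a d • opAdag d (expCoeff Z k) := by
  rw [lower_expCoeff (opB_mul_raise a Z) _ (opB_vacuum a)]
  · simp
  · exact Commute.sum_left _ _ _ fun c _ => (commute_opAdag_raise c Z).smul_left _

lemma expCoeff_smul (s : ℂ) (Z : Matrix (Fin n) (Fin n) ℂ) (k : ℕ) :
    expCoeff (s • Z) k = s ^ k • expCoeff Z k := by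
  rw [expCoeff, expCoeff, raise_smul, smul_pow, LinearMap.smul_apply, smul_comm]

/-! ### Invariance under `SU(2)` -/

/-- `J_+` turns the `B†` of each pair into an `A†`. The remainder contracts `Z` with an expression
symmetric in its indices, so it vanishes for antisymmetric `Z`. -/
lemma commutator_opJplus_raise (Z : Matrix (Fin n) (Fin n) ℂ) :
    opJplus n * raise Z = raise Z * opJplus n + ∑ c, ∑ d, Z c d • (opAdag c * opAdag d) := by
  simp only [opJplus, Finset.sum_mul, mul_assoc, opB_mul_raise, mul_add, Finset.sum_add_distrib]
  congr 1
  · rw [Finset.mul_sum]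
    refine Finset.sum_congr rfl fun c _ => ?_
    rw [← mul_assoc, (commute_opAdag_raise c Z).eq, mul_assoc]
  · simp [Finset.mul_sum]

lemma commutator_opJminus_raise (Z : Matrix (Fin n) (Fin n) ℂ) :
    opJminus n * raise Z = raise Z * opJminus n + ∑ d, ∑ c, Z c d • (opBdag d * opBdag c) := by
  simp only [opJminus, Finset.sum_mul, mul_assoc, opA_mul_raise, mul_add, Finset.sum_add_distrib]
  congr 1
  · rw [Finset.mul_sum]
    refine Finset.sum_congr rfl fun c _ => ?_
    rw [← mul_assoc, (commute_opBdag_raise c Z).eq, mul_assoc]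
  · simp [Finset.mul_sum]

lemma sum_antisymm_smul {M : Type*} [AddCommGroup M] [Module ℂ M]
    {Z : Matrix (Fin n) (Fin n) ℂ} (hZ : Zᵀ = -Z) (f : Fin n → Fin n → M)
    (hf : ∀ a b, f a b = f b a) : ∑ a, ∑ b, Z a b • f a b = 0 := by
  have h : ∑ a, ∑ b, Z a b • f a b = - ∑ a, ∑ b, Z a b • f a b := by
    conv_lhs => rw [Finset.sum_comm]
    simp only [← Finset.sum_neg_distrib]
    refine Finset.sum_congr rfl fun c _ => Finset.sum_congr rfl fun d _ => ?_
    have : Z d c = - Z c d := congrFun (congrFun hZ c) d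
    rw [this, hf]
    exact neg_smul _ _
  have h2 : (2 : ℂ) • ∑ a, ∑ b, Z a b • f a b = 0 := by
    rw [two_smul]
    nth_rewrite 1 [h]
    exact neg_add_cancel _
  exact (smul_eq_zero.mp h2).resolve_left two_ne_zero

lemma commute_opJplus_raise {Z : Matrix (Fin n) (Fin n) ℂ} (hZ : Zᵀ = -Z) :
    Commute (opJplus n) (raise Z) := by
  rw [commute_iff_eq, commutator_opJplus_raise,
    sum_antisymm_smul hZ _ (fun a b => (commute_opAdag_opAdag a b).eq), add_zero]

lemma commute_opJminus_raise {Z : Matrix (Fin n) (Fin n) ℂ} (hZ : Zᵀ = -Z) :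
    Commute (opJminus n) (raise Z) := by
  rw [commute_iff_eq, commutator_opJminus_raise, Finset.sum_comm,
    sum_antisymm_smul hZ _ (fun a b => (commute_opBdag_opBdag b a).eq), add_zero]

/-! ### Finitely supported coefficients and the sesquilinear pairing -/

/-- Families with finitely many non-zero coefficients. -/
def finSupp (n : ℕ) : Submodule ℂ (Coeff n) where
  carrier := {f | (Function.support f).Finite}
  add_mem' hf hg := (Set.Finite.union hf hg).subset (Function.support_add _ _)
  zero_mem' := by simp
  smul_mem' c f hf := Set.Finite.subset hf (Function.support_const_smul_subset c f)

lemma vacuum_mem_finSupp : vacuum n ∈ finSupp n :=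
  (Set.finite_singleton (0 : Occ n)).subset Pi.support_single_subset

/-- Adding one quantum to the oscillator `A_a`. -/
def incA (a : Fin n) (i : Occ n) : Occ n := (i.1 + Pi.single a 1, i.2)

/-- Adding one quantum to the oscillator `B_a`. -/
def incB (a : Fin n) (i : Occ n) : Occ n := (i.1, i.2 + Pi.single a 1)

lemma incA_injective (a : Fin n) : Function.Injective (incA a) := by
  intro i j h
  simp only [incA, Prod.mk.injEq, add_left_inj] at h
  exact Prod.ext h.1 h.2

lemma incB_injective (a : Fin n) : Function.Injective (incB a) := by
  intro i j h
  simp only [incB, Prod.mk.injEq, add_left_inj] at h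
  exact Prod.ext h.1 h.2

lemma mem_range_incA {a : Fin n} {i : Occ n} (h : i.1 a ≠ 0) : i ∈ Set.range (incA a) :=
  ⟨(i.1 - Pi.single a 1, i.2), Prod.ext (sub_single_add_single _ h) rfl⟩

lemma mem_range_incB {a : Fin n} {i : Occ n} (h : i.2 a ≠ 0) : i ∈ Set.range (incB a) :=
  ⟨(i.1, i.2 - Pi.single a 1), Prod.ext rfl (sub_single_add_single _ h)⟩

lemma opAdag_incA (a : Fin n) (f : Coeff n) (i : Occ n) :
    opAdag a f (incA a i) = (Real.sqrt (i.1 a + 1) : ℂ) * f i := by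
  simp [opAdag_apply, incA]

lemma opBdag_incB (a : Fin n) (f : Coeff n) (i : Occ n) :
    opBdag a f (incB a i) = (Real.sqrt (i.2 a + 1) : ℂ) * f i := by
  simp [opBdag_apply, incB]

lemma ne_zero_of_opAdag_ne_zero {a : Fin n} {f : Coeff n} {i : Occ n}
    (h : opAdag a f i ≠ 0) : i.1 a ≠ 0 := by
  rintro h0
  simp [opAdag_apply, h0] at h

lemma ne_zero_of_opBdag_ne_zero {a : Fin n} {f : Coeff n} {i : Occ n}
    (h : opBdag a f i ≠ 0) : i.2 a ≠ 0 := by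
  rintro h0
  simp [opBdag_apply, h0] at h

lemma opA_mem_finSupp {f : Coeff n} (a : Fin n) (hf : f ∈ finSupp n) : opA a f ∈ finSupp n :=
  (Set.Finite.preimage (incA_injective a).injOn hf).subset fun _ hi => right_ne_zero_of_mul hi

lemma opB_mem_finSupp {f : Coeff n} (a : Fin n) (hf : f ∈ finSupp n) : opB a f ∈ finSupp n :=
  (Set.Finite.preimage (incB_injective a).injOn hf).subset fun _ hi => right_ne_zero_of_mul hi

lemma opAdag_mem_finSupp {f : Coeff n} (a : Fin n) (hf : f ∈ finSupp n) :
    opAdag a f ∈ finSupp n := by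
  refine (Set.Finite.image (incA a) hf).subset fun i hi => ?_
  obtain ⟨j, rfl⟩ := mem_range_incA (ne_zero_of_opAdag_ne_zero hi)
  refine ⟨j, ?_, rfl⟩
  rw [Function.mem_support, opAdag_incA] at hi
  exact right_ne_zero_of_mul hi

lemma opBdag_mem_finSupp {f : Coeff n} (a : Fin n) (hf : f ∈ finSupp n) :
    opBdag a f ∈ finSupp n := by
  refine (Set.Finite.image (incB a) hf).subset fun i hi => ?_
  obtain ⟨j, rfl⟩ := mem_range_incB (ne_zero_of_opBdag_ne_zero hi)
  refine ⟨j, ?_, rfl⟩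
  rw [Function.mem_support, opBdag_incB] at hi
  exact right_ne_zero_of_mul hi

lemma raise_mem_finSupp {f : Coeff n} (Z : Matrix (Fin n) (Fin n) ℂ) (hf : f ∈ finSupp n) :
    raise Z f ∈ finSupp n := by
  simp only [raise, LinearMap.sum_apply, LinearMap.smul_apply, Module.End.mul_apply]
  exact Submodule.sum_mem _ fun c _ => Submodule.sum_mem _ fun d _ =>
    Submodule.smul_mem _ _ (opBdag_mem_finSupp c (opAdag_mem_finSupp d hf))

lemma raise_pow_mem_finSupp (Z : Matrix (Fin n) (Fin n) ℂ) (k : ℕ) :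
    (raise Z ^ k) (vacuum n) ∈ finSupp n := by
  induction k with
  | zero => exact vacuum_mem_finSupp
  | succ k ih => rw [pow_succ', Module.End.mul_apply]; exact raise_mem_finSupp Z ih

lemma expCoeff_mem_finSupp (Z : Matrix (Fin n) (Fin n) ℂ) (k : ℕ) : expCoeff Z k ∈ finSupp n :=
  Submodule.smul_mem _ _ (raise_pow_mem_finSupp Z k)

/-- The pairing `∑ conj(f_i) g_i`. -/
def pair (f g : Coeff n) : ℂ := ∑' i, conj (f i) * g i

lemma conj_pair (f g : Coeff n) : conj (pair f g) = pair g f := by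
  rw [pair, Complex.conj_tsum]
  exact tsum_congr fun i => by simp [mul_comm]

/-- Creation shifts the index along `incA`, and reindexing along an injection whose range contains
the support preserves `tsum` even without convergence. Hence the adjunction holds for arbitrary
families. -/
lemma pair_opAdag_right (a : Fin n) (f g : Coeff n) :
    pair f (opAdag a g) = pair (opA a f) g := by
  rw [pair, ← (incA_injective a).tsum_eq
    (fun i hi => mem_range_incA (ne_zero_of_opAdag_ne_zero (right_ne_zero_of_mul hi)))]
  refine tsum_congr fun i => ?_
  rw [opAdag_incA, opA_apply, map_mul, Complex.conj_ofReal, incA]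
  ring

lemma pair_opBdag_right (a : Fin n) (f g : Coeff n) :
    pair f (opBdag a g) = pair (opB a f) g := by
  rw [pair, ← (incB_injective a).tsum_eq
    (fun i hi => mem_range_incB (ne_zero_of_opBdag_ne_zero (right_ne_zero_of_mul hi)))]
  refine tsum_congr fun i => ?_
  rw [opBdag_incB, opB_apply, map_mul, Complex.conj_ofReal, incB]
  ring

lemma pair_opAdag_left (a : Fin n) (f g : Coeff n) :
    pair (opAdag a f) g = pair f (opA a g) := by
  rw [← conj_pair, pair_opAdag_right, conj_pair]

lemma pair_opBdag_left (a : Fin n) (f g : Coeff n) :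
    pair (opBdag a f) g = pair f (opB a g) := by
  rw [← conj_pair, pair_opBdag_right, conj_pair]

lemma summable_pair_of_left {f : Coeff n} (hf : f ∈ finSupp n) (g : Coeff n) :
    Summable fun i => conj (f i) * g i :=
  summable_of_hasFiniteSupport <| Set.Finite.subset hf fun i hi => by
    have := left_ne_zero_of_mul hi
    simpa using this

/-- The pairing with a finitely supported family, as a linear map. -/
def pairRight {f : Coeff n} (hf : f ∈ finSupp n) : Coeff n →ₗ[ℂ] ℂ where
  toFun g := pair f g
  map_add' g h := by
    simp only [pair, Pi.add_apply, mul_add]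
    exact (summable_pair_of_left hf g).tsum_add (summable_pair_of_left hf h)
  map_smul' c g := by
    simp only [pair, Pi.smul_apply, smul_eq_mul, RingHom.id_apply, ← tsum_mul_left]
    exact tsum_congr fun i => by ring

lemma pair_add_right {f : Coeff n} (hf : f ∈ finSupp n) (g h : Coeff n) :
    pair f (g + h) = pair f g + pair f h := (pairRight hf).map_add g h

lemma pair_smul_right (f : Coeff n) (c : ℂ) (g : Coeff n) : pair f (c • g) = c * pair f g := by
  simp only [pair, Pi.smul_apply, smul_eq_mul, ← tsum_mul_left]
  exact tsum_congr fun i => by ring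

lemma pair_sum_right {f : Coeff n} (hf : f ∈ finSupp n) {ι : Type*} (s : Finset ι)
    (g : ι → Coeff n) : pair f (∑ j ∈ s, g j) = ∑ j ∈ s, pair f (g j) :=
  map_sum (pairRight hf) g s

lemma pair_smul_left (c : ℂ) (f g : Coeff n) : pair (c • f) g = conj c * pair f g := by
  rw [← conj_pair, pair_smul_right, map_mul, conj_pair]

lemma pair_sum_left {h : Coeff n} (hh : h ∈ finSupp n) {ι : Type*} (s : Finset ι)
    (f : ι → Coeff n) : pair (∑ j ∈ s, f j) h = ∑ j ∈ s, pair (f j) h := by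
  rw [← conj_pair, pair_sum_right hh, map_sum]
  exact Finset.sum_congr rfl fun j _ => conj_pair _ _

lemma memlp_of_mem_finSupp {f : Coeff n} (hf : f ∈ finSupp n) : Memℓp f 2 := by
  refine memℓp_gen (summable_of_hasFiniteSupport (Set.Finite.subset hf fun i hi => ?_))
  intro h0
  simp [h0] at hi

lemma toFock_coe {f : Coeff n} (hf : Memℓp f 2) : (toFock f : Coeff n) = f := by
  rw [toFock, dif_pos hf]

lemma toFock_fock (ψ : Fock n) : toFock (ψ : Coeff n) = ψ :=
  lp.ext (toFock_coe (lp.memℓp ψ))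

lemma inner_eq_pair (ψ φ : Fock n) : inner ℂ ψ φ = pair (ψ : Coeff n) φ := by
  rw [lp.inner_eq_tsum]
  exact tsum_congr fun i => by rw [RCLike.inner_apply, mul_comm]

lemma inner_toFock {f g : Coeff n} (hf : Memℓp f 2) (hg : Memℓp g 2) :
    inner ℂ (toFock f) (toFock g) = pair f g := by
  rw [inner_eq_pair, toFock_coe hf, toFock_coe hg]

lemma toFock_add {f g : Coeff n} (hf : Memℓp f 2) (hg : Memℓp g 2) :
    toFock (f + g) = toFock f + toFock g :=
  lp.ext (by rw [lp.coeFn_add, toFock_coe hf, toFock_coe hg, toFock_coe (hf.add hg)])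

lemma toFock_smul {f : Coeff n} (c : ℂ) (hf : Memℓp f 2) : toFock (c • f) = c • toFock f :=
  lp.ext (by rw [lp.coeFn_smul, toFock_coe hf, toFock_coe (hf.const_smul c)])

/-- Squared length of a family of coefficients. -/
def sqLen (f : Coeff n) : ℝ := ∑' i, ‖f i‖ ^ 2

lemma pair_self (f : Coeff n) : pair f f = sqLen f := by
  rw [pair, sqLen, Complex.ofReal_tsum]
  refine tsum_congr fun i => ?_
  rw [mul_comm, Complex.mul_conj, Complex.normSq_eq_norm_sq]

lemma norm_toFock_sq {f : Coeff n} (hf : Memℓp f 2) : ‖toFock f‖ ^ 2 = sqLen f := by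
  have h := inner_self_eq_norm_sq (𝕜 := ℂ) (toFock f)
  rw [inner_toFock hf hf, pair_self] at h
  exact h.symm

lemma sqLen_nonneg (f : Coeff n) : 0 ≤ sqLen f := tsum_nonneg fun _ => sq_nonneg _

lemma summable_sq {f : Coeff n} (hf : f ∈ finSupp n) : Summable fun i => ‖f i‖ ^ 2 :=
  summable_of_hasFiniteSupport (Set.Finite.subset hf fun i hi => by
    intro h0
    simp [h0] at hi)

/-! ### Degrees -/

/-- All occurring basis vectors have `k` quanta of type `A` and `l` quanta of type `B`. -/
def HasDeg (k l : ℕ) (f : Coeff n) : Prop :=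
  ∀ i, f i ≠ 0 → ∑ a, i.1 a = k ∧ ∑ a, i.2 a = l

lemma HasDeg.smul {k l : ℕ} {f : Coeff n} (hf : HasDeg k l f) (c : ℂ) : HasDeg k l (c • f) :=
  fun i hi => hf i (right_ne_zero_of_mul hi)

lemma HasDeg.sum {k l : ℕ} {ι : Type*} (s : Finset ι) {f : ι → Coeff n}
    (hf : ∀ j ∈ s, HasDeg k l (f j)) : HasDeg k l (∑ j ∈ s, f j) := by
  intro i hi
  rw [Finset.sum_apply] at hi
  obtain ⟨j, hj, hji⟩ := Finset.exists_ne_zero_of_sum_ne_zero hi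
  exact hf j hj i hji

lemma HasDeg.opAdag {k l : ℕ} {f : Coeff n} (hf : HasDeg k l f) (a : Fin n) :
    HasDeg (k + 1) l (opAdag a f) := by
  intro i hi
  obtain ⟨j, rfl⟩ := mem_range_incA (ne_zero_of_opAdag_ne_zero hi)
  rw [opAdag_incA] at hi
  have := hf j (right_ne_zero_of_mul hi)
  simp [incA, Finset.sum_add_distrib, this.1, this.2]

lemma HasDeg.opBdag {k l : ℕ} {f : Coeff n} (hf : HasDeg k l f) (a : Fin n) :
    HasDeg k (l + 1) (opBdag a f) := by
  intro i hi
  obtain ⟨j, rfl⟩ := mem_range_incB (ne_zero_of_opBdag_ne_zero hi)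
  rw [opBdag_incB] at hi
  have := hf j (right_ne_zero_of_mul hi)
  simp [incB, Finset.sum_add_distrib, this.1, this.2]

lemma HasDeg.raise {k l : ℕ} {f : Coeff n} (hf : HasDeg k l f) (Z : Matrix (Fin n) (Fin n) ℂ) :
    HasDeg (k + 1) (l + 1) (raise Z f) := by
  simp only [SOStarCoherent.raise, LinearMap.sum_apply, LinearMap.smul_apply, Module.End.mul_apply]
  exact HasDeg.sum _ fun c _ => HasDeg.sum _ fun d _ => ((hf.opAdag d).opBdag c).smul _

lemma hasDeg_vacuum : HasDeg 0 0 (vacuum n) := by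
  intro i hi
  have h0 : i = 0 := by
    by_contra h
    exact hi (Pi.single_eq_of_ne h 1)
  simp [h0]

lemma hasDeg_expCoeff (Z : Matrix (Fin n) (Fin n) ℂ) (k : ℕ) : HasDeg k k (expCoeff Z k) := by
  refine HasDeg.smul ?_ _
  induction k with
  | zero => exact hasDeg_vacuum
  | succ k ih => rw [pow_succ', Module.End.mul_apply]; exact ih.raise Z

lemma sum_opAdag_opA_apply {k l : ℕ} {f : Coeff n} (hf : HasDeg k l f) :
    ∑ a, opAdag a (opA a f) = (k : ℂ) • f := by
  ext i
  simp only [Finset.sum_apply, opAdag_mul_opA_apply, ← Finset.sum_mul, Pi.smul_apply, smul_eq_mul]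
  by_cases h : f i = 0
  · simp [h]
  · rw [← (hf i h).1]; push_cast; rfl

lemma sum_opBdag_opB_apply {k l : ℕ} {f : Coeff n} (hf : HasDeg k l f) :
    ∑ a, opBdag a (opB a f) = (l : ℂ) • f := by
  ext i
  simp only [Finset.sum_apply, opBdag_mul_opB_apply, ← Finset.sum_mul, Pi.smul_apply, smul_eq_mul]
  by_cases h : f i = 0
  · simp [h]
  · rw [← (hf i h).2]; push_cast; rfl

lemma opA_opAdag_apply (a b : Fin n) (f : Coeff n) :
    opA a (opAdag b f) = opAdag b (opA a f) + (if a = b then 1 else 0 : ℂ) • f := by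
  have := LinearMap.congr_fun (opA_mul_opAdag a b) f
  simp only [Module.End.mul_apply, LinearMap.add_apply] at this
  rw [this]
  split_ifs <;> simp

lemma opB_opBdag_apply (a b : Fin n) (f : Coeff n) :
    opB a (opBdag b f) = opBdag b (opB a f) + (if a = b then 1 else 0 : ℂ) • f := by
  have := LinearMap.congr_fun (opB_mul_opBdag a b) f
  simp only [Module.End.mul_apply, LinearMap.add_apply] at this
  rw [this]
  split_ifs <;> simp

lemma sum_sqLen_opA {k l : ℕ} {f : Coeff n} (hf : HasDeg k l f) (hf' : f ∈ finSupp n) :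
    ∑ a, sqLen (opA a f) = k * sqLen f := by
  have : (∑ a, pair (opA a f) (opA a f)) = k * pair f f := by
    simp only [← pair_opAdag_right]
    rw [← pair_sum_right hf', sum_opAdag_opA_apply hf, pair_smul_right]
  simp only [pair_self] at this
  exact_mod_cast this

/-- Each of the `n` reorderings of `B_a B†_a` contributes `1`; this is the source of the `k + n` in
the decay estimate. -/
lemma sum_sqLen_opBdag {k l : ℕ} {f : Coeff n} (hf : HasDeg k l f) (hf' : f ∈ finSupp n) :
    ∑ a, sqLen (opBdag a f) = (l + n) * sqLen f := by
  have : (∑ a, pair (opBdag a f) (opBdag a f)) = (l + n) * pair f f := by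
    simp only [pair_opBdag_left, opB_opBdag_apply, if_true, one_smul, pair_add_right hf',
      Finset.sum_add_distrib]
    rw [← pair_sum_right hf', sum_opBdag_opB_apply hf, pair_smul_right]
    simp
    ring
  simp only [pair_self] at this
  exact_mod_cast this

/-! ### The kernel, degree by degree -/

/-- Overlap of the terms of degree `k`. -/
def overlapCoeff (ω ζ : Matrix (Fin n) (Fin n) ℂ) (k : ℕ) : ℂ :=
  pair (expCoeff ω k) (expCoeff ζ k)

/-- Overlaps of the terms of degree `k` raised by `A†_a`, `A†_b`. -/
def overlapA (ω ζ : Matrix (Fin n) (Fin n) ℂ) (k : ℕ) : Matrix (Fin n) (Fin n) ℂ :=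
  Matrix.of fun a b => pair (opAdag a (expCoeff ω k)) (opAdag b (expCoeff ζ k))

/-- Overlaps of the terms of degree `k` raised by `B†_a`, `B†_b`. -/
def overlapB (ω ζ : Matrix (Fin n) (Fin n) ℂ) (k : ℕ) : Matrix (Fin n) (Fin n) ℂ :=
  Matrix.of fun a b => pair (opBdag a (expCoeff ω k)) (opBdag b (expCoeff ζ k))

lemma overlapCoeff_zero (ω ζ : Matrix (Fin n) (Fin n) ℂ) : overlapCoeff ω ζ 0 = 1 := by
  rw [overlapCoeff, expCoeff_zero, expCoeff_zero, pair, tsum_eq_single 0]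
  · simp [vacuum]
  · intro i hi
    simp [vacuum, Pi.single_eq_of_ne hi]

lemma overlapA_apply (ω ζ : Matrix (Fin n) (Fin n) ℂ) (k : ℕ) (a b : Fin n) :
    overlapA ω ζ k a b = (if a = b then 1 else 0) * overlapCoeff ω ζ k
      + pair (opA b (expCoeff ω k)) (opA a (expCoeff ζ k)) := by
  rw [overlapA, Matrix.of_apply, pair_opAdag_left, opA_opAdag_apply,
    pair_add_right (expCoeff_mem_finSupp ω k), pair_smul_right, pair_opAdag_right, overlapCoeff,
    add_comm]

lemma overlapB_apply (ω ζ : Matrix (Fin n) (Fin n) ℂ) (k : ℕ) (a b : Fin n) :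
    overlapB ω ζ k a b = (if a = b then 1 else 0) * overlapCoeff ω ζ k
      + pair (opB b (expCoeff ω k)) (opB a (expCoeff ζ k)) := by
  rw [overlapB, Matrix.of_apply, pair_opBdag_left, opB_opBdag_apply,
    pair_add_right (expCoeff_mem_finSupp ω k), pair_smul_right, pair_opBdag_right, overlapCoeff,
    add_comm]

lemma pair_sum_smul_sum_smul {ι κ : Type*} (s : Finset ι) (t : Finset κ) (x : ι → ℂ) (y : κ → ℂ)
    {f : ι → Coeff n} {g : κ → Coeff n} (hf : ∀ i, f i ∈ finSupp n) (hg : ∀ j, g j ∈ finSupp n) :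
    pair (∑ i ∈ s, x i • f i) (∑ j ∈ t, y j • g j)
      = ∑ i ∈ s, ∑ j ∈ t, conj (x i) * y j * pair (f i) (g j) := by
  rw [pair_sum_left (Submodule.sum_mem _ fun j _ => Submodule.smul_mem _ _ (hg j))]
  refine Finset.sum_congr rfl fun i _ => ?_
  rw [pair_smul_left, pair_sum_right (hf i), Finset.mul_sum]
  refine Finset.sum_congr rfl fun j _ => ?_
  rw [pair_smul_right, mul_assoc]

lemma overlapA_zero (ω ζ : Matrix (Fin n) (Fin n) ℂ) : overlapA ω ζ 0 = 1 := by
  ext a b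
  rw [overlapA_apply, overlapCoeff_zero, expCoeff_zero, opA_vacuum, Matrix.one_apply]
  simp [pair]

lemma overlapB_zero (ω ζ : Matrix (Fin n) (Fin n) ℂ) : overlapB ω ζ 0 = 1 := by
  ext a b
  rw [overlapB_apply, overlapCoeff_zero, expCoeff_zero, opB_vacuum, Matrix.one_apply]
  simp [pair]

/-- After normal ordering, both annihilators lower degree `k + 1` to degree `k`, trading each `A`
for a combination of `B†`. The recursions for `overlapA` and `overlapB` are therefore coupled. -/
lemma overlapA_succ (ω ζ : Matrix (Fin n) (Fin n) ℂ) (k : ℕ) :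
    overlapA ω ζ (k + 1) = overlapCoeff ω ζ (k + 1) • (1 : Matrix (Fin n) (Fin n) ℂ)
      + ζᵀ * (overlapB ω ζ k)ᵀ * ω.map conj := by
  ext a b
  rw [overlapA_apply, opA_expCoeff_succ, opA_expCoeff_succ, pair_sum_smul_sum_smul _ _ _ _
    (fun c => opBdag_mem_finSupp c (expCoeff_mem_finSupp ω k))
    (fun c => opBdag_mem_finSupp c (expCoeff_mem_finSupp ζ k))]
  simp only [Matrix.add_apply, Matrix.smul_apply, Matrix.one_apply, Matrix.mul_apply,
    Matrix.transpose_apply, Matrix.map_apply, smul_eq_mul, Finset.sum_mul, overlapB,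
    Matrix.of_apply]
  congr 1
  · ring
  · exact Finset.sum_congr rfl fun c _ => Finset.sum_congr rfl fun d _ => by ring

lemma overlapB_succ (ω ζ : Matrix (Fin n) (Fin n) ℂ) (k : ℕ) :
    overlapB ω ζ (k + 1) = overlapCoeff ω ζ (k + 1) • (1 : Matrix (Fin n) (Fin n) ℂ)
      + ζ * (overlapA ω ζ k)ᵀ * ωᴴ := by
  ext a b
  rw [overlapB_apply, opB_expCoeff_succ, opB_expCoeff_succ, pair_sum_smul_sum_smul _ _ _ _
    (fun c => opAdag_mem_finSupp c (expCoeff_mem_finSupp ω k))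
    (fun c => opAdag_mem_finSupp c (expCoeff_mem_finSupp ζ k))]
  simp only [Matrix.add_apply, Matrix.smul_apply, Matrix.one_apply, Matrix.mul_apply,
    Matrix.transpose_apply, Matrix.conjTranspose_apply, smul_eq_mul, Finset.sum_mul, overlapA,
    Matrix.of_apply, RCLike.star_def]
  congr 1
  · ring
  · exact Finset.sum_congr rfl fun c _ => Finset.sum_congr rfl fun d _ => by ring

lemma map_conj_eq_neg_conjTranspose {ω : Matrix (Fin n) (Fin n) ℂ} (hω : ωᵀ = -ω) :
    ω.map conj = -ωᴴ := by
  ext a b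
  have : ω b a = - ω a b := congrFun (congrFun hω a) b
  simp [this]

lemma conjTranspose_transpose_of_antisymm {ω : Matrix (Fin n) (Fin n) ℂ} (hω : ωᵀ = -ω) :
    ωᴴᵀ = -ωᴴ := by
  rw [← map_conj_eq_neg_conjTranspose hω]
  rfl

/-- For antisymmetric `ω` and `ζ` the signs from `ζᵀ` and from `conj ω = -ω*` cancel, so the two
coupled recursions coincide. -/
lemma overlapB_eq_overlapA {ω ζ : Matrix (Fin n) (Fin n) ℂ} (hω : ωᵀ = -ω) (hζ : ζᵀ = -ζ)
    (k : ℕ) : overlapB ω ζ k = overlapA ω ζ k := by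
  induction k with
  | zero => rw [overlapA_zero, overlapB_zero]
  | succ k ih =>
    rw [overlapA_succ, overlapB_succ, ih, hζ, map_conj_eq_neg_conjTranspose hω]
    simp

lemma overlapA_eq_sum {ω ζ : Matrix (Fin n) (Fin n) ℂ} (hω : ωᵀ = -ω) (hζ : ζᵀ = -ζ) (k : ℕ) :
    overlapA ω ζ k = ∑ p ∈ Finset.HasAntidiagonal.antidiagonal k, overlapCoeff ω ζ p.1 • (ζ * ωᴴ) ^ p.2 := by
  induction k with
  | zero => simp [overlapA_zero, overlapCoeff_zero]
  | succ k ih =>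
    -- Antisymmetry gives `(ζω*)ᵀ = ω*ζ`, and `ζ (ω*ζ)^j ω* = (ζω*)^{j+1}`; this removes the
    -- transpose from the recursion.
    have hpow : ∀ j, ζ * ((ζ * ωᴴ) ^ j)ᵀ * ωᴴ = (ζ * ωᴴ) ^ (j + 1) := by
      intro j
      rw [Matrix.transpose_pow, Matrix.transpose_mul, hζ, conjTranspose_transpose_of_antisymm hω,
        neg_mul_neg]
      induction j with
      | zero => simp
      | succ j hj => rw [pow_succ _ (j + 1), ← hj, pow_succ]; simp only [Matrix.mul_assoc]
    rw [overlapA_succ, overlapB_eq_overlapA hω hζ, hζ, map_conj_eq_neg_conjTranspose hω,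
      Finset.Nat.antidiagonal_succ', Finset.sum_cons, Finset.sum_map, ih, Matrix.transpose_sum,
      Matrix.mul_neg, Matrix.neg_mul, Matrix.neg_mul, neg_neg, Finset.mul_sum, Finset.sum_mul]
    congr 1
    refine Finset.sum_congr rfl fun p _ => ?_
    rw [Matrix.transpose_smul, Matrix.mul_smul, Matrix.smul_mul, hpow]
    rfl

lemma overlapA_succ_eq_mul {ω ζ : Matrix (Fin n) (Fin n) ℂ} (hω : ωᵀ = -ω) (hζ : ζᵀ = -ζ)
    (k : ℕ) : overlapA ω ζ (k + 1)
      = overlapCoeff ω ζ (k + 1) • (1 : Matrix (Fin n) (Fin n) ℂ) + overlapA ω ζ k * (ζ * ωᴴ) := by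
  rw [overlapA_eq_sum hω hζ, overlapA_eq_sum hω hζ, Finset.Nat.antidiagonal_succ',
    Finset.sum_cons, Finset.sum_map, Finset.sum_mul]
  simp [pow_succ]

/-- The trace of `overlapA ω ζ k * (ζ * ωᴴ)` is evaluated twice: as an expectation of the number
operator, which has the value `k + 1` in this degree, and through the expansion of `overlapA` in
powers of `ζω*`. The outcome has the shape of Newton's identities. -/
lemma succ_mul_overlapCoeff_succ {ω ζ : Matrix (Fin n) (Fin n) ℂ} (hω : ωᵀ = -ω) (hζ : ζᵀ = -ζ)
    (k : ℕ) : ((k : ℂ) + 1) * overlapCoeff ω ζ (k + 1)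
      = ∑ p ∈ Finset.HasAntidiagonal.antidiagonal k, overlapCoeff ω ζ p.1 * ((ζ * ωᴴ) ^ (p.2 + 1)).trace := by
  have h1 : (overlapA ω ζ k * (ζ * ωᴴ)).trace = ((k : ℂ) + 1) * overlapCoeff ω ζ (k + 1) := by
    have h2 : ∀ a, (overlapA ω ζ k * (ζ * ωᴴ)) a a
        = pair (opA a (expCoeff ω (k + 1))) (opA a (expCoeff ζ (k + 1))) := by
      intro a
      have := congrFun (congrFun (overlapA_succ_eq_mul hω hζ k) a) a
      rw [overlapA_apply, Matrix.add_apply, Matrix.smul_apply, Matrix.one_apply_eq] at this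
      simpa using this.symm
    rw [Matrix.trace]
    simp only [Matrix.diag_apply, h2, ← pair_opAdag_right]
    rw [← pair_sum_right (expCoeff_mem_finSupp ω _), sum_opAdag_opA_apply (hasDeg_expCoeff ζ _),
      pair_smul_right, overlapCoeff]
    push_cast
    rfl
  rw [← h1, overlapA_eq_sum hω hζ, Finset.sum_mul, Matrix.trace_sum]
  refine Finset.sum_congr rfl fun p _ => ?_
  rw [Matrix.smul_mul, ← pow_succ, Matrix.trace_smul, smul_eq_mul]

/-! ### The generating function of the kernel -/

/-- Jacobi's formula: differentiating the Leibniz expansion one column at a time gives determinants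
with a replaced column, which Cramer's rule reads as entries of the adjugate times the derivative.
-/
lemma derivative_det {m R : Type*} [Fintype m] [DecidableEq m] [CommRing R]
    (M : Matrix m m (Polynomial R)) :
    Polynomial.derivative M.det = (M.adjugate * M.map Polynomial.derivative).trace := by
  have h1 : Polynomial.derivative M.det
      = ∑ i, (M.updateCol i fun j => Polynomial.derivative (M j i)).det := by
    simp only [Matrix.det_apply, map_sum, Polynomial.derivative_smul,
      Polynomial.derivative_prod_finset]
    rw [Finset.sum_comm]
    refine Finset.sum_congr rfl fun σ _ => ?_
    rw [← Finset.smul_sum]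
    congr 1
    refine Finset.sum_congr rfl fun i _ => ?_
    rw [← Finset.prod_erase_mul _ _ (Finset.mem_univ i), Matrix.updateCol_self]
    congr 1
    refine Finset.prod_congr rfl fun j hj => ?_
    rw [Matrix.updateCol_ne (Finset.ne_of_mem_erase hj)]
  rw [h1, Matrix.trace]
  refine Finset.sum_congr rfl fun i _ => ?_
  rw [← Matrix.cramer_apply, Matrix.cramer_eq_adjugate_mulVec]
  rfl

/-- The logarithmic derivative of `det(1 - X x)` is `-tr (x (1 - X x)⁻¹)`, expanded as a geometric
series. -/
lemma derivative_charpolyRev (x : Matrix (Fin n) (Fin n) ℂ) :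
    PowerSeries.derivative ℂ (x.charpolyRev : PowerSeries ℂ)
      = - (x.charpolyRev : PowerSeries ℂ) * PowerSeries.mk fun j => (x ^ (j + 1)).trace := by
  set M : Matrix (Fin n) (Fin n) (Polynomial ℂ) := 1 - (Polynomial.X : Polynomial ℂ) •
    x.map Polynomial.C with hM
  set φ : Polynomial ℂ →+* PowerSeries ℂ := Polynomial.coeToPowerSeries.ringHom with hφ
  have hφa : ∀ p : Polynomial ℂ, φ p = (p : PowerSeries ℂ) := fun p => rfl
  -- The Neumann series of `(1 - X x)⁻¹`, as a matrix of formal power series; it turns the adjugate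
  -- into `det(1 - X x) • G`.
  set G : Matrix (Fin n) (Fin n) (PowerSeries ℂ) :=
    Matrix.of fun a b => PowerSeries.mk fun j => (x ^ j) a b with hG
  have hMG : φ.mapMatrix M * G = 1 := by
    ext a b j
    have h1 : ∀ c, φ.mapMatrix M a c
        = (if a = c then 1 else 0) - PowerSeries.X * PowerSeries.C (x a c) := by
      intro c
      simp only [hM, RingHom.mapMatrix_apply, Matrix.map_apply, Matrix.sub_apply, Matrix.one_apply,
        Matrix.smul_apply, smul_eq_mul, hφa]
      split_ifs <;> simp [mul_comm (PowerSeries.X : PowerSeries ℂ)]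
    simp only [Matrix.mul_apply, h1, sub_mul, ite_mul, one_mul, zero_mul, Finset.sum_sub_distrib,
      Finset.sum_ite_eq, Finset.mem_univ, if_true, map_sub, map_sum, mul_assoc]
    cases j with
    | zero =>
      simp only [hG, Matrix.of_apply, PowerSeries.coeff_mk, pow_zero, Matrix.one_apply]
      split_ifs <;> simp
    | succ j =>
      simp only [hG, Matrix.of_apply, PowerSeries.coeff_mk, PowerSeries.coeff_succ_X_mul,
        PowerSeries.coeff_C_mul]
      rw [pow_succ', Matrix.mul_apply, sub_self, Matrix.one_apply]
      split_ifs <;> simp [PowerSeries.coeff_one]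
  have hadj : φ.mapMatrix M.adjugate = (x.charpolyRev : PowerSeries ℂ) • G := by
    calc φ.mapMatrix M.adjugate = φ.mapMatrix M.adjugate * (φ.mapMatrix M * G) := by
          rw [hMG, mul_one]
      _ = φ.mapMatrix (M.adjugate * M) * G := by rw [map_mul, mul_assoc]
      _ = (x.charpolyRev : PowerSeries ℂ) • G := by
          rw [Matrix.adjugate_mul, ← hφa, Matrix.charpolyRev, ← hM]
          ext1 a b
          simp only [Matrix.mul_apply, RingHom.mapMatrix_apply, Matrix.map_apply,
            Matrix.smul_apply, Matrix.one_apply, smul_eq_mul, map_mul, mul_assoc]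
          simp [apply_ite φ]
  have hder : M.map Polynomial.derivative = -x.map Polynomial.C := by
    ext1 a b
    simp only [hM, Matrix.map_apply, Matrix.sub_apply, Matrix.smul_apply, Matrix.one_apply,
      Matrix.neg_apply, smul_eq_mul, Polynomial.derivative_sub, Polynomial.derivative_mul,
      Polynomial.derivative_X, Polynomial.derivative_C]
    split_ifs <;> simp
  rw [PowerSeries.derivative_coe, Matrix.charpolyRev, ← hM, derivative_det, hder, ← hφa,
    Matrix.mul_neg, Matrix.trace_neg, map_neg, neg_mul, neg_inj, AddMonoidHom.map_trace φ]
  have h2 : (M.adjugate * x.map Polynomial.C).map φ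
      = φ.mapMatrix M.adjugate * φ.mapMatrix (x.map Polynomial.C) := by
    rw [← map_mul]; rfl
  rw [h2, hadj, Matrix.smul_mul, Matrix.trace_smul, smul_eq_mul, Matrix.charpolyRev, ← hM]
  congr 1
  ext j
  simp only [Matrix.trace, Matrix.diag_apply, Matrix.mul_apply, map_sum, PowerSeries.coeff_mk,
    pow_succ, hG, Matrix.of_apply, RingHom.mapMatrix_apply, Matrix.map_apply, hφa,
    Polynomial.coe_C, PowerSeries.coeff_mul_C]

/-- If `(k + 1) K_{k+1} = ∑ K_i tr x^{j+1}` over `i + j = k` and `K_0 = 1`, then `∑ K_k X^k` is the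
inverse of `det (1 - X x)`. -/
lemma mk_mul_charpolyRev {K : ℕ → ℂ} {x : Matrix (Fin n) (Fin n) ℂ} (h0 : K 0 = 1)
    (h : ∀ k : ℕ, ((k : ℂ) + 1) * K (k + 1)
      = ∑ p ∈ Finset.HasAntidiagonal.antidiagonal k, K p.1 * (x ^ (p.2 + 1)).trace) :
    PowerSeries.mk K * (x.charpolyRev : PowerSeries ℂ) = 1 := by
  set T : PowerSeries ℂ := PowerSeries.mk fun j => (x ^ (j + 1)).trace with hT
  have hK : PowerSeries.derivative ℂ (PowerSeries.mk K) = PowerSeries.mk K * T := by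
    ext k
    rw [PowerSeries.coeff_derivative, PowerSeries.coeff_mk, PowerSeries.coeff_mul, mul_comm, h]
    simp [hT]
  have hD : PowerSeries.derivative ℂ (x.charpolyRev : PowerSeries ℂ)
      = - (x.charpolyRev : PowerSeries ℂ) * T := derivative_charpolyRev x
  -- The logarithmic derivatives of the two factors are `T` and `-T`, so the product has derivative
  -- zero and is determined by its constant term.
  refine PowerSeries.derivative.ext ?_ ?_
  · rw [Derivation.leibniz, hK, hD, Derivation.map_one_eq_zero]
    simp only [smul_eq_mul]
    ring
  · simp [h0, Polynomial.coeff_zero_eq_eval_zero]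

/-! ### The domain -/

lemma star_dotProduct_self (x : Fin n → ℂ) : star x ⬝ᵥ x = ((∑ c, ‖x c‖ ^ 2 : ℝ) : ℂ) := by
  rw [dotProduct]
  push_cast
  exact Finset.sum_congr rfl fun c _ => by
    rw [Pi.star_apply, RCLike.star_def, mul_comm, Complex.mul_conj, Complex.normSq_eq_norm_sq]
    push_cast
    rfl

lemma dotProduct_one_sub_mulVec (ζ : Matrix (Fin n) (Fin n) ℂ) (x : Fin n → ℂ) :
    star x ⬝ᵥ ((1 - ζᴴ * ζ) *ᵥ x)
      = ((∑ c, ‖x c‖ ^ 2 - ∑ a, ‖(ζ *ᵥ x) a‖ ^ 2 : ℝ) : ℂ) := by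
  rw [Matrix.sub_mulVec, Matrix.one_mulVec, dotProduct_sub, ← Matrix.mulVec_mulVec,
    Matrix.dotProduct_mulVec, ← Matrix.star_mulVec, star_dotProduct_self, star_dotProduct_self]
  push_cast
  rfl

lemma isHermitian_one_sub (ζ : Matrix (Fin n) (Fin n) ℂ) : (1 - ζᴴ * ζ).IsHermitian :=
  Matrix.isHermitian_one.sub (Matrix.isHermitian_conjTranspose_mul_self ζ)

lemma posDef_one_sub_iff (ζ : Matrix (Fin n) (Fin n) ℂ) :
    (1 - ζᴴ * ζ).PosDef ↔ ∀ x ≠ 0, ∑ a, ‖(ζ *ᵥ x) a‖ ^ 2 < ∑ c, ‖x c‖ ^ 2 := by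
  constructor
  · intro h x hx
    have := h.dotProduct_mulVec_pos hx
    rw [dotProduct_one_sub_mulVec] at this
    have := Complex.zero_lt_real.mp this
    linarith
  · intro h
    refine Matrix.PosDef.of_dotProduct_mulVec_pos (isHermitian_one_sub ζ) fun x hx => ?_
    rw [dotProduct_one_sub_mulVec]
    exact Complex.zero_lt_real.mpr (by linarith [h x hx])

lemma sum_norm_sq_pos {x : Fin n → ℂ} (hx : x ≠ 0) : 0 < ∑ c, ‖x c‖ ^ 2 := by
  obtain ⟨c, hc⟩ := Function.ne_iff.mp hx
  exact Finset.sum_pos' (fun _ _ => sq_nonneg _)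
    ⟨c, Finset.mem_univ c, pow_pos (norm_pos_iff.mpr hc) 2⟩

/-- Compactness turns strict positivity into a uniform gap: the ratio of the two quadratic forms is
continuous and homogeneous of degree zero, so it attains its maximum on the unit sphere (of the sup
norm), and the maximum is below `1`. -/
lemma exists_contraction {ζ : Matrix (Fin n) (Fin n) ℂ} (h : (1 - ζᴴ * ζ).PosDef) :
    ∃ ρ : ℝ, 0 ≤ ρ ∧ ρ < 1 ∧
      ∀ x : Fin n → ℂ, ∑ a, ‖(ζ *ᵥ x) a‖ ^ 2 ≤ ρ * ∑ c, ‖x c‖ ^ 2 := by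
  rw [posDef_one_sub_iff] at h
  set q : (Fin n → ℂ) → ℝ := fun x => ∑ a, ‖(ζ *ᵥ x) a‖ ^ 2 with hq
  set N : (Fin n → ℂ) → ℝ := fun x => ∑ c, ‖x c‖ ^ 2 with hN
  have hqc : Continuous q := by
    simp only [hq, Matrix.mulVec, dotProduct]
    fun_prop
  have hNc : Continuous N := by
    simp only [hN]
    fun_prop
  have hq0 : ∀ x, 0 ≤ q x := fun x => Finset.sum_nonneg fun _ _ => sq_nonneg _
  by_cases hne : (Metric.sphere (0 : Fin n → ℂ) 1).Nonempty
  · have hS : ∀ x ∈ Metric.sphere (0 : Fin n → ℂ) 1, x ≠ 0 := fun x hx =>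
      ne_zero_of_mem_unit_sphere ⟨x, hx⟩
    have hc : ContinuousOn (fun x => q x / N x) (Metric.sphere (0 : Fin n → ℂ) 1) :=
      hqc.continuousOn.div hNc.continuousOn fun x hx => (sum_norm_sq_pos (hS x hx)).ne'
    obtain ⟨x₀, hx₀, hmax⟩ := (isCompact_sphere (0 : Fin n → ℂ) 1).exists_isMaxOn hne hc
    have hp := sum_norm_sq_pos (hS x₀ hx₀)
    refine ⟨q x₀ / N x₀, div_nonneg (hq0 x₀) hp.le, (div_lt_one hp).mpr (h x₀ (hS x₀ hx₀)), ?_⟩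
    intro x
    by_cases hx : x = 0
    · subst hx; simp
    have hxn : ‖x‖ ≠ 0 := norm_ne_zero_iff.mpr hx
    set y : Fin n → ℂ := ((‖x‖⁻¹ : ℝ) : ℂ) • x with hy
    have hyS : y ∈ Metric.sphere (0 : Fin n → ℂ) 1 := by
      rw [mem_sphere_zero_iff_norm, hy, norm_smul]
      simp [hxn]
    have hqy : q y = (‖x‖⁻¹) ^ 2 * q x := by
      simp only [hq, hy, Matrix.mulVec_smul, Pi.smul_apply, norm_smul, mul_pow, ← Finset.mul_sum]
      simp
    have hNy : N y = (‖x‖⁻¹) ^ 2 * N x := by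
      simp only [hN, hy, Pi.smul_apply, norm_smul, mul_pow, ← Finset.mul_sum]
      simp
    have h1 : q y / N y ≤ q x₀ / N x₀ := hmax hyS
    rw [hqy, hNy, mul_div_mul_left _ _ (by positivity), div_le_iff₀ (sum_norm_sq_pos hx)] at h1
    exact h1
  -- An empty sphere means that every vector is zero.
  · refine ⟨0, le_rfl, one_pos, fun x => ?_⟩
    have hx : x = 0 := by
      by_contra hx
      refine hne ⟨((‖x‖⁻¹ : ℝ) : ℂ) • x, ?_⟩
      rw [mem_sphere_zero_iff_norm, norm_smul]
      simp [hx]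
    subst hx
    simp

lemma smul_mem_domain {ζ : Matrix (Fin n) (Fin n) ℂ} (hζ : ζ ∈ domain n) {s : ℂ} (hs : ‖s‖ ≤ 1) :
    s • ζ ∈ domain n := by
  refine ⟨by rw [Matrix.transpose_smul, hζ.1, smul_neg], ?_⟩
  have h := (posDef_one_sub_iff ζ).mp hζ.2
  refine (posDef_one_sub_iff _).mpr fun x hx => lt_of_le_of_lt ?_ (h x hx)
  refine Finset.sum_le_sum fun a _ => ?_
  rw [Matrix.smul_mulVec, Pi.smul_apply, norm_smul, mul_pow]
  exact mul_le_of_le_one_left (sq_nonneg _) (pow_le_one₀ (norm_nonneg s) hs)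

lemma zero_mem_domain : (0 : Matrix (Fin n) (Fin n) ℂ) ∈ domain n :=
  ⟨by simp, by simpa using Matrix.PosDef.one⟩

/-- Extends degreewise statements from the domain to all antisymmetric matrices. With `C` the
squared Hilbert–Schmidt norm, Cauchy–Schwarz bounds the form by `C`, and `C / (1 + C)² < 1`. -/
lemma exists_smul_mem_domain {ζ : Matrix (Fin n) (Fin n) ℂ} (hζ : ζᵀ = -ζ) :
    ∃ s : ℂ, s ≠ 0 ∧ s • ζ ∈ domain n := by
  obtain ⟨C, hC⟩ : ∃ C : ℝ, C = ∑ a, ∑ c, ‖ζ a c‖ ^ 2 := ⟨_, rfl⟩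
  have hC0 : 0 ≤ C := hC ▸ Finset.sum_nonneg fun _ _ => Finset.sum_nonneg fun _ _ => sq_nonneg _
  have hs0 : 0 < (1 + C)⁻¹ := by positivity
  refine ⟨((1 + C)⁻¹ : ℝ), by exact_mod_cast hs0.ne',
    by rw [Matrix.transpose_smul, hζ, smul_neg], (posDef_one_sub_iff _).mpr fun x hx => ?_⟩
  have hN := sum_norm_sq_pos hx
  have h1 : ∑ a, ‖(ζ *ᵥ x) a‖ ^ 2 ≤ C * ∑ c, ‖x c‖ ^ 2 := by
    rw [hC, Finset.sum_mul]
    refine Finset.sum_le_sum fun a _ => ?_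
    calc ‖(ζ *ᵥ x) a‖ ^ 2 ≤ (∑ c, ‖ζ a c‖ * ‖x c‖) ^ 2 := by
          refine pow_le_pow_left₀ (norm_nonneg _) 
            ((norm_sum_le Finset.univ fun c => ζ a c * x c).trans_eq ?_) 2
          exact Finset.sum_congr rfl fun c _ => norm_mul _ _
      _ ≤ _ := Finset.sum_mul_sq_le_sq_mul_sq _ _ _
  have h2 : ∑ a, ‖(((((1 + C)⁻¹ : ℝ) : ℂ) • ζ) *ᵥ x) a‖ ^ 2
      = ((1 + C)⁻¹) ^ 2 * ∑ a, ‖(ζ *ᵥ x) a‖ ^ 2 := by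
    rw [Finset.mul_sum]
    refine Finset.sum_congr rfl fun a _ => ?_
    rw [Matrix.smul_mulVec, Pi.smul_apply, norm_smul, mul_pow, Complex.norm_real, Real.norm_eq_abs,
      sq_abs]
  rw [h2]
  have h3 : ((1 + C)⁻¹) ^ 2 * C < 1 := by
    rw [inv_pow, inv_mul_lt_iff₀ (by positivity)]
    nlinarith
  calc ((1 + C)⁻¹) ^ 2 * ∑ a, ‖(ζ *ᵥ x) a‖ ^ 2 ≤ ((1 + C)⁻¹) ^ 2 * (C * ∑ c, ‖x c‖ ^ 2) :=
        mul_le_mul_of_nonneg_left h1 (by positivity)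
    _ = (((1 + C)⁻¹) ^ 2 * C) * ∑ c, ‖x c‖ ^ 2 := by ring
    _ < 1 * ∑ c, ‖x c‖ ^ 2 := mul_lt_mul_of_pos_right h3 hN
    _ = _ := one_mul _

/-! ### Geometric decay of the exponential series -/

/-- The left side is `∑ ‖A_a u_{k+1}‖²`. At each index `i`, the tuple `(A_a u_{k+1})_a` is, up to
sign, `ζ` applied to `(B†_c u_k)_c`; the contraction bound is applied pointwise and summed. -/
lemma succ_mul_sqLen_expCoeff_succ_le {ζ : Matrix (Fin n) (Fin n) ℂ} (hζ : ζᵀ = -ζ) {ρ : ℝ}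
    (hρ : ∀ x : Fin n → ℂ, ∑ a, ‖(ζ *ᵥ x) a‖ ^ 2 ≤ ρ * ∑ c, ‖x c‖ ^ 2) (k : ℕ) :
    (k + 1) * sqLen (expCoeff ζ (k + 1)) ≤ ρ * ((k + n) * sqLen (expCoeff ζ k)) := by
  have hk := sum_sqLen_opA (hasDeg_expCoeff ζ (k + 1)) (expCoeff_mem_finSupp ζ (k + 1))
  push_cast at hk
  have hu := expCoeff_mem_finSupp ζ k
  rw [← hk, ← sum_sqLen_opBdag (hasDeg_expCoeff ζ k) hu]
  simp only [sqLen]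
  rw [← Summable.tsum_finsetSum
      fun a _ => summable_sq (opA_mem_finSupp a (expCoeff_mem_finSupp ζ _)),
    ← Summable.tsum_finsetSum fun a _ => summable_sq (opBdag_mem_finSupp a hu), ← tsum_mul_left]
  refine Summable.tsum_le_tsum (fun i => ?_)
    (summable_sum fun a _ => summable_sq (opA_mem_finSupp a (expCoeff_mem_finSupp ζ _)))
    ((summable_sum fun a _ => summable_sq (opBdag_mem_finSupp a hu)).mul_left ρ)
  refine le_trans (le_of_eq ?_) (hρ fun c => opBdag c (expCoeff ζ k) i)
  refine Finset.sum_congr rfl fun a _ => ?_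
  rw [opA_expCoeff_succ, Finset.sum_apply, Matrix.mulVec, dotProduct, ← norm_neg,
    ← Finset.sum_neg_distrib]
  congr 2
  refine Finset.sum_congr rfl fun c _ => ?_
  have : ζ c a = - ζ a c := congrFun (congrFun hζ a) c
  simp [this]

lemma exists_geometric_bound {N : ℕ → ℝ} {r : ℝ} (hN : ∀ k, 0 ≤ N k) (hr : 0 < r) {k₀ : ℕ}
    (h : ∀ k ≥ k₀, N (k + 1) ≤ r * N k) : ∃ C, 0 ≤ C ∧ ∀ k, N k ≤ C * r ^ k := by
  set C := ∑ j ∈ Finset.range (k₀ + 1), N j / r ^ j with hC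
  have hpos : ∀ j, 0 ≤ N j / r ^ j := fun j => div_nonneg (hN j) (pow_pos hr j).le
  refine ⟨C, Finset.sum_nonneg fun j _ => hpos j, fun k => ?_⟩
  have hsmall : ∀ k ≤ k₀, N k ≤ C * r ^ k := by
    intro k hk
    rw [← div_le_iff₀ (pow_pos hr k)]
    exact Finset.single_le_sum (f := fun j => N j / r ^ j) (fun j _ => hpos j)
      (Finset.mem_range.mpr (by omega))
  induction k with
  | zero => exact hsmall 0 (Nat.zero_le _)
  | succ k ih =>
    by_cases hk : k + 1 ≤ k₀
    · exact hsmall _ hk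
    · calc N (k + 1) ≤ r * N k := h k (by omega)
        _ ≤ r * (C * r ^ k) := mul_le_mul_of_nonneg_left ih hr.le
        _ = C * r ^ (k + 1) := by ring

lemma exists_sqLen_expCoeff_le {ζ : Matrix (Fin n) (Fin n) ℂ} (hζ : ζ ∈ domain n) :
    ∃ C r : ℝ, 0 ≤ C ∧ 0 ≤ r ∧ r < 1 ∧ ∀ k, sqLen (expCoeff ζ k) ≤ (C * r ^ k) ^ 2 := by
  obtain ⟨ρ, hρ0, hρ1, hρ⟩ := exists_contraction hζ.2
  -- The ratio `ρ (k + n) / (k + 1)` tends to `ρ`, hence is eventually at most any `s` strictly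
  -- between `ρ` and `1`; the midpoint is taken.
  set s : ℝ := (1 + ρ) / 2 with hs
  have hs0 : 0 < s := by positivity
  have hs1 : s < 1 := by rw [hs]; linarith
  have hρs : ρ < s := by rw [hs]; linarith
  obtain ⟨k₀, hk₀⟩ := exists_nat_ge (ρ * n / (s - ρ))
  have hstep : ∀ k ≥ k₀, sqLen (expCoeff ζ (k + 1)) ≤ s * sqLen (expCoeff ζ k) := by
    intro k hk
    have h1 := succ_mul_sqLen_expCoeff_succ_le hζ.1 hρ k
    have h2 : ρ * (k + n) ≤ s * (k + 1) := by
      have hk' : (k₀ : ℝ) ≤ k := by exact_mod_cast hk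
      have := (div_le_iff₀ (by linarith)).mp (hk₀.trans hk')
      nlinarith
    have h3 : (k + 1 : ℝ) * sqLen (expCoeff ζ (k + 1)) ≤ (k + 1) * (s * sqLen (expCoeff ζ k)) := by
      nlinarith [mul_le_mul_of_nonneg_right h2 (sqLen_nonneg (expCoeff ζ k))]
    exact le_of_mul_le_mul_left h3 (by positivity)
  obtain ⟨C, hC, hb⟩ := exists_geometric_bound (fun k => sqLen_nonneg _) hs0 hstep
  refine ⟨√C, √s, Real.sqrt_nonneg _, Real.sqrt_nonneg _, ?_, fun k => ?_⟩
  · rw [Real.sqrt_lt' one_pos]; simpa using hs1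
  · rw [mul_pow, Real.sq_sqrt hC, ← pow_mul, mul_comm k, pow_mul, Real.sq_sqrt hs0.le]
    exact hb k

/-- A creation operator costs only a factor linear in the degree. Geometric decay absorbs it, which
puts the exponential vectors in the domains of the quadratic operators. -/
lemma sqLen_opBdag_le {k l : ℕ} {f : Coeff n} (hf : HasDeg k l f) (hf' : f ∈ finSupp n)
    (a : Fin n) : sqLen (opBdag a f) ≤ (l + 1) * sqLen f := by
  have h1 : ∑ b, sqLen (opB b f) = l * sqLen f := by
    have : (∑ b, pair (opB b f) (opB b f)) = l * pair f f := by
      simp only [← pair_opBdag_right]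
      rw [← pair_sum_right hf', sum_opBdag_opB_apply hf, pair_smul_right]
    simp only [pair_self] at this
    exact_mod_cast this
  have h2 : sqLen (opBdag a f) = sqLen (opB a f) + sqLen f := by
    have : pair (opBdag a f) (opBdag a f) = pair (opB a f) (opB a f) + pair f f := by
      rw [pair_opBdag_left, opB_opBdag_apply, pair_add_right hf', pair_opBdag_right]
      simp
    simp only [pair_self] at this
    exact_mod_cast this
  have h3 := Finset.single_le_sum (f := fun b => sqLen (opB b f)) (fun b _ => sqLen_nonneg _)
    (Finset.mem_univ a)
  simp only [h1] at h3
  linarith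

lemma sqLen_opAdag_le {k l : ℕ} {f : Coeff n} (hf : HasDeg k l f) (hf' : f ∈ finSupp n)
    (a : Fin n) : sqLen (opAdag a f) ≤ (k + 1) * sqLen f := by
  have h2 : sqLen (opAdag a f) = sqLen (opA a f) + sqLen f := by
    have : pair (opAdag a f) (opAdag a f) = pair (opA a f) (opA a f) + pair f f := by
      rw [pair_opAdag_left, opA_opAdag_apply, pair_add_right hf', pair_opAdag_right]
      simp
    simp only [pair_self] at this
    exact_mod_cast this
  have h3 := Finset.single_le_sum (f := fun b => sqLen (opA b f)) (fun b _ => sqLen_nonneg _)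
    (Finset.mem_univ a)
  simp only [sum_sqLen_opA hf hf'] at h3
  linarith

lemma summable_toFock_expCoeff {ζ : Matrix (Fin n) (Fin n) ℂ} (hζ : ζ ∈ domain n) :
    Summable fun k => toFock (expCoeff ζ k) := by
  obtain ⟨C, r, hC, hr0, hr1, hb⟩ := exists_sqLen_expCoeff_le hζ
  refine Summable.of_norm_bounded (g := fun k => C * r ^ k)
    ((summable_geometric_of_lt_one hr0 hr1).mul_left C) fun k => ?_
  refine (pow_le_pow_iff_left₀ (norm_nonneg _) (by positivity) two_ne_zero).mp ?_
  rw [norm_toFock_sq (memlp_of_mem_finSupp (expCoeff_mem_finSupp ζ k))]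
  exact hb k

lemma summable_toFock_opBdag_opAdag_expCoeff {ζ : Matrix (Fin n) (Fin n) ℂ} (hζ : ζ ∈ domain n)
    (c d : Fin n) : Summable fun k => toFock (opBdag c (opAdag d (expCoeff ζ k))) := by
  obtain ⟨C, r, hC, hr0, hr1, hb⟩ := exists_sqLen_expCoeff_le hζ
  have hs : Summable fun k : ℕ => (k : ℝ) ^ 1 * r ^ k :=
    summable_pow_mul_geometric_of_norm_lt_one 1 (by rwa [Real.norm_of_nonneg hr0])
  refine Summable.of_norm_bounded (g := fun k : ℕ => C * ((k : ℝ) ^ 1 * r ^ k) + C * r ^ k)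
    ((hs.mul_left C).add ((summable_geometric_of_lt_one hr0 hr1).mul_left C)) fun k => ?_
  refine (pow_le_pow_iff_left₀ (norm_nonneg _) (by positivity) two_ne_zero).mp ?_
  have hu := expCoeff_mem_finSupp ζ k
  have hd := hasDeg_expCoeff ζ k
  rw [norm_toFock_sq (memlp_of_mem_finSupp (opBdag_mem_finSupp c (opAdag_mem_finSupp d hu)))]
  calc sqLen (opBdag c (opAdag d (expCoeff ζ k)))
      ≤ (k + 1) * sqLen (opAdag d (expCoeff ζ k)) :=
        sqLen_opBdag_le (hd.opAdag d) (opAdag_mem_finSupp d hu) c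
    _ ≤ (k + 1) * ((k + 1) * sqLen (expCoeff ζ k)) :=
        mul_le_mul_of_nonneg_left (sqLen_opAdag_le hd hu d) (by positivity)
    _ ≤ (k + 1) * ((k + 1) * (C * r ^ k) ^ 2) := by
        have := hb k
        gcongr
    _ = _ := by ring

/-! ### The exponential vectors -/

/-- The Fock vector `exp (½ F̃_ζ) |0⟩`. -/
def expFock (ζ : Matrix (Fin n) (Fin n) ℂ) : Fock n := ∑' k, toFock (expCoeff ζ k)

/-- The coefficients of `exp (½ F̃_ζ) |0⟩`. -/
def expFam (ζ : Matrix (Fin n) (Fin n) ℂ) : Coeff n := fun i => expCoeff ζ (∑ a, i.1 a) i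

/-- Terms of different degree have disjoint supports, and `d` reads the degree off an index, so each
coefficient of the sum comes from a single term. -/
lemma tsum_toFock_apply {g : ℕ → Coeff n} (hg : ∀ k, g k ∈ finSupp n)
    (hs : Summable fun k => toFock (g k)) {d : Occ n → ℕ} (hd : ∀ k i, g k i ≠ 0 → d i = k)
    (i : Occ n) : (∑' k, toFock (g k) : Fock n) i = g (d i) i := by
  have h1 := (lp.evalCLM ℂ (fun _ : Occ n => ℂ) 2 i).map_tsum hs
  have h2 : ∀ k, lp.evalCLM ℂ (fun _ : Occ n => ℂ) 2 i (toFock (g k)) = g k i := fun k =>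
    congrFun (toFock_coe (memlp_of_mem_finSupp (hg k))) i
  simp only [h2] at h1
  have h3 : (∑' k, toFock (g k) : Fock n) i = ∑' k, g k i := h1
  rw [h3, tsum_eq_single (d i)]
  intro k hk
  by_contra h
  exact hk (hd k i h).symm

lemma toFock_tsum {g : ℕ → Coeff n} (hg : ∀ k, g k ∈ finSupp n)
    (hs : Summable fun k => toFock (g k)) {d : Occ n → ℕ} (hd : ∀ k i, g k i ≠ 0 → d i = k) :
    Memℓp (fun i => g (d i) i) 2 ∧ HasSum (fun k => toFock (g k)) (toFock fun i => g (d i) i) := by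
  have h1 : ((∑' k, toFock (g k) : Fock n) : Coeff n) = fun i => g (d i) i :=
    funext (tsum_toFock_apply hg hs hd)
  refine ⟨h1 ▸ lp.memℓp _, ?_⟩
  rw [← h1, toFock_fock]
  exact hs.hasSum

lemma coe_expFock {ζ : Matrix (Fin n) (Fin n) ℂ} (hζ : ζ ∈ domain n) :
    (expFock ζ : Coeff n) = expFam ζ :=
  funext (tsum_toFock_apply (expCoeff_mem_finSupp ζ) (summable_toFock_expCoeff hζ)
    fun k i hi => (hasDeg_expCoeff ζ k i hi).1)

lemma memlp_expFam {ζ : Matrix (Fin n) (Fin n) ℂ} (hζ : ζ ∈ domain n) : Memℓp (expFam ζ) 2 :=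
  coe_expFock hζ ▸ lp.memℓp _

lemma toFock_expFam {ζ : Matrix (Fin n) (Fin n) ℂ} (hζ : ζ ∈ domain n) :
    toFock (expFam ζ) = expFock ζ := by
  rw [← coe_expFock hζ, toFock_fock]

lemma opAdag_congr {f g : Coeff n} {a : Fin n} {i : Occ n} (h : i.1 a ≠ 0 →
    f (i.1 - Pi.single a 1, i.2) = g (i.1 - Pi.single a 1, i.2)) :
    opAdag a f i = opAdag a g i := by
  rw [opAdag_apply, opAdag_apply]
  by_cases h0 : i.1 a = 0
  · simp [h0]
  · rw [h h0]

lemma sum_sub_single {μ : Fin n → ℕ} {a : Fin n} (h : μ a ≠ 0) :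
    ∑ b, (μ - Pi.single a 1 : Fin n → ℕ) b = ∑ b, μ b - 1 := by
  have := congrArg (fun ν : Fin n → ℕ => ∑ b, ν b) (sub_single_add_single μ h)
  simp only [Pi.add_apply, Finset.sum_add_distrib, Finset.sum_pi_single', Finset.mem_univ,
    if_true] at this
  omega

/-- The truncation in `∑ b, i.1 b - 1` matters only when no `A` quantum is present, and there both
sides vanish. -/
lemma opAdag_expFam_apply (a : Fin n) (ζ : Matrix (Fin n) (Fin n) ℂ) (i : Occ n) :
    opAdag a (expFam ζ) i = opAdag a (expCoeff ζ (∑ b, i.1 b - 1)) i :=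
  opAdag_congr fun h => by rw [expFam, ← sum_sub_single h]

lemma opBdag_opAdag_expFam_apply (c d : Fin n) (ζ : Matrix (Fin n) (Fin n) ℂ) (i : Occ n) :
    opBdag c (opAdag d (expFam ζ)) i = opBdag c (opAdag d (expCoeff ζ (∑ b, i.1 b - 1))) i := by
  rw [opBdag_apply, opBdag_apply, opAdag_expFam_apply]

/-- An identity of formal families, degree by degree; no convergence is needed and `ζ` is arbitrary.
-/
lemma opA_expFam (a : Fin n) (ζ : Matrix (Fin n) (Fin n) ℂ) :
    opA a (expFam ζ) = ∑ c, ζ c a • opBdag c (expFam ζ) := by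
  ext i
  have h1 : opA a (expFam ζ) i = opA a (expCoeff ζ (∑ b, i.1 b + 1)) i := by
    rw [opA_apply, opA_apply, expFam]
    simp [Finset.sum_add_distrib]
  rw [h1, opA_expCoeff_succ, Finset.sum_apply, Finset.sum_apply]
  rfl

lemma opB_expFam (a : Fin n) (ζ : Matrix (Fin n) (Fin n) ℂ) :
    opB a (expFam ζ) = ∑ d, ζ a d • opAdag d (expFam ζ) := by
  ext i
  have h1 : opB a (expFam ζ) i = opB a (expCoeff ζ (∑ b, i.1 b)) i := rfl
  rw [h1, Finset.sum_apply]
  simp only [Pi.smul_apply, opAdag_expFam_apply]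
  -- `expFam` measures degree by the number of `A` quanta, which `B_a` preserves and `A†_d` raises.
  -- The two sides thus differ by one in degree, and degree zero is handled apart.
  cases hk : ∑ b, i.1 b with
  | zero =>
    rw [expCoeff_zero, opB_vacuum, Pi.zero_apply]
    symm
    refine Finset.sum_eq_zero fun d _ => ?_
    have : i.1 d = 0 := by
      have := Finset.single_le_sum (f := i.1) (fun _ _ => Nat.zero_le _) (Finset.mem_univ d)
      omega
    simp [opAdag_apply, this]
  | succ k =>
    rw [opB_expCoeff_succ, Finset.sum_apply]
    rfl

lemma memlp_opBdag_opAdag_expFam {ζ : Matrix (Fin n) (Fin n) ℂ} (hζ : ζ ∈ domain n)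
    (c d : Fin n) : Memℓp (opBdag c (opAdag d (expFam ζ))) 2 ∧
      HasSum (fun k => toFock (opBdag c (opAdag d (expCoeff ζ k))))
        (toFock (opBdag c (opAdag d (expFam ζ)))) := by
  have h := toFock_tsum
    (fun k => opBdag_mem_finSupp c (opAdag_mem_finSupp d (expCoeff_mem_finSupp ζ k)))
    (summable_toFock_opBdag_opAdag_expCoeff hζ c d) (d := fun i => ∑ b, i.1 b - 1)
    (fun k i hi => by
      have := ((hasDeg_expCoeff ζ k).opAdag d).opBdag c i hi
      simp only [this.1, Nat.add_sub_cancel])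
  rw [← funext (opBdag_opAdag_expFam_apply c d ζ)] at h
  exact h

/-! ### Overlaps -/

lemma pair_expFam {ω : Matrix (Fin n) (Fin n) ℂ} {k l : ℕ} {g : Coeff n} (hg : HasDeg k l g) :
    pair (expFam ω) g = pair (expCoeff ω k) g := by
  refine tsum_congr fun i => ?_
  by_cases h : g i = 0
  · simp [h]
  · rw [expFam, (hg i h).1]

lemma hasSum_pair_expFam {ω : Matrix (Fin n) (Fin n) ℂ} (hω : ω ∈ domain n) {g : ℕ → Coeff n}
    {f : Coeff n} (hg : ∀ k, g k ∈ finSupp n) (hf : Memℓp f 2)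
    (h : HasSum (fun k => toFock (g k)) (toFock f)) {d : ℕ → ℕ} (hd : ∀ k, HasDeg (d k) (d k) (g k)) :
    HasSum (fun k => pair (expCoeff ω (d k)) (g k)) (pair (expFam ω) f) := by
  have h1 := h.mapL (innerSL ℂ (expFock ω))
  simp only [innerSL_apply_apply] at h1
  rw [← toFock_expFam hω, inner_toFock (memlp_expFam hω) hf] at h1
  have h2 : (fun k => pair (expCoeff ω (d k)) (g k))
      = fun k => inner ℂ (toFock (expFam ω)) (toFock (g k)) := funext fun k => by
    rw [inner_toFock (memlp_expFam hω) (memlp_of_mem_finSupp (hg k)), pair_expFam (hd k)]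
  rw [h2]
  exact h1

lemma hasSum_overlapCoeff {ω ζ : Matrix (Fin n) (Fin n) ℂ} (hω : ω ∈ domain n)
    (hζ : ζ ∈ domain n) : HasSum (overlapCoeff ω ζ) (pair (expFam ω) (expFam ζ)) := by
  refine hasSum_pair_expFam hω (g := expCoeff ζ) (expCoeff_mem_finSupp ζ) (memlp_expFam hζ) ?_
    (hasDeg_expCoeff ζ)
  rw [toFock_expFam hζ]
  exact (summable_toFock_expCoeff hζ).hasSum

/-- The formal power series identity evaluated at `X = 1`: both series converge absolutely, so their
Cauchy product, which is `1` by `mk_mul_charpolyRev`, has the product of the sums as its sum. -/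
theorem pair_expFam_mul_det {ω ζ : Matrix (Fin n) (Fin n) ℂ} (hω : ω ∈ domain n)
    (hζ : ζ ∈ domain n) : pair (expFam ω) (expFam ζ) * (1 - ωᴴ * ζ).det = 1 := by
  have h := mk_mul_charpolyRev (overlapCoeff_zero ω ζ) (succ_mul_overlapCoeff_succ hω.1 hζ.1)
  set D := (ζ * ωᴴ).charpolyRev with hD
  have hK := hasSum_overlapCoeff hω hζ
  have hDs : HasSum D.coeff (D.eval 1) := by
    have h1 : HasSum D.coeff (∑ k ∈ D.support, D.coeff k) :=
      hasSum_sum_of_ne_finset_zero fun k hk => by simpa using hk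
    have h2 : D.eval 1 = ∑ k ∈ D.support, D.coeff k := by
      simp [Polynomial.eval_eq_sum, Polynomial.sum_def]
    rw [h2]
    exact h1
  have hdet : D.eval 1 = (1 - ωᴴ * ζ).det := by
    rw [Matrix.det_one_sub_mul_comm, hD, Matrix.charpolyRev, ← Polynomial.coe_evalRingHom,
      RingHom.map_det]
    congr 1
    ext a b
    simp [-Matrix.map_mul, Matrix.one_apply, apply_ite (Polynomial.eval (1 : ℂ))]
  rw [← hdet, ← hK.tsum_eq, ← hDs.tsum_eq,
    tsum_mul_tsum_eq_tsum_sum_antidiagonal_of_summable_norm hK.summable.norm hDs.summable.norm]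
  have hc : ∀ k, ∑ p ∈ Finset.HasAntidiagonal.antidiagonal k, overlapCoeff ω ζ p.1 * D.coeff p.2
      = if k = 0 then 1 else 0 := by
    intro k
    have := congrArg (PowerSeries.coeff k) h
    rw [PowerSeries.coeff_mul, PowerSeries.coeff_one] at this
    simpa using this
  rw [tsum_congr hc, tsum_ite_eq]

lemma det_one_sub_ne_zero {ω ζ : Matrix (Fin n) (Fin n) ℂ} (hω : ω ∈ domain n)
    (hζ : ζ ∈ domain n) : (1 - ωᴴ * ζ).det ≠ 0 :=
  right_ne_zero_of_mul_eq_one (pair_expFam_mul_det hω hζ)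

lemma pair_expFam_expFam {ω ζ : Matrix (Fin n) (Fin n) ℂ} (hω : ω ∈ domain n)
    (hζ : ζ ∈ domain n) : pair (expFam ω) (expFam ζ) = ((1 - ωᴴ * ζ).det)⁻¹ :=
  eq_inv_of_mul_eq_one_left (pair_expFam_mul_det hω hζ)

/-- The matrix `⟨ω| B†_c A†_d |ζ⟩` for the unnormalised states. -/
def raisedOverlap (ω ζ : Matrix (Fin n) (Fin n) ℂ) : Matrix (Fin n) (Fin n) ℂ :=
  Matrix.of fun c d => pair (expFam ω) (opBdag c (opAdag d (expFam ζ)))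

lemma hasSum_raisedOverlap {ω ζ : Matrix (Fin n) (Fin n) ℂ} (hω : ω ∈ domain n)
    (hζ : ζ ∈ domain n) :
    HasSum (fun k => ω.map conj * overlapA ω ζ k) (raisedOverlap ω ζ) := by
  refine Pi.hasSum.mpr fun c => Pi.hasSum.mpr fun d => ?_
  have hu := expCoeff_mem_finSupp ζ
  have h := memlp_opBdag_opAdag_expFam hζ c d
  have hs := hasSum_pair_expFam hω
    (fun k => opBdag_mem_finSupp c (opAdag_mem_finSupp d (hu k))) h.1 h.2 (d := fun k => k + 1)
    fun k => ((hasDeg_expCoeff ζ k).opAdag d).opBdag c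
  refine (funext fun k => ?_ : (fun k => (ω.map conj * overlapA ω ζ k) c d) = _) ▸ hs
  rw [pair_opBdag_right, opB_expCoeff_succ, pair_sum_left (opAdag_mem_finSupp d (hu k)),
    Matrix.mul_apply]
  refine Finset.sum_congr rfl fun a _ => ?_
  rw [pair_smul_left]
  rfl

/-- Summing the recursion `P_{k+1} = K_{k+1} + P_k ζω*` over `k`, multiplied by `conj ω` on the
left; the terms of degree zero agree on both sides and cancel. -/
lemma raisedOverlap_mul {ω ζ : Matrix (Fin n) (Fin n) ℂ} (hω : ω ∈ domain n)
    (hζ : ζ ∈ domain n) : raisedOverlap ω ζ * (1 - ζ * ωᴴ)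
      = -(pair (expFam ω) (expFam ζ) • ωᴴ) := by
  have hS := hasSum_raisedOverlap hω hζ
  have hK : HasSum (fun k => overlapCoeff ω ζ k • ω.map conj)
      (pair (expFam ω) (expFam ζ) • ω.map conj) := (hasSum_overlapCoeff hω hζ).smul_const _
  have h1 := (hasSum_nat_add_iff' 1).mpr hS
  have h2 := (hasSum_nat_add_iff' 1).mpr hK
  have h3 := hS.mul_right (ζ * ωᴴ)
  have h4 : ∀ k, ω.map conj * overlapA ω ζ (k + 1) = overlapCoeff ω ζ (k + 1) • ω.map conj
      + ω.map conj * overlapA ω ζ k * (ζ * ωᴴ) := by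
    intro k
    rw [overlapA_succ_eq_mul hω.1 hζ.1, Matrix.mul_add, Matrix.mul_smul, Matrix.mul_one,
      Matrix.mul_assoc]
  simp only [h4] at h1
  have h5 := h1.unique (h2.add h3)
  rw [← smul_neg, ← map_conj_eq_neg_conjTranspose hω.1, Matrix.mul_sub, Matrix.mul_one,
    sub_eq_iff_eq_add]
  simpa [overlapA_zero, overlapCoeff_zero, sub_eq_iff_eq_add, sub_add_eq_add_sub] using h5

/-! ### Normalised states and matrix elements of the generators -/

lemma memlp_expTerm {ζ : Matrix (Fin n) (Fin n) ℂ} (hζ : ζᵀ = -ζ) (k : ℕ) :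
    Memℓp (expTerm ζ k) 2 := by
  refine memlp_of_mem_finSupp ?_
  rw [expTerm, half_opFtSum hζ]
  exact raise_pow_mem_finSupp ζ k

lemma smul_toFock_expTerm {ζ : Matrix (Fin n) (Fin n) ℂ} (hζ : ζᵀ = -ζ) (k : ℕ) :
    ((k.factorial : ℂ)⁻¹) • toFock (expTerm ζ k) = toFock (expCoeff ζ k) := by
  rw [← toFock_smul _ (memlp_expTerm hζ k), expTerm_eq hζ]

lemma ket_eq {ζ : Matrix (Fin n) (Fin n) ℂ} (hζ : ζ ∈ domain n) :
    ket ζ = (normFactor ζ : ℂ) • expFock ζ := by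
  rw [ket, expFock]
  simp only [smul_toFock_expTerm hζ.1]

lemma inner_expFock {ω ζ : Matrix (Fin n) (Fin n) ℂ} (hω : ω ∈ domain n) (hζ : ζ ∈ domain n) :
    inner ℂ (expFock ω) (expFock ζ) = ((1 - ωᴴ * ζ).det)⁻¹ := by
  rw [inner_eq_pair, coe_expFock hω, coe_expFock hζ, pair_expFam_expFam hω hζ]

lemma inner_ket {ω ζ : Matrix (Fin n) (Fin n) ℂ} (hω : ω ∈ domain n) (hζ : ζ ∈ domain n) :
    inner ℂ (ket ω) (ket ζ)
      = (normFactor ζ : ℂ) * (normFactor ω : ℂ) / (1 - ωᴴ * ζ).det := by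
  rw [ket_eq hω, ket_eq hζ, inner_smul_left, inner_smul_right, inner_expFock hω hζ,
    Complex.conj_ofReal]
  ring

lemma det_one_sub_pos {ζ : Matrix (Fin n) (Fin n) ℂ} (hζ : ζ ∈ domain n) :
    0 < (1 - ζᴴ * ζ).det.re ∧ (((1 - ζᴴ * ζ).det.re : ℝ) : ℂ) = (1 - ζᴴ * ζ).det := by
  have := Complex.pos_iff.mp hζ.2.det_pos
  exact ⟨this.1, Complex.ext rfl (by rw [Complex.ofReal_im, this.2])⟩

lemma normFactor_pos {ζ : Matrix (Fin n) (Fin n) ℂ} (hζ : ζ ∈ domain n) : 0 < normFactor ζ :=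
  Real.sqrt_pos.mpr (det_one_sub_pos hζ).1

lemma normFactor_mul_self {ζ : Matrix (Fin n) (Fin n) ℂ} (hζ : ζ ∈ domain n) :
    (normFactor ζ : ℂ) * normFactor ζ = (1 - ζᴴ * ζ).det := by
  rw [← Complex.ofReal_mul, normFactor, Real.mul_self_sqrt (det_one_sub_pos hζ).1.le,
    (det_one_sub_pos hζ).2]

lemma norm_ket {ζ : Matrix (Fin n) (Fin n) ℂ} (hζ : ζ ∈ domain n) : ‖ket ζ‖ = 1 := by
  have h1 : inner ℂ (ket ζ) (ket ζ) = (1 : ℂ) := by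
    rw [inner_ket hζ hζ, normFactor_mul_self hζ, div_self (det_one_sub_ne_zero hζ hζ)]
  have h2 := inner_self_eq_norm_sq (𝕜 := ℂ) (ket ζ)
  rw [h1] at h2
  have h3 : ‖ket ζ‖ ^ 2 = 1 := by simpa using h2.symm
  exact (pow_eq_one_iff_of_nonneg (norm_nonneg _) two_ne_zero).mp h3

/-- The basis vector with one quantum in `A_d` and one in `B_c`. -/
def pairIndex (c d : Fin n) : Occ n := (Pi.single d 1, Pi.single c 1)

lemma expFam_zero (ζ : Matrix (Fin n) (Fin n) ℂ) : expFam ζ 0 = 1 := by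
  simp [expFam, expCoeff_zero, vacuum]

/-- The coefficients with one quantum of each type recover `ζ`. As the vacuum coefficient is `1`,
even the ray of `e_ζ` determines `ζ`. -/
lemma expFam_pairIndex (ζ : Matrix (Fin n) (Fin n) ℂ) (c d : Fin n) :
    expFam ζ (pairIndex c d) = ζ c d := by
  have h1 : expFam ζ (pairIndex c d) = opA d (expFam ζ) (0, Pi.single c 1) := by
    simp [opA_apply, pairIndex]
  have h2 : ∀ e, opBdag e (expFam ζ) (0, Pi.single c 1) = if e = c then 1 else 0 := by
    intro e
    rw [opBdag_apply]
    split_ifs with h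
    · subst h
      have : ((0, Pi.single e 1 - Pi.single e 1) : Occ n) = 0 := by simp
      rw [this, expFam_zero]
      simp
    · simp [Pi.single_eq_of_ne h]
  rw [h1, opA_expFam, Finset.sum_apply]
  simp [h2]

lemma ket_apply {ζ : Matrix (Fin n) (Fin n) ℂ} (hζ : ζ ∈ domain n) (i : Occ n) :
    ket ζ i = (normFactor ζ : ℂ) * expFam ζ i := by
  rw [ket_eq hζ, lp.coeFn_smul, Pi.smul_apply, coe_expFock hζ, smul_eq_mul]

lemma norm_inner_ket_le {ω ζ : Matrix (Fin n) (Fin n) ℂ} (hω : ω ∈ domain n)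
    (hζ : ζ ∈ domain n) : ‖(inner ℂ (ket ω) (ket ζ) : ℂ)‖ ≤ 1 := by
  have := norm_inner_le_norm (𝕜 := ℂ) (ket ω) (ket ζ)
  rwa [norm_ket hω, norm_ket hζ, one_mul] at this

lemma norm_inner_ket_eq_one_iff {ω ζ : Matrix (Fin n) (Fin n) ℂ} (hω : ω ∈ domain n)
    (hζ : ζ ∈ domain n) : ‖(inner ℂ (ket ω) (ket ζ) : ℂ)‖ = 1 ↔ ω = ζ := by
  have hne : ∀ {ξ : Matrix (Fin n) (Fin n) ℂ}, ξ ∈ domain n → ket ξ ≠ 0 := fun hξ h0 => by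
    have := norm_ket hξ
    simp [h0] at this
  constructor
  · intro h
    have h1 : ‖(inner ℂ (ket ω) (ket ζ) : ℂ)‖ = ‖ket ω‖ * ‖ket ζ‖ := by
      rw [h, norm_ket hω, norm_ket hζ, one_mul]
    obtain ⟨r, hr, hrζ⟩ := (norm_inner_eq_norm_iff (hne hω) (hne hζ)).mp h1
    have hcoord : ∀ i, (normFactor ζ : ℂ) * expFam ζ i = r * ((normFactor ω : ℂ) * expFam ω i) := by
      intro i
      rw [← ket_apply hζ, ← ket_apply hω, hrζ, lp.coeFn_smul, Pi.smul_apply, smul_eq_mul]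
    -- Equality in Cauchy–Schwarz makes the states proportional; the vacuum coefficient fixes the
    -- ratio, so the coefficients of the exponential vectors agree.
    have h0 : (normFactor ζ : ℂ) = r * normFactor ω := by simpa [expFam_zero] using hcoord 0
    have hN : (normFactor ζ : ℂ) ≠ 0 := by exact_mod_cast (normFactor_pos hζ).ne'
    ext c d
    have := hcoord (pairIndex c d)
    rw [expFam_pairIndex, expFam_pairIndex, ← mul_assoc, ← h0] at this
    exact (mul_left_cancel₀ hN this).symm
  · rintro rfl
    have := inner_self_eq_norm_sq_to_K (𝕜 := ℂ) (ket ω)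
    rw [this, norm_ket hω]
    simp

lemma matrixElementEq_of_pair {ω ζ : Matrix (Fin n) (Fin n) ℂ} (hω : ω ∈ domain n)
    (hζ : ζ ∈ domain n) {T : Module.End ℂ (Coeff n)} {c : ℂ} (hT : Memℓp (T (expFam ζ)) 2)
    (h : pair (expFam ω) (T (expFam ζ)) = pair (expFam ω) (expFam ζ) * c) :
    MatrixElementEq ω T ζ (inner ℂ (ket ω) (ket ζ) * c) := by
  have h1 : T (ket ζ) = (normFactor ζ : ℂ) • T (expFam ζ) := by
    rw [ket_eq hζ, lp.coeFn_smul, coe_expFock hζ, map_smul]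
  refine ⟨h1 ▸ hT.const_smul _, ?_⟩
  rw [h1, toFock_smul _ hT, ket_eq hω, ket_eq hζ, inner_smul_left, inner_smul_right,
    inner_smul_left, inner_smul_right, ← toFock_expFam hω, ← toFock_expFam hζ,
    inner_toFock (memlp_expFam hω) hT, inner_toFock (memlp_expFam hω) (memlp_expFam hζ), h]
  ring

/-- Square-summable families. -/
def sqSum (n : ℕ) : Submodule ℂ (Coeff n) where
  carrier := {f | Memℓp f 2}
  add_mem' hf hg := Memℓp.add hf hg
  zero_mem' := zero_memℓp
  smul_mem' c _ hf := Memℓp.const_smul hf c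

/-- The pairing with a square-summable family, as a linear map. -/
def pairSq {f : Coeff n} (hf : Memℓp f 2) : sqSum n →ₗ[ℂ] ℂ where
  toFun g := pair f g
  map_add' g h := by
    have hg : Memℓp (g : Coeff n) 2 := g.2
    have hh : Memℓp (h : Coeff n) 2 := h.2
    rw [Submodule.coe_add, ← inner_toFock hf (hg.add hh), ← inner_toFock hf hg,
      ← inner_toFock hf hh, toFock_add hg hh, inner_add_right]
  map_smul' c g := by simp [pair_smul_right]

/-- Each generator maps an exponential vector to this form, so all matrix elements reduce to traces
against the one matrix `raisedOverlap`. -/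
lemma pair_raise_add_smul {ω ζ : Matrix (Fin n) (Fin n) ℂ} (hω : ω ∈ domain n)
    (hζ : ζ ∈ domain n) (M : Matrix (Fin n) (Fin n) ℂ) (x : ℂ) :
    Memℓp (raise M (expFam ζ) + x • expFam ζ) 2 ∧
    pair (expFam ω) (raise M (expFam ζ) + x • expFam ζ)
      = (Mᵀ * raisedOverlap ω ζ).trace + x * pair (expFam ω) (expFam ζ) := by
  set v : Fin n → Fin n → sqSum n := fun c d =>
    ⟨opBdag c (opAdag d (expFam ζ)), (memlp_opBdag_opAdag_expFam hζ c d).1⟩ with hv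
  set w : sqSum n := ⟨expFam ζ, memlp_expFam hζ⟩ with hw
  have h1 : raise M (expFam ζ) + x • expFam ζ
      = ((∑ c, ∑ d, M c d • v c d + x • w : sqSum n) : Coeff n) := by
    simp [hv, hw, raise]
  rw [h1]
  refine ⟨(∑ c, ∑ d, M c d • v c d + x • w : sqSum n).2, ?_⟩
  have h2 := (pairSq (memlp_expFam hω)).map_add (∑ c, ∑ d, M c d • v c d) (x • w)
  simp only [map_sum, map_smul, smul_eq_mul] at h2
  refine h2.trans ?_
  congr 1
  exact Finset.sum_comm

/-! ### The generators applied to exponential vectors. -/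

lemma raise_sub (Z W : Matrix (Fin n) (Fin n) ℂ) : raise (Z - W) = raise Z - raise W := by
  rw [sub_eq_add_neg, raise_add, ← neg_one_smul ℂ W, raise_smul, sub_eq_add_neg,
    ← neg_one_smul ℂ (raise W)]

lemma raise_sum {ι : Type*} (s : Finset ι) (Z : ι → Matrix (Fin n) (Fin n) ℂ) :
    raise (∑ j ∈ s, Z j) = ∑ j ∈ s, raise (Z j) := by
  classical
  induction s using Finset.induction_on with
  | empty => simp [raise]
  | insert a s ha ih => rw [Finset.sum_insert ha, Finset.sum_insert ha, raise_add, ih]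

lemma raise_apply (Z : Matrix (Fin n) (Fin n) ℂ) (f : Coeff n) :
    raise Z f = ∑ c, ∑ d, Z c d • opBdag c (opAdag d f) := by
  simp [raise]

lemma opAdag_opBdag_apply (a b : Fin n) (f : Coeff n) :
    opAdag a (opBdag b f) = opBdag b (opAdag a f) :=
  LinearMap.congr_fun (commute_opAdag_opBdag a b).eq f

lemma opFtSum_eq (Z : Matrix (Fin n) (Fin n) ℂ) : opFtSum Z = raise (Z - Zᵀ) := by
  rw [raise_sub, opFtSum]
  simp only [opFt, smul_sub, Finset.sum_sub_distrib]
  congr 1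
  rw [raise, Finset.sum_comm]
  simp only [(commute_opAdag_opBdag _ _).eq, Matrix.transpose_apply]

/-- Each annihilator next to `e_ζ` is traded for creation operators; the trace comes from the `δ_ab`
in `E_ab`. -/
lemma opESum_expFam (X ζ : Matrix (Fin n) (Fin n) ℂ) :
    opESum X (expFam ζ) = raise (ζ * Xᵀ + X * ζ) (expFam ζ) + X.trace • expFam ζ := by
  have hE : ∀ a b, opE a b (expFam ζ) = ∑ c, ζ c b • opBdag c (opAdag a (expFam ζ))
      + ∑ d, ζ b d • opBdag a (opAdag d (expFam ζ)) + if a = b then expFam ζ else 0 := by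
    intro a b
    simp only [opE, LinearMap.add_apply, Module.End.mul_apply, opA_expFam, opB_expFam, map_sum,
      map_smul, opAdag_opBdag_apply]
    congr 1
    split_ifs <;> rfl
  simp only [opESum, LinearMap.sum_apply, LinearMap.smul_apply, hE, smul_add,
    Finset.sum_add_distrib, raise_add, LinearMap.add_apply]
  congr 1
  · congr 1
    · simp only [raise_apply, Matrix.mul_apply, Finset.sum_smul, Finset.smul_sum, smul_smul,
        Matrix.transpose_apply]
      rw [Finset.sum_congr rfl fun a _ => Finset.sum_comm, Finset.sum_comm]
      simp only [mul_comm]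
    · simp only [raise_apply, Matrix.mul_apply, Finset.sum_smul, Finset.smul_sum, smul_smul]
      exact Finset.sum_congr rfl fun a _ => Finset.sum_comm
  · simp [Matrix.trace, Finset.sum_smul]

/-- The first annihilator becomes a creation operator, past which the second must be commuted; the
commutators produce the scalar term. -/
lemma opFSum_expFam (Y ζ : Matrix (Fin n) (Fin n) ℂ) :
    opFSum Y (expFam ζ) = raise (ζ * (Y.map conj)ᵀ * ζ - ζ * Y.map conj * ζ) (expFam ζ)
      + (((Y.map conj)ᵀ * ζ).trace - (Y.map conj * ζ).trace) • expFam ζ := by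
  have hBA : ∀ a b, opB a (opA b (expFam ζ)) = raise (Matrix.of fun c d => ζ c b * ζ a d) (expFam ζ)
      + ζ a b • expFam ζ := by
    intro a b
    simp only [opA_expFam, map_sum, map_smul, opB_opBdag_apply, opB_expFam, smul_add,
      Finset.sum_add_distrib, raise_apply, Finset.smul_sum, smul_smul, Matrix.of_apply]
    simp
  have hAB : ∀ a b, opA a (opB b (expFam ζ)) = raise (Matrix.of fun c d => ζ c a * ζ b d) (expFam ζ)
      + ζ b a • expFam ζ := by
    intro a b
    simp only [opB_expFam, map_sum, map_smul, opA_opAdag_apply, opA_expFam, smul_add,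
      Finset.sum_add_distrib, raise_apply, Finset.smul_sum, smul_smul, Matrix.of_apply,
      opAdag_opBdag_apply]
    rw [Finset.sum_comm]
    simp [mul_comm]
  have h1 : ζ * (Y.map conj)ᵀ * ζ
      = ∑ a, ∑ b, conj (Y a b) • Matrix.of fun c d => ζ c b * ζ a d := by
    ext c d
    simp only [Matrix.mul_apply, Matrix.sum_apply, Matrix.smul_apply, Matrix.of_apply,
      smul_eq_mul, Finset.sum_mul, Matrix.transpose_apply, Matrix.map_apply]
    exact Finset.sum_congr rfl fun a _ => Finset.sum_congr rfl fun b _ => by ring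
  have h2 : ζ * Y.map conj * ζ
      = ∑ a, ∑ b, conj (Y a b) • Matrix.of fun c d => ζ c a * ζ b d := by
    ext c d
    simp only [Matrix.mul_apply, Matrix.sum_apply, Matrix.smul_apply, Matrix.of_apply,
      smul_eq_mul, Finset.sum_mul, Matrix.map_apply]
    rw [Finset.sum_comm]
    exact Finset.sum_congr rfl fun a _ => Finset.sum_congr rfl fun b _ => by ring
  have h3 : ((Y.map conj)ᵀ * ζ).trace = ∑ a, ∑ b, conj (Y a b) * ζ a b := by
    simp only [Matrix.trace, Matrix.diag_apply, Matrix.mul_apply, Matrix.transpose_apply,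
      Matrix.map_apply]
    exact Finset.sum_comm
  have h4 : (Y.map conj * ζ).trace = ∑ a, ∑ b, conj (Y a b) * ζ b a := by
    simp only [Matrix.trace, Matrix.diag_apply, Matrix.mul_apply, Matrix.map_apply]
  rw [h1, h2, h3, h4]
  simp only [opFSum, opF, LinearMap.sum_apply, LinearMap.smul_apply, LinearMap.sub_apply,
    Module.End.mul_apply, hBA, hAB, raise_sub, raise_sum, raise_smul, sub_smul, Finset.sum_smul,
    smul_sub, smul_add, Finset.sum_sub_distrib, Finset.sum_add_distrib, smul_smul]
  abel

/-! ### Matrix elements -/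

lemma isUnit_det_one_sub {ω ζ : Matrix (Fin n) (Fin n) ℂ} (hω : ω ∈ domain n)
    (hζ : ζ ∈ domain n) : IsUnit (1 - ωᴴ * ζ).det :=
  (det_one_sub_ne_zero hω hζ).isUnit

/-- Solves `raisedOverlap_mul` by means of the push-through identity `ω*(1 - ζω*) = (1 - ω*ζ)ω*`. -/
lemma raisedOverlap_eq {ω ζ : Matrix (Fin n) (Fin n) ℂ} (hω : ω ∈ domain n)
    (hζ : ζ ∈ domain n) : raisedOverlap ω ζ
      = -(pair (expFam ω) (expFam ζ) • ((1 - ωᴴ * ζ)⁻¹ * ωᴴ)) := by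
  have hu : IsUnit (1 - ζ * ωᴴ).det := by
    rw [← Matrix.det_one_sub_mul_comm]; exact isUnit_det_one_sub hω hζ
  have h1 := raisedOverlap_mul hω hζ
  have h2 : (1 - ωᴴ * ζ)⁻¹ * ωᴴ * (1 - ζ * ωᴴ) = ωᴴ := by
    have : ωᴴ * (1 - ζ * ωᴴ) = (1 - ωᴴ * ζ) * ωᴴ := by
      rw [Matrix.mul_sub, Matrix.sub_mul, Matrix.mul_one, Matrix.one_mul, Matrix.mul_assoc]
    rw [Matrix.mul_assoc, this, Matrix.nonsing_inv_mul_cancel_left _ _ (isUnit_det_one_sub hω hζ)]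
  have h3 : raisedOverlap ω ζ * (1 - ζ * ωᴴ)
      = -(pair (expFam ω) (expFam ζ) • ((1 - ωᴴ * ζ)⁻¹ * ωᴴ)) * (1 - ζ * ωᴴ) := by
    rw [h1, Matrix.neg_mul, Matrix.smul_mul, h2]
  rw [← Matrix.mul_nonsing_inv_cancel_right _ (raisedOverlap ω ζ) hu, h3,
    Matrix.mul_nonsing_inv_cancel_right _ _ hu]

lemma raisedOverlap_transpose {ω ζ : Matrix (Fin n) (Fin n) ℂ} (hω : ω ∈ domain n)
    (hζ : ζ ∈ domain n) : (raisedOverlap ω ζ)ᵀ = - raisedOverlap ω ζ := by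
  have hu : IsUnit (1 - ζ * ωᴴ).det := by
    rw [← Matrix.det_one_sub_mul_comm]; exact isUnit_det_one_sub hω hζ
  have h2 : (1 - ωᴴ * ζ)⁻¹ * ωᴴ = ωᴴ * (1 - ζ * ωᴴ)⁻¹ := by
    have : ωᴴ * (1 - ζ * ωᴴ) = (1 - ωᴴ * ζ) * ωᴴ := by
      rw [Matrix.mul_sub, Matrix.sub_mul, Matrix.mul_one, Matrix.one_mul, Matrix.mul_assoc]
    rw [← Matrix.mul_nonsing_inv_cancel_right _ ((1 - ωᴴ * ζ)⁻¹ * ωᴴ) hu,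
      Matrix.mul_assoc _ ωᴴ, this,
      Matrix.nonsing_inv_mul_cancel_left _ _ (isUnit_det_one_sub hω hζ)]
  rw [raisedOverlap_eq hω hζ, Matrix.transpose_neg, Matrix.transpose_smul, Matrix.transpose_mul,
    Matrix.transpose_nonsing_inv, Matrix.transpose_sub, Matrix.transpose_mul, Matrix.transpose_one,
    conjTranspose_transpose_of_antisymm hω.1, hζ.1, neg_mul_neg, Matrix.neg_mul, smul_neg, h2]

lemma trace_single_one_mul (a b : Fin n) (M : Matrix (Fin n) (Fin n) ℂ) :
    (Matrix.single a b (1 : ℂ) * M).trace = M b a := by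
  rw [Matrix.trace_single_mul, one_smul]

lemma opESum_single (a b : Fin n) : opESum (Matrix.single a b (1 : ℂ)) = opE a b := by
  simp [opESum, Matrix.single_apply, ite_and]

lemma opFSum_single (a b : Fin n) : opFSum (Matrix.single a b (1 : ℂ)) = opF a b := by
  simp [opFSum, Matrix.single_apply, ite_and, apply_ite conj]

lemma opFtSum_single (a b : Fin n) : opFtSum (Matrix.single a b (1 : ℂ)) = opFt a b := by
  simp [opFtSum, Matrix.single_apply, ite_and]

lemma inv_one_sub_eq {ω ζ : Matrix (Fin n) (Fin n) ℂ} (hω : ω ∈ domain n) (hζ : ζ ∈ domain n) :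
    (1 - ωᴴ * ζ)⁻¹ = 1 + (1 - ωᴴ * ζ)⁻¹ * ωᴴ * ζ ∧
      (1 - ωᴴ * ζ)⁻¹ * ωᴴ * ζ = ωᴴ * ζ * (1 - ωᴴ * ζ)⁻¹ := by
  have h1 := Matrix.nonsing_inv_mul _ (isUnit_det_one_sub hω hζ)
  have h2 := Matrix.mul_nonsing_inv _ (isUnit_det_one_sub hω hζ)
  rw [Matrix.mul_sub, Matrix.mul_one, sub_eq_iff_eq_add, ← Matrix.mul_assoc] at h1
  rw [Matrix.sub_mul, Matrix.one_mul, sub_eq_iff_eq_add] at h2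
  exact ⟨h1, add_left_cancel (h1.symm.trans h2)⟩

theorem matrixElementEq_opE {ω ζ : Matrix (Fin n) (Fin n) ℂ} (hω : ω ∈ domain n)
    (hζ : ζ ∈ domain n) (a b : Fin n) : MatrixElementEq ω (opE a b) ζ
      (inner ℂ (ket ω) (ket ζ) *
        (1 + (2 : ℂ) • (ωᴴ * ζ * (1 - ωᴴ * ζ)⁻¹) : Matrix (Fin n) (Fin n) ℂ) a b) := by
  have h1 := opESum_expFam (Matrix.single a b (1 : ℂ)) ζ
  rw [opESum_single] at h1
  obtain ⟨h2, h3⟩ := pair_raise_add_smul hω hζ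
    (ζ * (Matrix.single a b (1 : ℂ))ᵀ + Matrix.single a b (1 : ℂ) * ζ)
    (Matrix.single a b (1 : ℂ)).trace
  rw [← h1] at h2 h3
  refine matrixElementEq_of_pair hω hζ h2 (h3.trans ?_)
  -- Antisymmetry of `ζ` and of `raisedOverlap` identifies the `A` and `B` contributions, which
  -- produces the factor `2`.
  have h4 : (ζ * raisedOverlap ω ζ) b a = (raisedOverlap ω ζ * ζ) a b := by
    rw [← Matrix.transpose_apply (ζ * raisedOverlap ω ζ), Matrix.transpose_mul, hζ.1,
      raisedOverlap_transpose hω hζ, neg_mul_neg]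
  have h5 : (Matrix.single a b (1 : ℂ)).trace = (1 : Matrix (Fin n) (Fin n) ℂ) a b := by
    rw [← Matrix.mul_one (Matrix.single a b (1 : ℂ)), trace_single_one_mul, Matrix.one_apply,
      Matrix.one_apply]
    simp [eq_comm]
  rw [Matrix.transpose_add, Matrix.transpose_mul, Matrix.transpose_mul, Matrix.transpose_transpose,
    Matrix.add_mul, Matrix.trace_add, hζ.1, Matrix.mul_assoc, trace_single_one_mul, Matrix.neg_mul,
    Matrix.neg_mul, Matrix.neg_apply, Matrix.neg_mul, Matrix.trace_neg, Matrix.mul_assoc,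
    Matrix.trace_mul_comm, Matrix.mul_assoc, Matrix.transpose_single, trace_single_one_mul, h4, h5,
    raisedOverlap_eq hω hζ, Matrix.neg_mul, Matrix.smul_mul, (inv_one_sub_eq hω hζ).2]
  simp only [Matrix.neg_apply, Matrix.add_apply, Matrix.smul_apply, smul_eq_mul]
  ring

theorem matrixElementEq_opF {ω ζ : Matrix (Fin n) (Fin n) ℂ} (hω : ω ∈ domain n)
    (hζ : ζ ∈ domain n) (a b : Fin n) : MatrixElementEq ω (opF a b) ζ
      (inner ℂ (ket ω) (ket ζ) * ((2 : ℂ) • (ζ * (1 - ωᴴ * ζ)⁻¹)) a b) := by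
  have h1 := opFSum_expFam (Matrix.single a b (1 : ℂ)) ζ
  have hmap : (Matrix.single a b (1 : ℂ)).map conj = Matrix.single a b (1 : ℂ) := by
    ext c d
    simp [Matrix.single_apply, apply_ite conj]
  rw [opFSum_single, hmap] at h1
  obtain ⟨h2, h3⟩ := pair_raise_add_smul hω hζ
    (ζ * (Matrix.single a b (1 : ℂ))ᵀ * ζ - ζ * Matrix.single a b (1 : ℂ) * ζ)
    (((Matrix.single a b (1 : ℂ))ᵀ * ζ).trace - (Matrix.single a b (1 : ℂ) * ζ).trace)
  rw [← h1] at h2 h3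
  refine matrixElementEq_of_pair hω hζ h2 (h3.trans ?_)
  set S := raisedOverlap ω ζ with hS
  have h4 : (ζ * (S * ζ)) b a = - (ζ * (S * ζ)) a b := by
    rw [← Matrix.transpose_apply (ζ * (S * ζ)), Matrix.transpose_mul, Matrix.transpose_mul, hζ.1,
      hS, raisedOverlap_transpose hω hζ, neg_mul_neg, Matrix.mul_neg, Matrix.neg_apply,
      Matrix.mul_assoc]
  have h5 : ζ b a = - ζ a b := congrFun (congrFun hζ.1 a) b
  have h6 : ∀ E : Matrix (Fin n) (Fin n) ℂ, ((ζ * E * ζ)ᵀ * S).trace = (Eᵀ * (ζ * (S * ζ))).trace := by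
    intro E
    rw [Matrix.transpose_mul, Matrix.transpose_mul, hζ.1, Matrix.mul_neg, Matrix.mul_neg,
      Matrix.neg_mul, Matrix.neg_mul, Matrix.neg_mul, neg_neg, Matrix.mul_assoc,
      Matrix.trace_mul_comm]
    simp only [Matrix.mul_assoc]
  -- The summand `ζ` matches the scalar part of `opFSum_expFam`, the other summand its raised part.
  have h7 : (ζ * (1 - ωᴴ * ζ)⁻¹) = ζ + ζ * ((1 - ωᴴ * ζ)⁻¹ * ωᴴ * ζ) := by
    nth_rewrite 1 [(inv_one_sub_eq hω hζ).1]
    rw [Matrix.mul_add, Matrix.mul_one]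
  rw [Matrix.transpose_sub, Matrix.sub_mul, Matrix.trace_sub, h6, h6, Matrix.transpose_transpose,
    Matrix.transpose_single, trace_single_one_mul, trace_single_one_mul, trace_single_one_mul,
    trace_single_one_mul, h4, h5, h7, hS, raisedOverlap_eq hω hζ, Matrix.neg_mul, Matrix.smul_mul,
    Matrix.mul_neg, Matrix.mul_smul]
  simp only [Matrix.neg_apply, Matrix.add_apply, Matrix.smul_apply, smul_eq_mul]
  ring

theorem matrixElementEq_opFt {ω ζ : Matrix (Fin n) (Fin n) ℂ} (hω : ω ∈ domain n)
    (hζ : ζ ∈ domain n) (a b : Fin n) : MatrixElementEq ω (opFt a b) ζ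
      (inner ℂ (ket ω) (ket ζ) * ((2 : ℂ) • ((1 - ωᴴ * ζ)⁻¹ * ω.map conj)) a b) := by
  obtain ⟨h2, h3⟩ := pair_raise_add_smul hω hζ
    (Matrix.single a b (1 : ℂ) - (Matrix.single a b (1 : ℂ))ᵀ) 0
  have h1 : opFt a b (expFam ζ) = raise (Matrix.single a b (1 : ℂ) - (Matrix.single a b (1 : ℂ))ᵀ)
      (expFam ζ) + (0 : ℂ) • expFam ζ := by
    rw [← opFtSum_eq, opFtSum_single, zero_smul, add_zero]
  rw [← h1] at h2 h3
  refine matrixElementEq_of_pair hω hζ h2 (h3.trans ?_)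
  have h4 : raisedOverlap ω ζ b a = - raisedOverlap ω ζ a b :=
    congrFun (congrFun (raisedOverlap_transpose hω hζ) a) b
  rw [Matrix.transpose_sub, Matrix.transpose_transpose, Matrix.sub_mul, Matrix.trace_sub,
    Matrix.transpose_single, trace_single_one_mul, trace_single_one_mul, h4,
    raisedOverlap_eq hω hζ, map_conj_eq_neg_conjTranspose hω.1, Matrix.mul_neg]
  simp only [Matrix.neg_apply, Matrix.smul_apply, smul_eq_mul]
  ring

/-! ### The intertwiners -/

lemma continuous_fock_apply (i : Occ n) : Continuous fun ψ : Fock n => (ψ : Coeff n) i :=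
  (lp.evalCLM ℂ (fun _ : Occ n => ℂ) 2 i).continuous

lemma opJplus_apply (f : Coeff n) : opJplus n f = ∑ a, opAdag a (opB a f) := by
  simp [opJplus]

lemma opJminus_apply (f : Coeff n) : opJminus n f = ∑ a, opBdag a (opA a f) := by
  simp [opJminus]

lemma opJz_apply (f : Coeff n) (i : Occ n) :
    opJz n f i = (1 / 2 : ℂ) * (((∑ a, i.1 a : ℕ) : ℂ) - ((∑ a, i.2 a : ℕ) : ℂ)) * f i := by
  simp only [opJz, LinearMap.smul_apply, LinearMap.sum_apply, LinearMap.sub_apply,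
    Module.End.mul_apply, Pi.smul_apply, Finset.sum_apply, Pi.sub_apply, opAdag_mul_opA_apply,
    opBdag_mul_opB_apply, smul_eq_mul, Finset.sum_sub_distrib, ← Finset.sum_mul]
  push_cast
  ring

/-- The operators `J` are unbounded, but each coefficient of `J ψ` involves only finitely many
coefficients of `ψ`, hence is continuous in `ψ`. -/
lemma isClosed_intertwiners : IsClosed (intertwiners n : Set (Fock n)) := by
  have hc := continuous_fock_apply (n := n)
  have h1 : ∀ i, Continuous fun ψ : Fock n => opJz n (ψ : Coeff n) i := fun i => by
    simp only [opJz_apply]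
    exact continuous_const.mul (hc i)
  have h2 : ∀ i, Continuous fun ψ : Fock n => opJplus n (ψ : Coeff n) i := fun i => by
    simp only [opJplus_apply, Finset.sum_apply, opAdag_apply, opB_apply]
    exact continuous_finsetSum _ fun a _ => continuous_const.mul (continuous_const.mul (hc _))
  have h3 : ∀ i, Continuous fun ψ : Fock n => opJminus n (ψ : Coeff n) i := fun i => by
    simp only [opJminus_apply, Finset.sum_apply, opBdag_apply, opA_apply]
    exact continuous_finsetSum _ fun a _ => continuous_const.mul (continuous_const.mul (hc _))
  have h4 : (intertwiners n : Set (Fock n))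
      = ⋂ i, {ψ : Fock n | opJz n (ψ : Coeff n) i = 0} ∩
        ({ψ : Fock n | opJplus n (ψ : Coeff n) i = 0} ∩
        {ψ : Fock n | opJminus n (ψ : Coeff n) i = 0}) := by
    ext ψ
    simp only [Set.mem_iInter, Set.mem_inter_iff, Set.mem_ofPred_eq]
    exact ⟨fun h i => ⟨congrFun h.1 i, congrFun h.2.1 i, congrFun h.2.2 i⟩,
      fun h => ⟨funext fun i => (h i).1, funext fun i => (h i).2.1, funext fun i => (h i).2.2⟩⟩
  rw [h4]
  exact isClosed_iInter fun i => (isClosed_eq (h1 i) continuous_const).inter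
    ((isClosed_eq (h2 i) continuous_const).inter (isClosed_eq (h3 i) continuous_const))

instance : CompleteSpace (intertwiners n) := isClosed_intertwiners.completeSpace_coe

lemma opJz_of_hasDeg {k : ℕ} {f : Coeff n} (hf : HasDeg k k f) : opJz n f = 0 := by
  ext i
  rw [opJz_apply]
  by_cases h : f i = 0
  · simp [h]
  · rw [(hf i h).1, (hf i h).2]; simp

lemma apply_expCoeff_eq_zero {T : Module.End ℂ (Coeff n)} {Z : Matrix (Fin n) (Fin n) ℂ}
    (h : Commute T (raise Z)) (h0 : T (vacuum n) = 0) (k : ℕ) : T (expCoeff Z k) = 0 := by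
  rw [expCoeff, map_smul, ← Module.End.mul_apply, (h.pow_right k).eq, Module.End.mul_apply, h0,
    map_zero, smul_zero]

lemma expCoeff_invariant {Z : Matrix (Fin n) (Fin n) ℂ} (hZ : Zᵀ = -Z) (k : ℕ) :
    opJz n (expCoeff Z k) = 0 ∧ opJplus n (expCoeff Z k) = 0 ∧ opJminus n (expCoeff Z k) = 0 := by
  refine ⟨opJz_of_hasDeg (hasDeg_expCoeff Z k),
    apply_expCoeff_eq_zero (commute_opJplus_raise hZ) ?_ k,
    apply_expCoeff_eq_zero (commute_opJminus_raise hZ) ?_ k⟩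
  · simp [opJplus_apply, opB_vacuum]
  · simp [opJminus_apply, opA_vacuum]

lemma toFock_mem_intertwiners {f : Coeff n} (hf : Memℓp f 2)
    (h : opJz n f = 0 ∧ opJplus n f = 0 ∧ opJminus n f = 0) : toFock f ∈ intertwiners n := by
  change _ ∧ _ ∧ _
  rwa [toFock_coe hf]

lemma expFock_mem {ζ : Matrix (Fin n) (Fin n) ℂ} (hζ : ζ ∈ domain n) :
    expFock ζ ∈ intertwiners n := by
  have h := (summable_toFock_expCoeff hζ).hasSum
  refine isClosed_intertwiners.mem_of_tendsto h (Filter.Eventually.of_forall fun s => ?_)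
  exact Submodule.sum_mem _ fun k _ => toFock_mem_intertwiners
    (memlp_of_mem_finSupp (expCoeff_mem_finSupp ζ k)) (expCoeff_invariant hζ.1 k)

lemma ket_mem {ζ : Matrix (Fin n) (Fin n) ℂ} (hζ : ζ ∈ domain n) : ket ζ ∈ intertwiners n := by
  rw [ket_eq hζ]
  exact Submodule.smul_mem _ _ (expFock_mem hζ)

/-- The exponential vector as an intertwiner. -/
def expVec (ζ : domain n) : intertwiners n := ⟨expFock ζ.1, expFock_mem ζ.2⟩

/-! ### The exponential vectors are total in the space of intertwiners -/

/-- A Capelli-type identity. On the kernel of `J_+`, in degree `(m+1, m+1)`, the right side is the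
nonzero scalar `2(m+1)(m+2)`, so a vector there is recovered from its images under the `F_ab`. -/
lemma sum_opFt_mul_opF : ∑ a, ∑ b, opFt a b * opF a b
    = (2 : ℂ) • ((∑ a, opBdag a * opB a) * ∑ a : Fin n, opAdag a * opA a)
      + (2 : ℂ) • (∑ a, opBdag a * opB a) - (2 : ℂ) • (opJminus n * opJplus n) := by
  have h1 : ∀ a b : Fin n, opBdag a * opAdag b * (opB a * opA b)
      = (opBdag a * opB a) * (opAdag b * opA b) := by
    intro a b
    rw [mul_assoc, ← mul_assoc (opAdag b), (commute_opAdag_opB b a).eq]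
    simp only [mul_assoc]
  have h2 : ∀ a b : Fin n, opBdag a * opAdag b * (opA a * opB b)
      = (opBdag a * opA a) * (opAdag b * opB b) - if a = b then opBdag a * opB b else 0 := by
    intro a b
    have : opAdag b * opA a = opA a * opAdag b - if a = b then 1 else 0 :=
      eq_sub_of_add_eq (opA_mul_opAdag a b).symm
    rw [mul_assoc, ← mul_assoc (opAdag b), this]
    split_ifs <;> simp [mul_assoc, mul_sub, sub_mul]
  have h3 : ∀ a b : Fin n, opFt a b * opF a b
      = (opBdag a * opB a) * (opAdag b * opA b) + (opBdag b * opB b) * (opAdag a * opA a)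
        - ((opBdag a * opA a) * (opAdag b * opB b) - if a = b then opBdag a * opB b else 0)
        - ((opBdag b * opA b) * (opAdag a * opB a) - if b = a then opBdag b * opB a else 0) := by
    intro a b
    rw [← h1, ← h1, ← h2, ← h2, opFt, opF, sub_mul, mul_sub, mul_sub,
      (commute_opAdag_opBdag a b).eq, ← (commute_opA_opB a b).eq, ← (commute_opA_opB b a).eq]
    abel
  simp only [h3, Finset.sum_sub_distrib, Finset.sum_add_distrib, Finset.sum_ite_eq,
    Finset.sum_ite_eq', Finset.mem_univ, if_true]
  rw [Finset.sum_comm (f := fun a b => opBdag b * opB b * (opAdag a * opA a)),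
    Finset.sum_comm (f := fun a b => opBdag b * opA b * (opAdag a * opB a))]
  simp only [← Finset.sum_mul_sum, two_smul, opJplus, opJminus]
  abel

lemma opA_mul_opJplus (a : Fin n) : opA a * opJplus n = opJplus n * opA a + opB a := by
  have h : ∀ c : Fin n, opA a * (opAdag c * opB c)
      = opAdag c * opB c * opA a + if a = c then opB c else 0 := by
    intro c
    rw [← mul_assoc, opA_mul_opAdag, add_mul, mul_assoc, (commute_opA_opB a c).eq, mul_assoc]
    split_ifs <;> simp
  simp [opJplus, Finset.mul_sum, Finset.sum_mul, h, Finset.sum_add_distrib]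

lemma opB_mul_opJplus (a : Fin n) : opB a * opJplus n = opJplus n * opB a := by
  rw [opJplus, Finset.mul_sum, Finset.sum_mul]
  refine Finset.sum_congr rfl fun c _ => ?_
  rw [← mul_assoc, ← (commute_opAdag_opB c a).eq, mul_assoc, (commute_opB_opB a c).eq, mul_assoc]

/-- Both terms of `F_ab` have commutator `B_a B_b` with `J_+`, and these cancel. Hence `F_ab`
preserves the kernel of `J_+`, as the induction on the degree requires. -/
lemma commute_opF_opJplus (a b : Fin n) : Commute (opF a b) (opJplus n) := by
  rw [commute_iff_eq, opF, sub_mul, mul_sub, mul_assoc, opA_mul_opJplus, mul_add, ← mul_assoc,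
    opB_mul_opJplus, mul_assoc, mul_assoc (opA a), opB_mul_opJplus, ← mul_assoc (opA a),
    opA_mul_opJplus, add_mul, mul_assoc]
  abel

/-- The pairing against a fixed family, on finitely supported families. -/
def pairLeft (h : Coeff n) : finSupp n →ₗ⋆[ℂ] ℂ where
  toFun f := pair f h
  map_add' f g := by
    simp only [pair, Submodule.coe_add, Pi.add_apply, map_add, add_mul]
    exact (summable_pair_of_left f.2 h).tsum_add (summable_pair_of_left g.2 h)
  map_smul' c f := by simp [pair_smul_left]

lemma pair_raise_left {f : Coeff n} (hf : f ∈ finSupp n) (W : Matrix (Fin n) (Fin n) ℂ)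
    (φ : Coeff n) :
    pair (raise W f) φ = pair f (∑ c, ∑ d, conj (W c d) • opA d (opB c φ)) := by
  set v : Fin n → Fin n → finSupp n := fun c d =>
    ⟨opBdag c (opAdag d f), opBdag_mem_finSupp c (opAdag_mem_finSupp d hf)⟩ with hv
  have h1 : raise W f = ((∑ c, ∑ d, W c d • v c d : finSupp n) : Coeff n) := by
    simp [hv, raise_apply]
  have h2 : pairLeft φ (∑ c, ∑ d, W c d • v c d) = pair (raise W f) φ := by rw [h1]; rfl
  rw [← h2]
  simp only [map_sum, pair_sum_right hf, map_smulₛₗ, pair_smul_right]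
  refine Finset.sum_congr rfl fun c _ => Finset.sum_congr rfl fun d _ => ?_
  rw [smul_eq_mul]
  congr 1
  change pair (opBdag c (opAdag d f)) φ = _
  rw [pair_opBdag_left, pair_opAdag_left]

/-- Polarisation of powers of the raising operator. -/
lemma pair_polarize {m : ℕ} {φ : Coeff n}
    (h : ∀ Z : Matrix (Fin n) (Fin n) ℂ, Zᵀ = -Z → pair ((raise Z ^ (m + 1)) (vacuum n)) φ = 0)
    {Z W : Matrix (Fin n) (Fin n) ℂ} (hZ : Zᵀ = -Z) (hW : Wᵀ = -W) :
    pair (raise W ((raise Z ^ m) (vacuum n))) φ = 0 := by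
  have hmem : ∀ i j, (raise W ^ i) ((raise Z ^ j) (vacuum n)) ∈ finSupp n := by
    intro i j
    induction i with
    | zero => exact raise_pow_mem_finSupp Z j
    | succ i ih => rw [pow_succ', Module.End.mul_apply]; exact raise_mem_finSupp W ih
  -- The pairing is conjugate linear on the left, so replacing `Z` by `conj t • W + Z` gives a
  -- polynomial in `t` with coefficients `c k`. It vanishes identically, and its linear coefficient
  -- is `m + 1` times the desired pairing.
  set c : ℕ → ℂ := fun k =>
    ((m + 1).choose k : ℂ) * pair ((raise W ^ k) ((raise Z ^ (m + 1 - k)) (vacuum n))) φ with hc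
  set p : Polynomial ℂ := ∑ k ∈ Finset.range (m + 2), Polynomial.C (c k) * Polynomial.X ^ k with hp
  have hp0 : p = 0 := by
    refine Polynomial.funext fun t => ?_
    have h1 := h (conj t • W + Z) (by
      rw [Matrix.transpose_add, Matrix.transpose_smul, hZ, hW, smul_neg, neg_add])
    have hcomm : Commute (conj t • raise W) (raise Z) := (commute_raise_raise W Z).smul_left _
    rw [raise_add, raise_smul, hcomm.add_pow] at h1
    set v : ℕ → finSupp n := fun k =>
      ⟨(raise W ^ k) ((raise Z ^ (m + 1 - k)) (vacuum n)), hmem _ _⟩ with hv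
    have h2 : (∑ k ∈ Finset.range (m + 1 + 1), (conj t • raise W) ^ k * raise Z ^ (m + 1 - k) *
        ((m + 1).choose k : Module.End ℂ (Coeff n))) (vacuum n)
        = ((∑ k ∈ Finset.range (m + 1 + 1),
          ((conj t) ^ k * ((m + 1).choose k : ℂ)) • v k : finSupp n) : Coeff n) := by
      simp only [hv, LinearMap.sum_apply, Submodule.coe_sum, Submodule.coe_smul]
      refine Finset.sum_congr rfl fun k _ => ?_
      rw [← Nat.cast_comm, Module.End.mul_apply, Module.End.mul_apply, smul_pow,
        LinearMap.smul_apply, Module.End.natCast_apply, ← Nat.cast_smul_eq_nsmul ℂ, smul_smul,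
        mul_comm]
    rw [h2] at h1
    have h3 : pairLeft φ (∑ k ∈ Finset.range (m + 1 + 1),
          ((conj t) ^ k * ((m + 1).choose k : ℂ)) • v k) = 0 := h1
    rw [map_sum] at h3
    rw [hp, Polynomial.eval_finsetSum, Polynomial.eval_zero, ← h3]
    refine Finset.sum_congr rfl fun k _ => ?_
    rw [map_smulₛₗ, Polynomial.eval_mul, Polynomial.eval_C, Polynomial.eval_pow, Polynomial.eval_X,
      hc, smul_eq_mul, map_mul, map_pow, Complex.conj_conj, map_natCast]
    change _ = _ * pair ((raise W ^ k) ((raise Z ^ (m + 1 - k)) (vacuum n))) φ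
    ring
  have h4 := congrArg (fun q => Polynomial.coeff q 1) hp0
  simp only [hp, Polynomial.finsetSum_coeff, Polynomial.coeff_C_mul, Polynomial.coeff_X_pow,
    Polynomial.coeff_zero, mul_ite, mul_one, mul_zero] at h4
  rw [Finset.sum_ite_eq, if_pos (Finset.mem_range.mpr (by omega)), hc] at h4
  simp only [Nat.choose_one_right, pow_one, Nat.add_sub_cancel] at h4
  exact (mul_eq_zero.mp h4).resolve_left (by exact_mod_cast m.succ_ne_zero)

/-- Induction on the degree: by polarisation each `F_ab φ` inherits the orthogonality in degree `m`,
so it vanishes there. Then `∑ F̃_ab F_ab φ` vanishes in degree `m + 1`, and the Capelli-type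
identity makes it a nonzero multiple of `φ`. -/
lemma eq_zero_of_pair_raise_pow (m : ℕ) : ∀ φ : Coeff n, opJplus n φ = 0 →
    (∀ Z : Matrix (Fin n) (Fin n) ℂ, Zᵀ = -Z → pair ((raise Z ^ m) (vacuum n)) φ = 0) →
    ∀ i : Occ n, ∑ a, i.1 a = m → ∑ a, i.2 a = m → φ i = 0 := by
  induction m with
  | zero =>
    intro φ _ h i h1 h2
    have hi : i = 0 := by
      refine Prod.ext (funext fun a => ?_) (funext fun a => ?_)
      · exact Finset.sum_eq_zero_iff.mp h1 a (Finset.mem_univ a)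
      · exact Finset.sum_eq_zero_iff.mp h2 a (Finset.mem_univ a)
    have h0 := h 0 (by simp)
    rw [pow_zero, Module.End.one_apply, pair, tsum_eq_single 0] at h0
    · simpa [vacuum, hi] using h0
    · intro j hj
      simp [vacuum, Pi.single_eq_of_ne hj]
  | succ m ih =>
    intro φ hJ h i h1 h2
    have hF : ∀ a b : Fin n, ∀ j : Occ n, ∑ c, j.1 c = m → ∑ c, j.2 c = m →
        opF a b φ j = 0 := by
      intro a b
      refine ih _ ?_ fun Z hZ => ?_
      · rw [← Module.End.mul_apply, ← (commute_opF_opJplus a b).eq, Module.End.mul_apply, hJ,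
          map_zero]
      · have hW : (Matrix.single a b (1 : ℂ) - (Matrix.single a b (1 : ℂ))ᵀ)ᵀ
            = -(Matrix.single a b (1 : ℂ) - (Matrix.single a b (1 : ℂ))ᵀ) := by
          rw [Matrix.transpose_sub, Matrix.transpose_transpose, neg_sub]
        have h3 := pair_polarize h hZ hW
        rw [pair_raise_left (raise_pow_mem_finSupp Z m)] at h3
        have h4 : ∑ c, ∑ d, conj ((Matrix.single a b (1 : ℂ) - (Matrix.single a b (1 : ℂ))ᵀ) c d) •
            opA d (opB c φ) = opF a b φ := by
          have : ∀ c d, opA c (opB d φ) = opB d (opA c φ) := fun c d =>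
            LinearMap.congr_fun (commute_opA_opB c d).eq φ
          simp [Matrix.single_apply, ite_and, apply_ite conj, sub_smul, Finset.sum_sub_distrib,
            opF, this, Module.End.mul_apply]
        rwa [h4] at h3
    have hFt : ∀ a b : Fin n, opFt a b (opF a b φ) i = 0 := by
      intro a b
      have key : ∀ c d : Fin n, opBdag c (opAdag d (opF a b φ)) i = 0 := by
        intro c d
        rw [opBdag_apply, opAdag_apply]
        by_cases hd : i.1 d = 0
        · simp [hd]
        by_cases hc : i.2 c = 0
        · simp [hc]
        rw [hF a b _ (by rw [sum_sub_single hd, h1]; rfl) (by rw [sum_sub_single hc, h2]; rfl)]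
        simp
      simp only [opFt, LinearMap.sub_apply, Module.End.mul_apply, Pi.sub_apply,
        opAdag_opBdag_apply, key, sub_zero]
    have hcap := congrFun (LinearMap.congr_fun (sum_opFt_mul_opF (n := n)) φ) i
    have hN : ∀ f : Coeff n, (∑ a, opBdag a * opB a : Module.End ℂ (Coeff n)) f i
        = ((∑ a, i.2 a : ℕ) : ℂ) * f i := by
      intro f
      simp only [LinearMap.sum_apply, Module.End.mul_apply, Finset.sum_apply,
        opBdag_mul_opB_apply, ← Finset.sum_mul]
      push_cast
      rfl
    have hM : ∀ f : Coeff n, (∑ a, opAdag a * opA a : Module.End ℂ (Coeff n)) f i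
        = ((∑ a, i.1 a : ℕ) : ℂ) * f i := by
      intro f
      simp only [LinearMap.sum_apply, Module.End.mul_apply, Finset.sum_apply,
        opAdag_mul_opA_apply, ← Finset.sum_mul]
      push_cast
      rfl
    rw [LinearMap.sub_apply, LinearMap.add_apply, LinearMap.smul_apply, LinearMap.smul_apply,
      LinearMap.smul_apply, Module.End.mul_apply, Module.End.mul_apply, hJ, map_zero, smul_zero,
      sub_zero, Pi.add_apply, Pi.smul_apply, Pi.smul_apply, hN, hN, hM, h1, h2] at hcap
    simp only [LinearMap.sum_apply, Module.End.mul_apply, Finset.sum_apply, hFt,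
      Finset.sum_const_zero, smul_eq_mul] at hcap
    have h5 : (2 * ((m + 1 : ℕ) : ℂ) * ((m + 1 : ℕ) + 1)) * φ i = 0 := by
      rw [hcap]; ring
    refine (mul_eq_zero.mp h5).resolve_left ?_
    have : ((m + 1 : ℕ) : ℂ) + 1 ≠ 0 := by exact_mod_cast (m + 1).succ_ne_zero
    have h6 : ((m + 1 : ℕ) : ℂ) ≠ 0 := by exact_mod_cast m.succ_ne_zero
    exact mul_ne_zero (mul_ne_zero two_ne_zero h6) this

lemma eq_zero_of_hasSum_pow {c : ℕ → ℂ}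
    (h : ∀ t : ℂ, ‖t‖ ≤ 1 → HasSum (fun k => t ^ k * c k) 0) (k : ℕ) : c k = 0 := by
  have h1 : HasFPowerSeriesAt (0 : ℂ → ℂ) (FormalMultilinearSeries.ofScalars ℂ c) 0 := by
    rw [hasFPowerSeriesAt_iff]
    filter_upwards [Metric.closedBall_mem_nhds (0 : ℂ) one_pos] with t ht
    have := h t (by simpa using ht)
    simpa [FormalMultilinearSeries.coeff_ofScalars] using this
  have h2 := congrArg (fun p => FormalMultilinearSeries.coeff p k) h1.eq_zero
  simp only [FormalMultilinearSeries.coeff_ofScalars] at h2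
  exact h2

/-- Replacing `ζ` by `conj t • ζ` with `‖t‖ ≤ 1` turns the inner product into a power series in `t`,
so orthogonality holds in each degree separately; rescaling `ζ` then removes the restriction to the
domain. -/
lemma eq_zero_of_inner_expFock {ψ : Fock n} (hψ : ψ ∈ intertwiners n)
    (h : ∀ ζ ∈ domain n, inner ℂ (expFock ζ) ψ = (0 : ℂ)) : ψ = 0 := by
  have h1 : ∀ ζ ∈ domain n, ∀ k, pair (expCoeff ζ k) (ψ : Coeff n) = 0 := by
    intro ζ hζ
    refine eq_zero_of_hasSum_pow fun t ht => ?_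
    have ht' : ‖conj t‖ ≤ 1 := by rwa [RCLike.norm_conj]
    have hd := smul_mem_domain hζ ht'
    have h2 := ((summable_toFock_expCoeff hd).hasSum).mapL (innerSL ℂ ψ)
    simp only [innerSL_apply_apply] at h2
    have h3 : inner ℂ ψ (∑' k, toFock (expCoeff (conj t • ζ) k)) = (0 : ℂ) := by
      exact inner_eq_zero_symm.mp (h _ hd)
    rw [h3] at h2
    have h4 := Complex.hasSum_conj'.mpr h2
    rw [map_zero] at h4
    refine (funext fun k => ?_ : (fun k => t ^ k * pair (expCoeff ζ k) (ψ : Coeff n)) = _) ▸ h4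
    rw [inner_conj_symm, inner_eq_pair, toFock_coe (memlp_of_mem_finSupp (expCoeff_mem_finSupp _ k)),
      expCoeff_smul, pair_smul_left, map_pow, Complex.conj_conj]
  have h5 : ∀ k, ∀ Z : Matrix (Fin n) (Fin n) ℂ, Zᵀ = -Z →
      pair ((raise Z ^ k) (vacuum n)) (ψ : Coeff n) = 0 := by
    intro k Z hZ
    obtain ⟨s, hs, hsZ⟩ := exists_smul_mem_domain hZ
    have := h1 _ hsZ k
    rw [expCoeff_smul, expCoeff, pair_smul_left, pair_smul_left] at this
    have hf : (k.factorial : ℂ) ≠ 0 := by exact_mod_cast k.factorial_ne_zero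
    simpa [hs, hf] using this
  refine lp.ext (funext fun i => ?_)
  rw [lp.coeFn_zero, Pi.zero_apply]
  -- Coefficients with unequal numbers of `A` and `B` quanta are excluded by `J_z`.
  by_cases hi : ∑ a, i.1 a = ∑ a, i.2 a
  · exact eq_zero_of_pair_raise_pow _ _ hψ.2.1 (h5 _) i rfl hi.symm
  · have hz := congrFun hψ.1 i
    rw [opJz_apply] at hz
    have h6 : ((∑ a, i.1 a : ℕ) : ℂ) - ((∑ a, i.2 a : ℕ) : ℂ) ≠ 0 :=
      sub_ne_zero.mpr (by exact_mod_cast hi)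
    exact (mul_eq_zero.mp hz).resolve_left (mul_ne_zero (by norm_num) h6)

lemma ext_inner_expVec {ψ φ : intertwiners n}
    (h : ∀ ζ : domain n, inner ℂ (expVec ζ) ψ = (inner ℂ (expVec ζ) φ : ℂ)) : ψ = φ := by
  rw [← sub_eq_zero]
  refine Subtype.ext (eq_zero_of_inner_expFock (ψ - φ).2 fun ζ hζ => ?_)
  have h1 : inner ℂ (expVec ⟨ζ, hζ⟩) (ψ - φ) = (0 : ℂ) := by
    rw [inner_sub_right, h, sub_self]
  exact h1

lemma span_expVec_dense :
    (Submodule.span ℂ (Set.range (expVec (n := n)))).topologicalClosure = ⊤ := by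
  rw [Submodule.topologicalClosure_eq_top_iff, Submodule.eq_bot_iff]
  intro ψ hψ
  refine ext_inner_expVec fun ζ => ?_
  rw [inner_zero_right]
  exact hψ _ (Submodule.subset_span ⟨ζ, rfl⟩)

/-! ### The action of `SO*(2n)` on the domain -/

/-- The numerator `A ζ + B` of the action. -/
def numer (g : SOStar n) (ζ : Matrix (Fin n) (Fin n) ℂ) : Matrix (Fin n) (Fin n) ℂ :=
  (mat g).toBlocks₁₁ * ζ + (mat g).toBlocks₁₂

lemma mat_mul (g h : SOStar n) : mat (g * h) = mat g * mat h :=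
  Matrix.SpecialLinearGroup.coe_mul g.1 h.1

lemma mat_one : mat (1 : SOStar n) = 1 := Matrix.SpecialLinearGroup.coe_one

lemma mat_injective : Function.Injective (mat : SOStar n → _) := fun _ _ h =>
  Subtype.ext (Subtype.ext h)

/-- The matrix `g` maps the column `(ζ, 1)` to `(numer, denom)`; the identity is invariance of the
Hermitian form on two such columns. -/
lemma numer_conj_mul_numer (g : SOStar n) (ω ζ : Matrix (Fin n) (Fin n) ℂ) :
    (denom g ω)ᴴ * denom g ζ - (numer g ω)ᴴ * numer g ζ = 1 - ωᴴ * ζ := by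
  have h := g.2.1
  change (mat g)ᴴ * hermForm n * mat g = hermForm n at h
  rw [denom, denom, numer, numer]
  rw [← Matrix.fromBlocks_toBlocks (mat g)] at h
  set A := (mat g).toBlocks₁₁
  set B := (mat g).toBlocks₁₂
  set C := (mat g).toBlocks₂₁
  set D := (mat g).toBlocks₂₂
  rw [hermForm, Matrix.fromBlocks_conjTranspose, Matrix.fromBlocks_multiply,
    Matrix.fromBlocks_multiply, Matrix.fromBlocks_inj] at h
  simp only [Matrix.mul_one, Matrix.mul_zero, Matrix.mul_neg, add_zero, zero_add,
    Matrix.neg_mul] at h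
  obtain ⟨h1, h2, h3, h4⟩ := h
  have e1 : Aᴴ * A = 1 + Cᴴ * C := by rw [← h1]; abel
  have e2 : Aᴴ * B = Cᴴ * D := by rw [← sub_eq_zero, ← h2]; abel
  have e3 : Bᴴ * A = Dᴴ * C := by rw [← sub_eq_zero, ← h3]; abel
  have e4 : Bᴴ * B = Dᴴ * D - 1 := by rw [sub_eq_add_neg, ← h4]; abel
  rw [Matrix.conjTranspose_add, Matrix.conjTranspose_add, Matrix.conjTranspose_mul,
    Matrix.conjTranspose_mul]
  calc (ωᴴ * Cᴴ + Dᴴ) * (C * ζ + D) - (ωᴴ * Aᴴ + Bᴴ) * (A * ζ + B)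
      = ωᴴ * (Cᴴ * C) * ζ + ωᴴ * (Cᴴ * D) + (Dᴴ * C) * ζ + Dᴴ * D
        - (ωᴴ * (Aᴴ * A) * ζ + ωᴴ * (Aᴴ * B) + (Bᴴ * A) * ζ + Bᴴ * B) := by noncomm_ring
    _ = 1 - ωᴴ * ζ := by rw [e1, e2, e3, e4]; noncomm_ring

/-- Antisymmetry of `ζ` means that the columns of `(ζ, 1)` are isotropic for the symmetric form,
which `g` preserves. -/
lemma numer_transpose_mul_denom (g : SOStar n) {ζ : Matrix (Fin n) (Fin n) ℂ} (hζ : ζᵀ = -ζ) :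
    (numer g ζ)ᵀ * denom g ζ = -((denom g ζ)ᵀ * numer g ζ) := by
  have h := g.2.2
  change (mat g)ᵀ * symmForm n * mat g = symmForm n at h
  rw [denom, numer]
  rw [← Matrix.fromBlocks_toBlocks (mat g)] at h
  set A := (mat g).toBlocks₁₁
  set B := (mat g).toBlocks₁₂
  set C := (mat g).toBlocks₂₁
  set D := (mat g).toBlocks₂₂
  rw [symmForm, Matrix.fromBlocks_transpose, Matrix.fromBlocks_multiply,
    Matrix.fromBlocks_multiply, Matrix.fromBlocks_inj] at h
  simp only [Matrix.mul_one, Matrix.mul_zero, add_zero, zero_add] at h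
  obtain ⟨h1, h2, h3, h4⟩ := h
  have e1 : Aᵀ * C = -(Cᵀ * A) := by rw [← sub_eq_zero, ← h1]; abel
  have e2 : Aᵀ * D = 1 - Cᵀ * B := by rw [← h2]; abel
  have e3 : Bᵀ * C = 1 - Dᵀ * A := by rw [← h3]; abel
  have e4 : Bᵀ * D = -(Dᵀ * B) := by rw [← sub_eq_zero, ← h4]; abel
  rw [Matrix.transpose_add, Matrix.transpose_add, Matrix.transpose_mul, Matrix.transpose_mul, hζ]
  calc (-ζ * Aᵀ + Bᵀ) * (C * ζ + D)
      = -ζ * (Aᵀ * C) * ζ + -ζ * (Aᵀ * D) + (Bᵀ * C) * ζ + Bᵀ * D := by noncomm_ring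
    _ = -((-ζ * Cᵀ + Dᵀ) * (A * ζ + B)) := by rw [e1, e2, e3, e4]; noncomm_ring

/-- `denom* denom` is the positive definite `1 - ζ*ζ` plus the positive semidefinite `numer* numer`.
-/
lemma isUnit_denom (g : SOStar n) {ζ : Matrix (Fin n) (Fin n) ℂ} (hζ : ζ ∈ domain n) :
    IsUnit (denom g ζ) := by
  have h1 : (denom g ζ)ᴴ * denom g ζ = (1 - ζᴴ * ζ) + (numer g ζ)ᴴ * numer g ζ := by
    rw [← numer_conj_mul_numer g ζ ζ]; abel
  have h2 : ((denom g ζ)ᴴ * denom g ζ).PosDef := by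
    rw [h1]
    exact hζ.2.add_posSemidef (Matrix.posSemidef_conjTranspose_mul_self _)
  have h3 := (Matrix.isUnit_iff_isUnit_det _).mp h2.isUnit
  rw [Matrix.det_mul] at h3
  exact (Matrix.isUnit_iff_isUnit_det _).mpr (isUnit_of_mul_isUnit_right h3)

lemma isUnit_det_denom (g : SOStar n) {ζ : Matrix (Fin n) (Fin n) ℂ} (hζ : ζ ∈ domain n) :
    IsUnit (denom g ζ).det := (Matrix.isUnit_iff_isUnit_det _).mp (isUnit_denom g hζ)

lemma act_mul_denom (g : SOStar n) {ζ : Matrix (Fin n) (Fin n) ℂ} (hζ : ζ ∈ domain n) :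
    act g ζ * denom g ζ = numer g ζ :=
  Matrix.nonsing_inv_mul_cancel_right _ _ (isUnit_det_denom g hζ)

lemma one_sub_act (g : SOStar n) {ω ζ : Matrix (Fin n) (Fin n) ℂ} (hω : ω ∈ domain n)
    (hζ : ζ ∈ domain n) :
    1 - ωᴴ * ζ = (denom g ω)ᴴ * (1 - (act g ω)ᴴ * act g ζ) * denom g ζ := by
  rw [← numer_conj_mul_numer g ω ζ, ← act_mul_denom g hω, ← act_mul_denom g hζ,
    Matrix.conjTranspose_mul]
  noncomm_ring

lemma act_mem_domain (g : SOStar n) {ζ : Matrix (Fin n) (Fin n) ℂ} (hζ : ζ ∈ domain n) :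
    act g ζ ∈ domain n := by
  have hu := isUnit_det_denom g hζ
  have hu' : IsUnit ((denom g ζ)ᵀ).det := by rwa [Matrix.det_transpose]
  have hu'' : IsUnit ((denom g ζ)ᴴ).det := by rw [Matrix.det_conjTranspose]; exact hu.star
  constructor
  · have h1 := numer_transpose_mul_denom g hζ.1
    rw [← act_mul_denom g hζ, Matrix.transpose_mul, ← Matrix.mul_assoc, ← Matrix.neg_mul] at h1
    have h2 := congrArg (fun M => M * (denom g ζ)⁻¹) h1
    simp only [Matrix.mul_nonsing_inv_cancel_right _ _ hu] at h2
    have h3 := congrArg (fun M => ((denom g ζ)ᵀ)⁻¹ * M) h2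
    simpa only [← Matrix.mul_neg, Matrix.nonsing_inv_mul_cancel_left _ _ hu'] using h3
  · have h1 : 1 - (act g ζ)ᴴ * act g ζ
        = ((denom g ζ)⁻¹)ᴴ * (1 - ζᴴ * ζ) * (denom g ζ)⁻¹ := by
      rw [one_sub_act g hζ hζ, Matrix.conjTranspose_nonsing_inv, Matrix.mul_assoc ((denom g ζ)ᴴ),
        Matrix.nonsing_inv_mul_cancel_left _ _ hu'', Matrix.mul_nonsing_inv_cancel_right _ _ hu]
    rw [h1]
    exact hζ.2.conjTranspose_mul_mul_same (Matrix.mulVec_injective_iff_isUnit.mpr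
      ((Matrix.isUnit_nonsing_inv_iff).mpr (isUnit_denom g hζ)))

lemma numer_denom_mul (g h : SOStar n) {ζ : Matrix (Fin n) (Fin n) ℂ} (hζ : ζ ∈ domain n) :
    numer (g * h) ζ = numer g (act h ζ) * denom h ζ ∧
      denom (g * h) ζ = denom g (act h ζ) * denom h ζ := by
  have h1 := mat_mul g h
  rw [← Matrix.fromBlocks_toBlocks (mat g), ← Matrix.fromBlocks_toBlocks (mat h),
    Matrix.fromBlocks_multiply] at h1
  constructor
  · rw [numer, numer, Matrix.add_mul, Matrix.mul_assoc, act_mul_denom h hζ, h1,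
      Matrix.toBlocks_fromBlocks₁₁, Matrix.toBlocks_fromBlocks₁₂, numer, denom]
    noncomm_ring
  · rw [denom, denom, Matrix.add_mul, Matrix.mul_assoc, act_mul_denom h hζ, h1,
      Matrix.toBlocks_fromBlocks₂₁, Matrix.toBlocks_fromBlocks₂₂, numer, denom]
    noncomm_ring

lemma act_mul (g h : SOStar n) {ζ : Matrix (Fin n) (Fin n) ℂ} (hζ : ζ ∈ domain n) :
    act (g * h) ζ = act g (act h ζ) := by
  have h1 := numer_denom_mul g h hζ
  change numer (g * h) ζ * _ = numer g (act h ζ) * _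
  rw [h1.1, h1.2, Matrix.mul_inv_rev, Matrix.mul_assoc, ← Matrix.mul_assoc (denom h ζ),
    Matrix.mul_nonsing_inv _ (isUnit_det_denom h hζ), Matrix.one_mul]

lemma denom_one (ζ : Matrix (Fin n) (Fin n) ℂ) : denom (1 : SOStar n) ζ = 1 := by
  rw [denom, mat_one, ← Matrix.fromBlocks_one, Matrix.toBlocks_fromBlocks₂₁,
    Matrix.toBlocks_fromBlocks₂₂, Matrix.zero_mul, zero_add]

lemma act_one (ζ : Matrix (Fin n) (Fin n) ℂ) : act (1 : SOStar n) ζ = ζ := by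
  rw [act, denom_one, mat_one, ← Matrix.fromBlocks_one, Matrix.toBlocks_fromBlocks₁₁,
    Matrix.toBlocks_fromBlocks₁₂]
  simp

/-- The action of `SO*(2n)` on points of the domain. -/
def actPt (g : SOStar n) (ζ : domain n) : domain n := ⟨act g ζ.1, act_mem_domain g ζ.2⟩

lemma actPt_mul (g h : SOStar n) (ζ : domain n) : actPt (g * h) ζ = actPt g (actPt h ζ) :=
  Subtype.ext (act_mul g h ζ.2)

lemma actPt_one (ζ : domain n) : actPt (1 : SOStar n) ζ = ζ := Subtype.ext (act_one ζ.1)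

/-! ### The unitary representation -/

/-- The image of an exponential vector under a group element. -/
def transVec (g : SOStar n) (ζ : domain n) : intertwiners n :=
  (denom g ζ.1).det⁻¹ • expVec (actPt g ζ)

lemma inner_smul_smul_intertwiners (c d : ℂ) (ψ φ : intertwiners n) :
    inner ℂ (c • ψ) (d • φ) = conj c * d * inner ℂ ψ φ := by
  change inner ℂ (c • (ψ : Fock n)) (d • (φ : Fock n)) = conj c * d * inner ℂ (ψ : Fock n) φ
  rw [inner_smul_left, inner_smul_right, mul_assoc]

lemma inner_expVec (ω ζ : domain n) :
    inner ℂ (expVec ω) (expVec ζ) = ((1 - ω.1ᴴ * ζ.1).det)⁻¹ := inner_expFock ω.2 ζ.2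

/-- The determinants of the two denominators are exactly the factors by which the kernel `det(1 -
ω*ζ)⁻¹` changes under `g`. -/
lemma inner_transVec (g : SOStar n) (ω ζ : domain n) :
    inner ℂ (transVec g ω) (transVec g ζ) = (inner ℂ (expVec ω) (expVec ζ) : ℂ) := by
  have h1 := (isUnit_det_denom g ω.2).ne_zero
  have h2 := (isUnit_det_denom g ζ.2).ne_zero
  have h3 : star (denom g ω.1).det ≠ 0 := star_ne_zero.mpr h1
  rw [transVec, transVec, inner_smul_smul_intertwiners, inner_expVec, inner_expVec,
    one_sub_act g ω.2 ζ.2, Matrix.det_mul, Matrix.det_mul, Matrix.det_conjTranspose, map_inv₀,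
    starRingEnd_apply, mul_inv, mul_inv, actPt, actPt]
  ring

lemma norm_linearCombination_eq {ι E : Type*} [NormedAddCommGroup E] [InnerProductSpace ℂ E]
    {v w : ι → E} (h : ∀ i j, inner ℂ (w i) (w j) = (inner ℂ (v i) (v j) : ℂ)) (x : ι →₀ ℂ) :
    ‖Finsupp.linearCombination ℂ w x‖ = ‖Finsupp.linearCombination ℂ v x‖ := by
  have key : inner ℂ (Finsupp.linearCombination ℂ w x) (Finsupp.linearCombination ℂ w x)
      = (inner ℂ (Finsupp.linearCombination ℂ v x) (Finsupp.linearCombination ℂ v x) : ℂ) := by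
    simp only [Finsupp.linearCombination_apply, Finsupp.sum, sum_inner, inner_sum,
      inner_smul_left, inner_smul_right, h]
  rw [norm_eq_sqrt_re_inner (𝕜 := ℂ), norm_eq_sqrt_re_inner (𝕜 := ℂ), key]

lemma denseRange_linearCombination {ι E : Type*} [NormedAddCommGroup E] [InnerProductSpace ℂ E]
    {v : ι → E} (h : (Submodule.span ℂ (Set.range v)).topologicalClosure = ⊤) :
    DenseRange (Finsupp.linearCombination ℂ v) := by
  rw [← Finsupp.range_linearCombination, ← Submodule.dense_iff_topologicalClosure_eq_top] at h
  exact h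

/-- Every exponential vector is a nonzero multiple of the translate by `g` of the one at `g⁻¹(ζ)`.
-/
lemma span_transVec_dense (g : SOStar n) :
    (Submodule.span ℂ (Set.range (transVec g))).topologicalClosure = ⊤ := by
  rw [Submodule.topologicalClosure_eq_top_iff, Submodule.eq_bot_iff]
  intro ψ hψ
  refine ext_inner_expVec fun ζ => ?_
  rw [inner_zero_right]
  have h1 := hψ _ (Submodule.subset_span ⟨actPt g⁻¹ ζ, rfl⟩)
  have h2 := (isUnit_det_denom g (actPt g⁻¹ ζ).2).ne_zero
  rw [transVec, ← actPt_mul, mul_inv_cancel, actPt_one,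
    ← one_smul ℂ ψ, inner_smul_smul_intertwiners, mul_one] at h1
  exact (mul_eq_zero.mp h1).resolve_left (by simpa using h2)

/-- The unitary operator of a group element. -/
def repOp (g : SOStar n) : intertwiners n ≃ₗᵢ[ℂ] intertwiners n :=
  (LinearEquiv.refl ℂ (domain n →₀ ℂ)).extendOfIsometry
    (Finsupp.linearCombination ℂ expVec) (Finsupp.linearCombination ℂ (transVec g))
    (denseRange_linearCombination span_expVec_dense)
    (denseRange_linearCombination (span_transVec_dense g))
    (norm_linearCombination_eq (inner_transVec g))

lemma repOp_expVec (g : SOStar n) (ζ : domain n) : repOp g (expVec ζ) = transVec g ζ := by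
  have h := LinearEquiv.extendOfIsometry_eq (LinearEquiv.refl ℂ (domain n →₀ ℂ))
    (Finsupp.linearCombination ℂ expVec) (Finsupp.linearCombination ℂ (transVec g))
    (denseRange_linearCombination span_expVec_dense)
    (denseRange_linearCombination (span_transVec_dense g))
    (norm_linearCombination_eq (inner_transVec g)) (Finsupp.single ζ 1)
  rw [LinearEquiv.refl_apply, Finsupp.linearCombination_single, Finsupp.linearCombination_single,
    one_smul, one_smul] at h
  exact h

lemma ext_expVec {U V : intertwiners n ≃ₗᵢ[ℂ] intertwiners n}
    (h : ∀ ζ, U (expVec ζ) = V (expVec ζ)) : U = V := by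
  have hd : Dense (Submodule.span ℂ (Set.range (expVec (n := n))) : Set (intertwiners n)) :=
    Submodule.dense_iff_topologicalClosure_eq_top.mpr span_expVec_dense
  have h1 := ContinuousLinearMap.ext_on hd 
    (f := (U.toContinuousLinearEquiv : intertwiners n →L[ℂ] intertwiners n))
    (g := (V.toContinuousLinearEquiv : intertwiners n →L[ℂ] intertwiners n)) (by rintro _ ⟨ζ, rfl⟩; exact h ζ)
  exact LinearIsometryEquiv.ext fun x => congrArg (fun T => T x) h1

/-- The unitary representation of `SO*(2n)` on the intertwiners. -/
def rep (n : ℕ) : SOStar n →* (intertwiners n ≃ₗᵢ[ℂ] intertwiners n) where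
  toFun := repOp
  map_one' := ext_expVec fun ζ => by
    rw [repOp_expVec, transVec, denom_one, actPt_one]
    simp
  map_mul' g h := ext_expVec fun ζ => by
    rw [LinearIsometryEquiv.coe_mul, Function.comp_apply, repOp_expVec, repOp_expVec, transVec, transVec, map_smul,
      repOp_expVec, transVec, actPt_mul, (numer_denom_mul g h ζ.2).2, Matrix.det_mul, smul_smul,
      mul_inv, mul_comm]
    rfl

lemma rep_expVec (g : SOStar n) (ζ : domain n) : rep n g (expVec ζ) = transVec g ζ :=
  repOp_expVec g ζ

/-! ### The Lie algebra operators -/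

lemma opBdag_mul_opJplus (a : Fin n) :
    opBdag a * opJplus n = opJplus n * opBdag a - opAdag a := by
  have h : ∀ c : Fin n, opAdag c * opB c * opBdag a
      = opBdag a * (opAdag c * opB c) + if c = a then opAdag c else 0 := by
    intro c
    rw [mul_assoc, opB_mul_opBdag, mul_add, ← mul_assoc, (commute_opAdag_opBdag c a).eq, mul_assoc]
    split_ifs <;> simp
  simp [opJplus, Finset.mul_sum, Finset.sum_mul, h, Finset.sum_add_distrib]

lemma commute_opAdag_opJplus (a : Fin n) : Commute (opAdag a) (opJplus n) :=
  Commute.sum_right _ _ _ fun c _ => (commute_opAdag_opAdag a c).mul_right (commute_opAdag_opB a c)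

lemma opB_mul_opJminus (a : Fin n) : opB a * opJminus n = opJminus n * opB a + opA a := by
  have h : ∀ c : Fin n, opB a * (opBdag c * opA c)
      = opBdag c * opA c * opB a + if a = c then opA c else 0 := by
    intro c
    rw [← mul_assoc, opB_mul_opBdag, add_mul, mul_assoc, ← (commute_opA_opB c a).eq, mul_assoc]
    split_ifs <;> simp
  simp [opJminus, Finset.mul_sum, Finset.sum_mul, h, Finset.sum_add_distrib]

lemma commute_opA_opJminus (a : Fin n) : Commute (opA a) (opJminus n) :=
  Commute.sum_right _ _ _ fun c _ => (commute_opA_opBdag a c).mul_right (commute_opA_opA a c)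

lemma opAdag_mul_opJminus (a : Fin n) :
    opAdag a * opJminus n = opJminus n * opAdag a - opBdag a := by
  have h : ∀ c : Fin n, opBdag c * opA c * opAdag a
      = opAdag a * (opBdag c * opA c) + if c = a then opBdag c else 0 := by
    intro c
    rw [mul_assoc, opA_mul_opAdag, mul_add, ← mul_assoc, ← (commute_opAdag_opBdag a c).eq, mul_assoc]
    split_ifs <;> simp
  simp [opJminus, Finset.mul_sum, Finset.sum_mul, h, Finset.sum_add_distrib]

lemma commute_opBdag_opJminus (a : Fin n) : Commute (opBdag a) (opJminus n) :=
  Commute.sum_right _ _ _ fun c _ =>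
    (commute_opBdag_opBdag a c).mul_right (commute_opA_opBdag c a).symm

lemma commute_opF_opJminus (a b : Fin n) : Commute (opF a b) (opJminus n) := by
  rw [commute_iff_eq, opF, sub_mul, mul_sub, mul_assoc, (commute_opA_opJminus b).eq, ← mul_assoc,
    opB_mul_opJminus, add_mul, mul_assoc, mul_assoc (opA a), opB_mul_opJminus, mul_add,
    ← mul_assoc (opA a), (commute_opA_opJminus a).eq, mul_assoc]
  abel

lemma commute_opE_opJplus (a b : Fin n) : Commute (opE a b) (opJplus n) := by
  refine Commute.add_left ?_ (by split_ifs <;> simp)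
  rw [commute_iff_eq, add_mul, mul_add, mul_assoc, opA_mul_opJplus, mul_add, ← mul_assoc,
    (commute_opAdag_opJplus a).eq, mul_assoc (opBdag a), opB_mul_opJplus, ← mul_assoc (opBdag a),
    opBdag_mul_opJplus, sub_mul, mul_assoc, mul_assoc]
  abel

lemma commute_opE_opJminus (a b : Fin n) : Commute (opE a b) (opJminus n) := by
  refine Commute.add_left ?_ (by split_ifs <;> simp)
  rw [commute_iff_eq, add_mul, mul_add, mul_assoc, (commute_opA_opJminus b).eq, ← mul_assoc,
    opAdag_mul_opJminus, sub_mul, mul_assoc (opBdag a), opB_mul_opJminus, mul_add,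
    ← mul_assoc (opBdag a), (commute_opBdag_opJminus a).eq, mul_assoc, mul_assoc]
  abel

lemma commute_lieOp {J : Module.End ℂ (Coeff n)} (hE : ∀ a b, Commute (opE a b) J)
    (hF : ∀ a b, Commute (opF a b) J)
    (hr : ∀ Z : Matrix (Fin n) (Fin n) ℂ, Zᵀ = -Z → Commute J (raise Z))
    (X Y : Matrix (Fin n) (Fin n) ℂ) : Commute J (lieOp X Y) := by
  have h1 : Commute J (opESum X) := Commute.sum_right _ _ _ fun a _ =>
    Commute.sum_right _ _ _ fun b _ => (hE a b).symm.smul_right _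
  have h2 : Commute J (opFSum Y) := Commute.sum_right _ _ _ fun a _ =>
    Commute.sum_right _ _ _ fun b _ => (hF a b).symm.smul_right _
  have h3 : Commute J (opFtSum Y) := by
    rw [opFtSum_eq]
    exact hr _ (by rw [Matrix.transpose_sub, Matrix.transpose_transpose, neg_sub])
  exact (h1.add_right (h3.smul_right _)).sub_right (h2.smul_right _)

/-- Reduces invariance under `J_z` to invariance under `J_±`. -/
lemma opJz_eq_commutator : opJz n = (1 / 2 : ℂ) • (opJplus n * opJminus n - opJminus n * opJplus n) := by
  have h : ∀ a : Fin n, opBdag a * opA a * opJplus n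
      = opJplus n * (opBdag a * opA a) + opBdag a * opB a - opAdag a * opA a := by
    intro a
    rw [mul_assoc, opA_mul_opJplus, mul_add, ← mul_assoc, opBdag_mul_opJplus, sub_mul, mul_assoc]
    abel
  have h1 : opJminus n * opJplus n
      = opJplus n * opJminus n + ∑ a, opBdag a * opB a - ∑ a : Fin n, opAdag a * opA a := by
    conv_lhs => rw [opJminus, Finset.sum_mul]
    simp only [h, Finset.sum_add_distrib, Finset.sum_sub_distrib, ← Finset.mul_sum]
    rfl
  rw [h1, opJz, Finset.sum_sub_distrib]
  congr 1
  abel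

lemma lieOp_invariant (X Y : Matrix (Fin n) (Fin n) ℂ) {f : Coeff n}
    (h : opJz n f = 0 ∧ opJplus n f = 0 ∧ opJminus n f = 0) :
    opJz n (lieOp X Y f) = 0 ∧ opJplus n (lieOp X Y f) = 0 ∧ opJminus n (lieOp X Y f) = 0 := by
  have h1 : opJplus n (lieOp X Y f) = 0 := by
    rw [← Module.End.mul_apply, (commute_lieOp commute_opE_opJplus commute_opF_opJplus
      (fun _ => commute_opJplus_raise) X Y).eq, Module.End.mul_apply, h.2.1, map_zero]
  have h2 : opJminus n (lieOp X Y f) = 0 := by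
    rw [← Module.End.mul_apply, (commute_lieOp commute_opE_opJminus commute_opF_opJminus
      (fun _ => commute_opJminus_raise) X Y).eq, Module.End.mul_apply, h.2.2, map_zero]
  refine ⟨?_, h1, h2⟩
  rw [opJz_eq_commutator]
  simp [h1, h2]

lemma neg_smul_end (c : ℂ) (T : Module.End ℂ (Coeff n)) : (-c) • T = -(c • T) :=
  LinearMap.ext fun f => by
    rw [LinearMap.smul_apply, LinearMap.neg_apply, LinearMap.smul_apply, neg_smul]

/-- `S` is the formal adjoint of `T` on finitely supported families. -/
structure FormalAdjoint (T S : Module.End ℂ (Coeff n)) : Prop where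
  mem : ∀ f ∈ finSupp n, S f ∈ finSupp n
  adj : ∀ f ∈ finSupp n, ∀ h, pair f (T h) = pair (S f) h

namespace FormalAdjoint

variable {T T' S S' : Module.End ℂ (Coeff n)}

lemma add (h : FormalAdjoint T S) (h' : FormalAdjoint T' S') :
    FormalAdjoint (T + T') (S + S') where
  mem f hf := Submodule.add_mem _ (h.mem f hf) (h'.mem f hf)
  adj f hf g := by
    have h1 := (pairLeft g).map_add ⟨S f, h.mem f hf⟩ ⟨S' f, h'.mem f hf⟩
    change pair (S f + S' f) g = pair (S f) g + pair (S' f) g at h1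
    rw [LinearMap.add_apply, pair_add_right hf, h.adj f hf, h'.adj f hf, LinearMap.add_apply, h1]

lemma smul (h : FormalAdjoint T S) (c : ℂ) : FormalAdjoint (c • T) (conj c • S) where
  mem f hf := Submodule.smul_mem _ _ (h.mem f hf)
  adj f hf g := by
    rw [LinearMap.smul_apply, LinearMap.smul_apply, pair_smul_right, pair_smul_left, h.adj f hf,
      Complex.conj_conj]

lemma neg (h : FormalAdjoint T S) : FormalAdjoint (-T) (-S) := by
  have h1 := h.smul (-1)
  rwa [map_neg, map_one, neg_smul_end, neg_smul_end, one_smul, one_smul] at h1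

lemma sub (h : FormalAdjoint T S) (h' : FormalAdjoint T' S') :
    FormalAdjoint (T - T') (S - S') := by
  rw [sub_eq_add_neg, sub_eq_add_neg]
  exact h.add h'.neg

lemma zero : FormalAdjoint (0 : Module.End ℂ (Coeff n)) 0 where
  mem _ _ := Submodule.zero_mem _
  adj f _ g := by simp [pair]

lemma one : FormalAdjoint (1 : Module.End ℂ (Coeff n)) 1 where
  mem _ hf := hf
  adj _ _ _ := rfl

lemma mul (h : FormalAdjoint T S) (h' : FormalAdjoint T' S') :
    FormalAdjoint (T * T') (S' * S) where
  mem f hf := h'.mem _ (h.mem f hf)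
  adj f hf g := by
    rw [Module.End.mul_apply, h.adj f hf, h'.adj _ (h.mem f hf), Module.End.mul_apply]

lemma sum {ι : Type*} (s : Finset ι) {T S : ι → Module.End ℂ (Coeff n)}
    (h : ∀ j, FormalAdjoint (T j) (S j)) : FormalAdjoint (∑ j ∈ s, T j) (∑ j ∈ s, S j) := by
  classical
  induction s using Finset.induction_on with
  | empty => simpa using zero
  | insert j s hj ih => rw [Finset.sum_insert hj, Finset.sum_insert hj]; exact (h j).add ih

lemma opA (a : Fin n) : FormalAdjoint (SOStarCoherent.opA a) (opAdag a) :=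
  ⟨fun _ => opAdag_mem_finSupp a, fun _ _ _ => (pair_opAdag_left a _ _).symm⟩

lemma opAdag (a : Fin n) : FormalAdjoint (SOStarCoherent.opAdag a) (SOStarCoherent.opA a) :=
  ⟨fun _ => opA_mem_finSupp a, fun _ _ _ => pair_opAdag_right a _ _⟩

lemma opB (a : Fin n) : FormalAdjoint (SOStarCoherent.opB a) (opBdag a) :=
  ⟨fun _ => opBdag_mem_finSupp a, fun _ _ _ => (pair_opBdag_left a _ _).symm⟩

lemma opBdag (a : Fin n) : FormalAdjoint (SOStarCoherent.opBdag a) (SOStarCoherent.opB a) :=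
  ⟨fun _ => opB_mem_finSupp a, fun _ _ _ => pair_opBdag_right a _ _⟩

lemma opE (a b : Fin n) : FormalAdjoint (SOStarCoherent.opE a b) (SOStarCoherent.opE b a) := by
  refine (((opAdag a).mul (opA b)).add ((opBdag a).mul (opB b))).add ?_
  by_cases h : a = b
  · simpa [h] using one
  · simpa [h, Ne.symm h] using zero

lemma opF (a b : Fin n) : FormalAdjoint (SOStarCoherent.opF a b) (SOStarCoherent.opFt a b) := by
  have h := ((opB a).mul (opA b)).sub ((opA a).mul (opB b))
  rwa [(commute_opAdag_opBdag b a).eq, ← (commute_opAdag_opBdag a b).eq] at h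

lemma opFt (a b : Fin n) : FormalAdjoint (SOStarCoherent.opFt a b) (SOStarCoherent.opF a b) := by
  have h := ((opBdag a).mul (opAdag b)).sub ((opAdag a).mul (opBdag b))
  rwa [(commute_opA_opB b a).eq, ← (commute_opA_opB a b).eq] at h

end FormalAdjoint

/-- `E_ab` and `E_ba` are mutually adjoint and `X` is anti-Hermitian, while `½ F̃_Y` and `½ F_Y` are
mutually adjoint and enter with opposite signs. -/
lemma formalAdjoint_lieOp {X : Matrix (Fin n) (Fin n) ℂ} (hX : Xᴴ = -X)
    (Y : Matrix (Fin n) (Fin n) ℂ) : FormalAdjoint (lieOp X Y) (-lieOp X Y) := by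
  have h1 : FormalAdjoint (opESum X) (-opESum X) := by
    have h := FormalAdjoint.sum Finset.univ fun a : Fin n => FormalAdjoint.sum Finset.univ
      fun b : Fin n => (FormalAdjoint.opE a b).smul (X a b)
    have e : ∀ a b, conj (X a b) • opE b a = -(X b a • opE b a) :=
      fun a b => by rw [← neg_smul_end]; exact congrArg (· • _) (congrFun (congrFun hX b) a)
    simp only [e, Finset.sum_neg_distrib] at h
    rw [Finset.sum_comm (f := fun a b => X b a • opE b a)] at h
    exact h
  have h2 : FormalAdjoint (opFtSum Y) (opFSum Y) :=
    FormalAdjoint.sum Finset.univ fun a : Fin n => FormalAdjoint.sum Finset.univ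
      fun b : Fin n => (FormalAdjoint.opFt a b).smul (Y a b)
  have h3 : FormalAdjoint (opFSum Y) (opFtSum Y) := by
    have h := FormalAdjoint.sum Finset.univ fun a : Fin n => FormalAdjoint.sum Finset.univ
      fun b : Fin n => (FormalAdjoint.opF a b).smul (conj (Y a b))
    simp only [Complex.conj_conj] at h
    exact h
  have h := (h1.add (h2.smul (1 / 2))).sub (h3.smul (1 / 2))
  have e : conj (1 / 2 : ℂ) = 1 / 2 := by
    rw [map_div₀, map_one, Complex.conj_ofNat]
  have e2 : -opESum X + (1 / 2 : ℂ) • opFSum Y - (1 / 2 : ℂ) • opFtSum Y = -lieOp X Y := by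
    rw [lieOp]
    abel
  rwa [e, e2] at h

/-- The infinitesimal action on the domain. -/
def infAct (X Y ζ : Matrix (Fin n) (Fin n) ℂ) : Matrix (Fin n) (Fin n) ℂ :=
  X * ζ + Y - ζ * (X.map conj - Y.map conj * ζ)

/-- The result is the derivative of `det(Cζ+D)⁻¹ e_{g(ζ)}` at the identity: `infAct` comes from the
motion of `ζ`, the trace from the determinant. -/
lemma lieOp_expFam {X Y : Matrix (Fin n) (Fin n) ℂ} (hX : Xᴴ = -X) (hY : Yᵀ = -Y)
    (ζ : Matrix (Fin n) (Fin n) ℂ) : lieOp X Y (expFam ζ)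
      = raise (infAct X Y ζ) (expFam ζ) - (X.map conj - Y.map conj * ζ).trace • expFam ζ := by
  have e1 : Xᵀ = -X.map conj := by
    ext a b
    have := congrFun (congrFun hX a) b
    simp only [Matrix.conjTranspose_apply, Matrix.neg_apply] at this
    simp only [Matrix.transpose_apply, Matrix.neg_apply, Matrix.map_apply]
    rw [← map_neg, ← this]
    simp
  have e2 : (Y.map conj)ᵀ = -Y.map conj := by
    rw [← Matrix.transpose_map, hY]
    ext a b
    simp
  have e3 : Y - Yᵀ = (2 : ℂ) • Y := by rw [hY, two_smul]; abel
  have e4 : X.trace = -(X.map conj).trace := by rw [← Matrix.trace_neg, ← e1, Matrix.trace_transpose]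
  have e5 : ζ * (-Y.map conj) * ζ - ζ * Y.map conj * ζ = (-2 : ℂ) • (ζ * Y.map conj * ζ) := by
    rw [neg_smul, two_smul, Matrix.mul_neg, Matrix.neg_mul]; abel
  have e6 : (-Y.map conj * ζ).trace - (Y.map conj * ζ).trace = (-2 : ℂ) * (Y.map conj * ζ).trace := by
    rw [Matrix.neg_mul, Matrix.trace_neg]; ring
  have e7 : infAct X Y ζ = (ζ * (-X.map conj) + X * ζ) + Y + ζ * Y.map conj * ζ := by
    rw [infAct]; noncomm_ring
  rw [lieOp, LinearMap.sub_apply, LinearMap.add_apply, LinearMap.smul_apply, LinearMap.smul_apply,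
    opESum_expFam, opFSum_expFam, opFtSum_eq, e2, e3, e5, e6, e1, e4, e7, raise_smul, raise_smul,
    raise_add _ (ζ * Y.map conj * ζ), raise_add _ Y, Matrix.trace_sub]
  simp only [LinearMap.add_apply, LinearMap.smul_apply]
  module

/-! ### Strong continuity -/

lemma continuous_mat : Continuous (mat : SOStar n → _) :=
  continuous_subtype_val.comp continuous_subtype_val

/-- In this form the inner product is an explicit function of the entries of both group elements,
from which continuity can be read off. -/
lemma inner_transVec_transVec (g h : SOStar n) (ω ζ : domain n) :
    inner ℂ (transVec g ω) (transVec h ζ)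
      = (((denom g ω.1)ᴴ * denom h ζ.1 - (numer g ω.1)ᴴ * numer h ζ.1).det)⁻¹ := by
  have e : (denom g ω.1)ᴴ * denom h ζ.1 - (numer g ω.1)ᴴ * numer h ζ.1
      = (denom g ω.1)ᴴ * (1 - (act g ω.1)ᴴ * act h ζ.1) * denom h ζ.1 := by
    rw [← act_mul_denom g ω.2, ← act_mul_denom h ζ.2, Matrix.conjTranspose_mul]
    noncomm_ring
  rw [transVec, transVec, inner_smul_smul_intertwiners, inner_expVec, e, Matrix.det_mul,
    Matrix.det_mul, Matrix.det_conjTranspose, map_inv₀, starRingEnd_apply, mul_inv, mul_inv,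
    actPt, actPt]
  ring

lemma continuous_toBlocks : Continuous (fun g : SOStar n => (mat g).toBlocks₁₁) ∧
    Continuous (fun g : SOStar n => (mat g).toBlocks₁₂) ∧
    Continuous (fun g : SOStar n => (mat g).toBlocks₂₁) ∧
    Continuous (fun g : SOStar n => (mat g).toBlocks₂₂) := by
  refine ⟨?_, ?_, ?_, ?_⟩ <;>
    exact continuous_matrix fun i j => continuous_mat.matrix_elem _ _

lemma continuous_numer (ζ : Matrix (Fin n) (Fin n) ℂ) : Continuous fun g : SOStar n => numer g ζ :=
  (continuous_toBlocks.1.matrix_mul continuous_const).add continuous_toBlocks.2.1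

lemma continuous_denom (ζ : Matrix (Fin n) (Fin n) ℂ) : Continuous fun g : SOStar n => denom g ζ :=
  (continuous_toBlocks.2.2.1.matrix_mul continuous_const).add continuous_toBlocks.2.2.2

/-- For vectors of constant norm `r`, `‖v y - v x‖² = 2r² - 2 Re⟨v x, v y⟩`. -/
lemma continuous_of_continuous_inner {α E : Type*} [TopologicalSpace α] [NormedAddCommGroup E]
    [InnerProductSpace ℂ E] {v : α → E} {r : ℝ} (hr : ∀ x, ‖v x‖ = r)
    (h : ∀ x, ContinuousAt (fun y => inner ℂ (v x) (v y)) x) : Continuous v := by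
  rw [continuous_iff_continuousAt]
  intro x
  rw [ContinuousAt, tendsto_iff_norm_sub_tendsto_zero]
  have h1 : ∀ y, ‖v y - v x‖ = Real.sqrt (2 * r ^ 2 - 2 * (inner ℂ (v x) (v y) : ℂ).re) := by
    intro y
    rw [← Real.sqrt_sq (norm_nonneg (v y - v x)), norm_sub_rev, @norm_sub_sq ℂ, hr, hr]
    congr 1
    simp only [RCLike.re_to_complex]
    ring
  simp only [h1]
  have h2 := ((continuous_const.sub (continuous_const.mul Complex.continuous_re)).sqrt (f := fun z : ℂ =>
    2 * r ^ 2 - 2 * z.re)).continuousAt.comp (h x)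
  have h3 : (inner ℂ (v x) (v x) : ℂ).re = r ^ 2 := by
    rw [← RCLike.re_to_complex, inner_self_eq_norm_sq, hr]
  rw [ContinuousAt] at h2
  simpa only [Function.comp_def, h3, sub_self, Real.sqrt_zero] using h2

lemma norm_transVec (g : SOStar n) (ζ : domain n) : ‖transVec g ζ‖ = ‖expVec ζ‖ := by
  rw [norm_eq_sqrt_re_inner (𝕜 := ℂ), norm_eq_sqrt_re_inner (𝕜 := ℂ), inner_transVec]

lemma continuous_transVec (ζ : domain n) : Continuous fun g : SOStar n => transVec g ζ := by
  refine continuous_of_continuous_inner (fun g => norm_transVec g ζ) fun g => ?_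
  simp only [inner_transVec_transVec]
  refine ContinuousAt.inv₀ (Continuous.continuousAt ?_) ?_
  · exact Continuous.matrix_det ((continuous_const.matrix_mul (continuous_denom ζ.1)).sub
      (continuous_const.matrix_mul (continuous_numer ζ.1)))
  · rw [numer_conj_mul_numer]
    exact det_one_sub_ne_zero ζ.2 ζ.2

lemma continuous_rep (ψ : intertwiners n) : Continuous fun g : SOStar n => rep n g ψ := by
  have h1 : ∀ φ ∈ Submodule.span ℂ (Set.range (expVec (n := n))),
      Continuous fun g : SOStar n => rep n g φ := by
    intro φ hφ
    induction hφ using Submodule.span_induction with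
    | mem x hx =>
      obtain ⟨ζ, rfl⟩ := hx
      simpa only [rep_expVec] using continuous_transVec ζ
    | zero => simpa only [map_zero] using continuous_const
    | add x y _ _ hx hy => simp only [map_add]; exact hx.add hy
    | smul c x _ hx => simp only [map_smul]; exact hx.const_smul c
  have hd : Dense (Submodule.span ℂ (Set.range (expVec (n := n))) : Set (intertwiners n)) :=
    Submodule.dense_iff_topologicalClosure_eq_top.mpr span_expVec_dense
  refine continuous_of_uniform_approx_of_continuous fun u hu => ?_
  obtain ⟨ε, hε, hu⟩ := Metric.mem_uniformity_dist.mp hu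
  obtain ⟨φ, hφ, hd⟩ := hd.exists_dist_lt ψ hε
  exact ⟨_, h1 φ hφ, fun g => hu (by rwa [LinearIsometryEquiv.dist_map])⟩

/-! ### Derivatives of coefficients along curves -/

lemma hasDerivAt_raise {Z : ℝ → Matrix (Fin n) (Fin n) ℂ} {Z' : Matrix (Fin n) (Fin n) ℂ} {t : ℝ}
    (hZ : ∀ a b, HasDerivAt (fun s => Z s a b) (Z' a b) t) {f : ℝ → Coeff n} {f' : Coeff n}
    (hf : ∀ i, HasDerivAt (fun s => f s i) (f' i) t) (i : Occ n) :
    HasDerivAt (fun s => raise (Z s) (f s) i) ((raise Z' (f t) + raise (Z t) f') i) t := by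
  simp only [raise_apply, Pi.add_apply, Finset.sum_apply, Pi.smul_apply, smul_eq_mul,
    ← Finset.sum_add_distrib]
  refine HasDerivAt.fun_sum fun c _ => HasDerivAt.fun_sum fun d _ => (hZ c d).fun_mul ?_
  exact ((hf _).const_mul _).const_mul _

lemma hasDerivAt_expCoeff {Z : ℝ → Matrix (Fin n) (Fin n) ℂ} {Z' : Matrix (Fin n) (Fin n) ℂ} {t : ℝ}
    (hZ : ∀ a b, HasDerivAt (fun s => Z s a b) (Z' a b) t) (k : ℕ) (i : Occ n) :
    HasDerivAt (fun s => expCoeff (Z s) (k + 1) i) (raise Z' (expCoeff (Z t) k) i) t := by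
  have hk : ∀ (k : ℕ) (W : Matrix (Fin n) (Fin n) ℂ),
      expCoeff W (k + 1) = ((k : ℂ) + 1)⁻¹ • raise W (expCoeff W k) := fun k W => by
    rw [raise_expCoeff, inv_smul_smul₀ (Nat.cast_add_one_ne_zero k)]
  induction k generalizing i with
  | zero =>
    have h := hasDerivAt_raise hZ (f := fun s => expCoeff (Z s) 0) (f' := 0)
      (fun i => by simp only [expCoeff_zero]; exact hasDerivAt_const t _) i
    simp only [hk 0]
    simpa using h
  | succ k ih =>
    have h := (hasDerivAt_raise hZ ih i).const_mul (((k + 1 : ℕ) : ℂ) + 1)⁻¹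
    -- Raising operators commute, so the product rule collapses to the ordinary rule for powers.
    have e : raise (Z t) (raise Z' (expCoeff (Z t) k)) = ((k : ℂ) + 1) • raise Z' (expCoeff (Z t) (k + 1)) := by
      rw [← Module.End.mul_apply, (commute_raise_raise _ _).eq, Module.End.mul_apply,
        raise_expCoeff, map_smul]
    simp only [hk (k + 1), Pi.smul_apply, smul_eq_mul]
    refine h.congr_deriv ?_
    rw [e, Pi.add_apply, Pi.smul_apply, smul_eq_mul, ← one_add_mul, ← mul_assoc]
    push_cast
    rw [add_comm (1 : ℂ), inv_mul_cancel₀, one_mul]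
    exact_mod_cast Nat.cast_add_one_ne_zero (R := ℂ) (k + 1)

lemma raise_expFam_apply (W ζ : Matrix (Fin n) (Fin n) ℂ) (i : Occ n) :
    raise W (expFam ζ) i = raise W (expCoeff ζ (∑ a, i.1 a - 1)) i := by
  simp only [raise_apply, Finset.sum_apply, Pi.smul_apply, opBdag_opAdag_expFam_apply]

lemma hasDerivAt_expFam {Z : ℝ → Matrix (Fin n) (Fin n) ℂ} {Z' : Matrix (Fin n) (Fin n) ℂ} {t : ℝ}
    (hZ : ∀ a b, HasDerivAt (fun s => Z s a b) (Z' a b) t) (i : Occ n) :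
    HasDerivAt (fun s => expFam (Z s) i) (raise Z' (expFam (Z t)) i) t := by
  rw [raise_expFam_apply]
  simp only [expFam]
  rcases h : ∑ a, i.1 a with _ | k
  · simp only [expCoeff_zero]
    refine (hasDerivAt_const t _).congr_deriv ?_
    by_contra h0
    have h1 := (hasDeg_vacuum (n := n)).raise Z' i
      (by rw [← expCoeff_zero (Z t)]; exact Ne.symm h0)
    omega
  · exact hasDerivAt_expCoeff hZ k i

lemma hasDerivAt_matrix_mul {l m p : Type*} [Fintype m] {M : ℝ → Matrix l m ℂ}
    {N : ℝ → Matrix m p ℂ} {M' : Matrix l m ℂ} {N' : Matrix m p ℂ} {t : ℝ}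
    (hM : ∀ a b, HasDerivAt (fun s => M s a b) (M' a b) t)
    (hN : ∀ a b, HasDerivAt (fun s => N s a b) (N' a b) t) (a : l) (b : p) :
    HasDerivAt (fun s => (M s * N s) a b) ((M' * N t + M t * N') a b) t := by
  simp only [Matrix.mul_apply, Matrix.add_apply, ← Finset.sum_add_distrib]
  exact HasDerivAt.fun_sum fun c _ => (hM a c).fun_mul (hN c b)

/-- The derivative of the determinant at the identity is the trace. -/
lemma hasDerivAt_det_of_eq_one {D : ℝ → Matrix (Fin n) (Fin n) ℂ} {D' : Matrix (Fin n) (Fin n) ℂ}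
    {t : ℝ} (hD : ∀ a b, HasDerivAt (fun s => D s a b) (D' a b) t) (h1 : D t = 1) :
    HasDerivAt (fun s => (D s).det) D'.trace t := by
  have h2 : ∀ σ : Equiv.Perm (Fin n), HasDerivAt (fun s => ∏ i, D s (σ i) i)
      (∑ i, (∏ j ∈ Finset.univ.erase i, D t (σ j) j) * D' (σ i) i) t := fun σ => by
    simpa only [smul_eq_mul] using
      HasDerivAt.fun_finsetProd (u := Finset.univ) fun i _ => hD (σ i) i
  simp only [Matrix.det_apply]
  refine (HasDerivAt.fun_sum fun σ _ => (h2 σ).const_smul (Equiv.Perm.sign σ)).congr_deriv ?_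
  rw [Finset.sum_eq_single 1]
  · simp [h1, Matrix.trace]
  · intro σ _ hσ
    rw [Finset.sum_eq_zero, smul_zero]
    intro i _
    -- A nontrivial permutation moves at least two points, so an off-diagonal entry of `1` remains
    -- after one factor has been differentiated.
    obtain ⟨j, hji, hj⟩ : ∃ j, j ≠ i ∧ σ j ≠ j := by
      by_contra! h
      refine hσ (Equiv.ext fun j => ?_)
      by_cases hj : j = i
      · subst hj
        by_contra hne
        exact hne (σ.injective (h _ hne))
      · exact h j hj
    rw [Finset.prod_eq_zero (Finset.mem_erase.mpr ⟨hji, Finset.mem_univ j⟩), zero_mul]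
    rw [h1, Matrix.one_apply_ne hj]
  · simp

/-- Only continuity of the second factor is needed, so the matrix inverse never has to be
differentiated. -/
lemma hasDerivAt_mul_of_eq_zero {f g : ℝ → ℂ} {f' : ℂ} {t : ℝ} (hf : HasDerivAt f f' t)
    (h0 : f t = 0) (hg : ContinuousAt g t) : HasDerivAt (fun s => f s * g s) (f' * g t) t := by
  rw [hasDerivAt_iff_tendsto_slope] at hf ⊢
  have h1 := hf.mul (hg.tendsto.mono_left nhdsWithin_le_nhds : Filter.Tendsto g (nhdsWithin t {t}ᶜ) _)
  refine h1.congr fun s => ?_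
  simp only [slope, vsub_eq_sub, h0, zero_mul, sub_zero, smul_mul_assoc]

/-- The derivative of `N D⁻¹` at a point where `D = 1`. -/
lemma hasDerivAt_mul_inv_of_eq_one {N D : ℝ → Matrix (Fin n) (Fin n) ℂ}
    {N' D' : Matrix (Fin n) (Fin n) ℂ} {t : ℝ} (hN : ∀ a b, HasDerivAt (fun s => N s a b) (N' a b) t)
    (hD : ∀ a b, HasDerivAt (fun s => D s a b) (D' a b) t) (h1 : D t = 1)
    (hu : ∀ s, IsUnit (D s).det) (a b : Fin n) :
    HasDerivAt (fun s => (N s * (D s)⁻¹) a b) ((N' - N t * D') a b) t := by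
  have hc : ∀ c, ContinuousAt (fun s => (D s)⁻¹ c b) t := by
    intro c
    have h2 : ContinuousAt D t := continuousAt_pi.mpr fun i => continuousAt_pi.mpr fun j =>
      (hD i j).continuousAt
    have h3 : ContinuousAt (fun s => (D s).adjugate c b) t :=
      ((continuous_id.matrix_adjugate).matrix_elem c b).continuousAt.comp h2
    have h4 := (hasDerivAt_det_of_eq_one hD h1).continuousAt
    simp only [Matrix.inv_def, Ring.inverse_eq_inv', Matrix.smul_apply, smul_eq_mul]
    exact (h4.inv₀ (hu t).ne_zero).mul h3
  have hH : ∀ c, HasDerivAt (fun s => (N s - N t * D s) a c) ((N' - N t * D') a c) t := by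
    intro c
    have h2 := hasDerivAt_matrix_mul (M := fun _ => N t) (M' := 0)
      (fun a b => hasDerivAt_const t _) hD a c
    rw [Matrix.zero_mul, zero_add] at h2
    exact (hN a c).sub h2
  -- `N D⁻¹ = N_t + (N - N_t D) D⁻¹`, where the first factor of the correction vanishes at `t`
  -- because `D_t = 1`.
  have h2 : ∀ s, (N s * (D s)⁻¹) a b = N t a b + ∑ c, (N s - N t * D s) a c * (D s)⁻¹ c b := by
    intro s
    rw [← Matrix.mul_apply, ← Matrix.add_apply, Matrix.sub_mul,
      Matrix.mul_nonsing_inv_cancel_right _ _ (hu s),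
      add_sub_cancel]
  simp only [h2]
  have h3 := (HasDerivAt.fun_sum (u := Finset.univ) fun c _ =>
    hasDerivAt_mul_of_eq_zero (hH c) (by rw [h1, Matrix.mul_one, sub_self]; rfl) (hc c)).const_add
      (N t a b)
  refine h3.congr_deriv ?_
  rw [← Matrix.mul_apply, h1, inv_one, Matrix.mul_one]

/-! ### One-parameter subgroups -/

section Exp

attribute [local instance] Matrix.linftyOpNormedRing Matrix.linftyOpNormedAlgebra

lemma continuous_exp_smul {m : Type*} [Fintype m] [DecidableEq m] (M : Matrix m m ℂ) :
    Continuous fun t : ℝ => NormedSpace.exp ((t : ℂ) • M) :=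
  NormedSpace.exp_continuous.comp (Complex.continuous_ofReal.smul continuous_const)

lemma hasDerivAt_exp_smul_apply {m : Type*} [Fintype m] [DecidableEq m] (M : Matrix m m ℂ) (i j : m) :
    HasDerivAt (fun t : ℝ => NormedSpace.exp ((t : ℂ) • M) i j) (M i j) 0 := by
  have h := hasDerivAt_exp_smul_const (𝕂 := ℂ) M 0
  rw [zero_smul, NormedSpace.exp_zero, one_mul] at h
  have h2 := (LinearMap.toContinuousLinearMap (Matrix.entryLinearMap ℂ ℂ i j)).hasFDerivAt.comp_hasDerivAt (0 : ℂ) h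
  have h3 : HasDerivAt (fun z : ℂ => NormedSpace.exp (z • M) i j) (M i j) ((0 : ℝ) : ℂ) := by
    rw [Complex.ofReal_zero]
    exact h2
  exact h3.comp_ofReal

end Exp

section OneParameter

variable {X Y : Matrix (Fin n) (Fin n) ℂ} {γ : ℝ → SOStar n}

lemma one_parameter_add (hγ : ∀ t : ℝ, mat (γ t) = NormedSpace.exp ((t : ℂ) • lieMat X Y))
    (s t : ℝ) : γ (s + t) = γ s * γ t := by
  refine mat_injective ?_
  rw [mat_mul, hγ, hγ, hγ, Complex.ofReal_add, add_smul, Matrix.exp_add_of_commute]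
  exact ((Commute.refl _).smul_left _).smul_right _

lemma one_parameter_zero (hγ : ∀ t : ℝ, mat (γ t) = NormedSpace.exp ((t : ℂ) • lieMat X Y)) :
    γ 0 = 1 := by
  refine mat_injective ?_
  rw [hγ, mat_one, Complex.ofReal_zero, zero_smul, NormedSpace.exp_zero]

lemma continuous_one_parameter
    (hγ : ∀ t : ℝ, mat (γ t) = NormedSpace.exp ((t : ℂ) • lieMat X Y)) : Continuous γ := by
  refine Continuous.subtype_mk (f := fun t => (γ t).1) (Continuous.subtype_mk (f := fun t => (γ t).1.1) ?_ _) _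
  change Continuous fun t => mat (γ t)
  simp only [hγ]
  exact continuous_exp_smul _

lemma hasDerivAt_numer_denom
    (hγ : ∀ t : ℝ, mat (γ t) = NormedSpace.exp ((t : ℂ) • lieMat X Y))
    (ζ : Matrix (Fin n) (Fin n) ℂ) (a b : Fin n) :
    HasDerivAt (fun t => numer (γ t) ζ a b) ((X * ζ + Y) a b) 0 ∧
    HasDerivAt (fun t => denom (γ t) ζ a b) ((X.map conj - Y.map conj * ζ) a b) 0 := by
  have h : ∀ i j, HasDerivAt (fun t => mat (γ t) i j) (lieMat X Y i j) 0 := fun i j => by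
    simp only [hγ]
    exact hasDerivAt_exp_smul_apply _ i j
  have hm : ∀ {M : ℝ → Matrix (Fin n) (Fin n) ℂ} {M' : Matrix (Fin n) (Fin n) ℂ},
      (∀ a b, HasDerivAt (fun s => M s a b) (M' a b) 0) →
      HasDerivAt (fun s => (M s * ζ) a b) ((M' * ζ) a b) 0 := fun hM => by
    have h1 := hasDerivAt_matrix_mul hM (N := fun _ => ζ) (N' := 0)
      (fun a b => hasDerivAt_const 0 _) a b
    rwa [Matrix.mul_zero, add_zero] at h1
  constructor
  · exact (hm (M := fun t => (mat (γ t)).toBlocks₁₁) (M' := X) fun a b => h (.inl a) (.inl b)).add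
      (h (.inl a) (.inr b))
  · refine ((hm (M := fun t => (mat (γ t)).toBlocks₂₁) (M' := -Y.map conj)
      fun a b => h (.inr a) (.inl b)).add (h (.inr a) (.inr b))).congr_deriv ?_
    rw [Matrix.neg_mul, Matrix.sub_apply, sub_eq_neg_add]
    rfl

lemma hasDerivAt_transVec_apply (hX : Xᴴ = -X) (hY : Yᵀ = -Y)
    (hγ : ∀ t : ℝ, mat (γ t) = NormedSpace.exp ((t : ℂ) • lieMat X Y)) (ζ : domain n) (i : Occ n) :
    HasDerivAt (fun t => ((transVec (γ t) ζ : intertwiners n) : Fock n) i)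
      (lieOp X Y (expFam ζ.1) i) 0 := by
  have hd1 : denom (γ 0) ζ.1 = 1 := by rw [one_parameter_zero hγ, denom_one]
  have ha1 : act (γ 0) ζ.1 = ζ.1 := by rw [one_parameter_zero hγ, act_one]
  have hn1 : numer (γ 0) ζ.1 = ζ.1 := by rw [← act_mul_denom _ ζ.2, ha1, hd1, Matrix.mul_one]
  have hN := fun a b => (hasDerivAt_numer_denom hγ ζ.1 a b).1
  have hD := fun a b => (hasDerivAt_numer_denom hγ ζ.1 a b).2
  have hact := fun a b => hasDerivAt_mul_inv_of_eq_one hN hD hd1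
    (fun s => isUnit_det_denom (γ s) ζ.2) a b
  rw [hn1] at hact
  have h1 := hasDerivAt_expFam (Z := fun t => act (γ t) ζ.1) (Z' := infAct X Y ζ.1) hact i
  have hdet := (hasDerivAt_det_of_eq_one hD hd1).fun_inv (by rw [hd1, Matrix.det_one]; exact one_ne_zero)
  have h2 := hdet.fun_mul h1
  have e : ∀ t, ((transVec (γ t) ζ : intertwiners n) : Fock n) i
      = (denom (γ t) ζ.1).det⁻¹ * expFam (act (γ t) ζ.1) i := by
    intro t
    change (denom (γ t) ζ.1).det⁻¹ * (expFock (act (γ t) ζ.1)) i = _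
    rw [coe_expFock (act_mem_domain _ ζ.2)]
  simp only [e]
  refine h2.congr_deriv ?_
  rw [lieOp_expFam hX hY, hd1, ha1, Matrix.det_one]
  simp only [Pi.sub_apply, Pi.smul_apply, smul_eq_mul]
  ring

lemma pair_eq_sum {f g : Coeff n} {s : Finset (Occ n)} (hs : Function.support g ⊆ s) :
    pair f g = ∑ i ∈ s, conj (f i) * g i :=
  tsum_eq_sum fun i hi => by
    rw [Function.notMem_support.mp fun h => hi (hs h), mul_zero]

/-- The vector `L ψ`, for an intertwiner `ψ` with finitely many non-zero coefficients. -/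
lemma toFock_lieOp_mem (hX : Xᴴ = -X) {ψ : Fock n} (hψ : ψ ∈ intertwiners n)
    (hs : (ψ : Coeff n) ∈ finSupp n) :
    lieOp X Y (ψ : Coeff n) ∈ finSupp n ∧ toFock (lieOp X Y (ψ : Coeff n)) ∈ intertwiners n := by
  have h1 : lieOp X Y (ψ : Coeff n) ∈ finSupp n := by
    rw [← neg_neg (lieOp X Y (ψ : Coeff n))]
    exact Submodule.neg_mem _ ((formalAdjoint_lieOp hX Y).mem _ hs)
  exact ⟨h1, toFock_mem_intertwiners (memlp_of_mem_finSupp h1) (lieOp_invariant X Y hψ)⟩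

lemma inner_rep_right (g : SOStar n) (ψ φ : intertwiners n) :
    inner ℂ ψ (rep n g φ) = (inner ℂ (rep n g⁻¹ ψ) φ : ℂ) := by
  rw [← LinearIsometryEquiv.inner_map_map (rep n g⁻¹) ψ, ← Function.comp_apply (f := rep n g⁻¹) (g := rep n g),
    ← LinearIsometryEquiv.coe_mul, ← map_mul, inv_mul_cancel, map_one]
  rfl

lemma one_parameter_neg (hγ : ∀ t : ℝ, mat (γ t) = NormedSpace.exp ((t : ℂ) • lieMat X Y)) (t : ℝ) :
    γ (-t) = (γ t)⁻¹ := by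
  rw [eq_inv_iff_mul_eq_one, ← one_parameter_add hγ, neg_add_cancel, one_parameter_zero hγ]

/-- Finite support of `ψ` makes the inner product a finite sum, so coefficientwise derivatives
suffice once the group element is moved to `e_ζ`. The signs from `γ (-t)` and from skew-adjointness
cancel. -/
lemma hasDerivAt_inner_zero (hX : Xᴴ = -X) (hY : Yᵀ = -Y)
    (hγ : ∀ t : ℝ, mat (γ t) = NormedSpace.exp ((t : ℂ) • lieMat X Y)) (ζ : domain n)
    {ψ : Fock n} (hψ : ψ ∈ intertwiners n) (hs : (ψ : Coeff n) ∈ finSupp n) :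
    HasDerivAt (fun t => (inner ℂ (expVec ζ) (rep n (γ t) ⟨ψ, hψ⟩) : ℂ))
      (inner ℂ (expFock ζ.1) (toFock (lieOp X Y (ψ : Coeff n)))) 0 := by
  have e : ∀ t, (inner ℂ (expVec ζ) (rep n (γ t) ⟨ψ, hψ⟩) : ℂ)
      = ∑ i ∈ Set.Finite.toFinset hs, conj (((transVec (γ (-t)) ζ : intertwiners n) : Fock n) i) * ψ i := by
    intro t
    rw [inner_rep_right, ← one_parameter_neg hγ, rep_expVec]
    change inner ℂ ((transVec (γ (-t)) ζ : intertwiners n) : Fock n) ψ = _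
    rw [inner_eq_pair, pair_eq_sum (Set.Finite.coe_toFinset hs).ge]
  have e2 : inner ℂ (expFock ζ.1) (toFock (lieOp X Y (ψ : Coeff n)))
      = ∑ i ∈ Set.Finite.toFinset hs, conj (-lieOp X Y (expFam ζ.1) i) * ψ i := by
    have h1 := (formalAdjoint_lieOp hX Y).adj _ hs (expFam ζ.1)
    rw [inner_eq_pair, coe_expFock ζ.2, toFock_coe (memlp_of_mem_finSupp (toFock_lieOp_mem hX hψ hs).1),
      ← conj_pair]
    have h2 : pair (lieOp X Y (ψ : Coeff n)) (expFam ζ.1) = -pair (ψ : Coeff n) (lieOp X Y (expFam ζ.1)) := by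
      rw [h1, LinearMap.neg_apply, ← neg_one_smul ℂ (lieOp X Y (ψ : Coeff n)), pair_smul_left]
      simp
    rw [h2, map_neg, conj_pair, pair_eq_sum (Set.Finite.coe_toFinset hs).ge, ← Finset.sum_neg_distrib]
    exact Finset.sum_congr rfl fun i _ => by rw [map_neg, neg_mul]
  simp only [e]
  rw [e2]
  refine HasDerivAt.fun_sum fun i _ => HasDerivAt.mul_const ?_ _
  have h1 := hasDerivAt_transVec_apply hX hY hγ ζ i
  rw [← neg_zero] at h1
  have h2 := h1.scomp (0 : ℝ) (hasDerivAt_neg (0 : ℝ))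
  rw [neg_one_smul] at h2
  exact Complex.conjCLE.toContinuousLinearMap.hasFDerivAt.comp_hasDerivAt (0 : ℝ) h2

/-- The group law carries the derivative from `0` to `t`, since the inverse of `γ t` maps `e_ζ` to a
multiple of another exponential vector. -/
lemma hasDerivAt_inner (hX : Xᴴ = -X) (hY : Yᵀ = -Y)
    (hγ : ∀ t : ℝ, mat (γ t) = NormedSpace.exp ((t : ℂ) • lieMat X Y)) (ζ : domain n)
    {ψ : Fock n} (hψ : ψ ∈ intertwiners n) (hs : (ψ : Coeff n) ∈ finSupp n) (t : ℝ) :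
    HasDerivAt (fun t => (inner ℂ (expVec ζ) (rep n (γ t) ⟨ψ, hψ⟩) : ℂ))
      (inner ℂ (expVec ζ) (rep n (γ t) ⟨_, (toFock_lieOp_mem (Y := Y) hX hψ hs).2⟩)) t := by
  have e : ∀ s φ, (inner ℂ (expVec ζ) (rep n (γ (s + t)) φ) : ℂ)
      = conj (denom (γ t)⁻¹ ζ.1).det⁻¹ * inner ℂ (expVec (actPt (γ t)⁻¹ ζ)) (rep n (γ s) φ) := by
    intro s φ
    rw [add_comm, one_parameter_add hγ, map_mul, LinearIsometryEquiv.coe_mul, Function.comp_apply,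
      inner_rep_right, rep_expVec, transVec]
    have := inner_smul_smul_intertwiners (denom (γ t)⁻¹ ζ.1).det⁻¹ 1 (expVec (actPt (γ t)⁻¹ ζ)) (rep n (γ s) φ)
    rwa [one_smul, mul_one] at this
  have h1 := (hasDerivAt_inner_zero hX hY hγ (actPt (γ t)⁻¹ ζ) hψ hs).const_mul
    (conj (denom (γ t)⁻¹ ζ.1).det⁻¹)
  simp only [← e] at h1
  rw [← sub_self t] at h1
  have h2 := h1.comp_sub_const t t
  simp only [sub_add_cancel] at h2
  refine h2.congr_deriv ?_
  rw [← zero_add t, e, one_parameter_zero hγ, map_one]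
  simp only [zero_add]
  rfl

end OneParameter

/-- A weakly differentiable curve with continuous weak derivative is differentiable. -/
lemma hasDerivAt_of_inner {E : Type*} [NormedAddCommGroup E] [InnerProductSpace ℂ E]
    [CompleteSpace E] {ι : Type*} {v : ι → E}
    (hv : ∀ x y : E, (∀ j, inner ℂ (v j) x = (inner ℂ (v j) y : ℂ)) → x = y) {u w : ℝ → E}
    (hw : Continuous w)
    (h : ∀ j t, HasDerivAt (fun t => (inner ℂ (v j) (u t) : ℂ)) (inner ℂ (v j) (w t)) t) (t : ℝ) :
    HasDerivAt u (w t) t := by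
  have h1 : ∀ t, HasDerivAt (fun t => ∫ s in (0 : ℝ)..t, w s) (w t) t := fun t =>
    intervalIntegral.integral_hasDerivAt_right (hw.intervalIntegrable _ _)
      hw.aestronglyMeasurable.stronglyMeasurableAtFilter hw.continuousAt
  -- Paired with each `v j`, the difference of `u` and the integral of `w` has zero derivative,
  -- hence is constant; the `v j` separate points.
  have h2 : ∀ t, u t = u 0 + ∫ s in (0 : ℝ)..t, w s := by
    intro t
    refine hv _ _ fun j => ?_
    have h3 : ∀ t, HasDerivAt (fun t => (inner ℂ (v j) (u t) : ℂ) - inner ℂ (v j) (∫ s in (0 : ℝ)..t, w s)) 0 t := by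
      intro t
      have h4 := ((innerSL ℂ (v j)).restrictScalars ℝ).hasFDerivAt.comp_hasDerivAt t (h1 t)
      have h5 := (h j t).fun_sub h4
      rw [show ((innerSL ℂ (v j)).restrictScalars ℝ) (w t) = inner ℂ (v j) (w t) from rfl, sub_self] at h5
      exact h5
    have h6 := is_const_of_deriv_eq_zero (fun t => (h3 t).differentiableAt) (fun t => (h3 t).deriv) t 0
    simp only [intervalIntegral.integral_same, inner_zero_right, sub_zero] at h6
    rw [inner_add_right, ← h6, sub_add_cancel]
  have h3 := (h1 t).const_add (u 0)
  simpa only [← h2] using h3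

lemma isIntertwinerRep_rep (n : ℕ) : IsIntertwinerRep (rep n) where
  continuous := continuous_rep
  hasDerivAt X Y hX hY γ hγ ψ hψ := by
    have h := hasDerivAt_of_inner (v := expVec (n := n)) (u := fun t => rep n (γ t) ψ)
      (w := fun t => rep n (γ t) ⟨_, (toFock_lieOp_mem (Y := Y) hX ψ.2 hψ).2⟩)
      (fun _ _ => ext_inner_expVec) ((continuous_rep _).comp (continuous_one_parameter hγ))
      (fun ζ t => hasDerivAt_inner hX hY hγ ζ ψ.2 hψ t) 0
    have h2 := ((intertwiners n).subtypeL.restrictScalars ℝ).hasFDerivAt.comp_hasDerivAt (0 : ℝ) h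
    refine h2.congr_deriv ?_
    rw [one_parameter_zero hγ, map_one]
    rfl

/-! ### The section and the covariance of the states -/

lemma map_conj_eq_transpose {X : Matrix (Fin n) (Fin n) ℂ} (hX : Xᴴ = X) : X.map conj = Xᵀ := by
  conv_rhs => rw [← hX]
  rfl

lemma one_sub_transpose {ζ : Matrix (Fin n) (Fin n) ℂ} (hζ : ζᵀ = -ζ) :
    (1 - ζᴴ * ζ)ᵀ = 1 - ζ * ζᴴ := by
  rw [Matrix.transpose_sub, Matrix.transpose_one, Matrix.transpose_mul,
    conjTranspose_transpose_of_antisymm hζ, hζ, neg_mul_neg]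

lemma posDef_one_sub_mul_conjTranspose {ζ : Matrix (Fin n) (Fin n) ℂ} (hζ : ζ ∈ domain n) :
    (1 - ζ * ζᴴ).PosDef := by
  rw [← one_sub_transpose hζ.1]
  exact hζ.2.transpose

open scoped MatrixOrder in
/-- The positive semi-definite square root that occurs in the section. -/
lemma exists_sqrt {ζ : Matrix (Fin n) (Fin n) ℂ} (hζ : ζ ∈ domain n) :
    ∃ X : Matrix (Fin n) (Fin n) ℂ, X.PosSemidef ∧ X * X = (1 - ζ * ζᴴ)⁻¹ := by
  have h := (posDef_one_sub_mul_conjTranspose hζ).posSemidef.inv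
  refine ⟨CFC.sqrt (1 - ζ * ζᴴ)⁻¹, Matrix.nonneg_iff_posSemidef.mp (CFC.sqrt_nonneg _), ?_⟩
  rw [← sq, CFC.sq_sqrt _ h.nonneg]

/-- The matrix factors as `(1, ζ; ζ*, 1)` times `diag(X, Xᵀ)`. Here `conj X = Xᵀ` as `X` is
Hermitian, and `(1 - ζ*ζ)ᵀ = 1 - ζζ*`, so the one equation for `X` normalises both diagonal blocks.
-/
lemma exists_isSection {ζ : Matrix (Fin n) (Fin n) ℂ} (hζ : ζ ∈ domain n) :
    ∃ g : SOStar n, IsSection ζ g ∧ act g 0 = ζ ∧ (denom g 0).det = (normFactor ζ : ℂ)⁻¹ := by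
  obtain ⟨X, hX, hXX⟩ := exists_sqrt hζ
  have hXc : X.map conj = Xᵀ := map_conj_eq_transpose hX.1
  have hu : IsUnit (1 - ζ * ζᴴ).det :=
    (Matrix.isUnit_iff_isUnit_det _).mp (posDef_one_sub_mul_conjTranspose hζ).isUnit
  have h1 : X * (1 - ζ * ζᴴ) * X = 1 := by
    rw [mul_eq_one_comm, ← Matrix.mul_assoc, hXX, Matrix.nonsing_inv_mul _ hu]
  have h2 : Xᵀ * (1 - ζᴴ * ζ) * Xᵀ = 1 := by
    have h := congrArg Matrix.transpose h1
    rwa [Matrix.transpose_mul, Matrix.transpose_mul, ← one_sub_transpose hζ.1,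
      Matrix.transpose_transpose, Matrix.transpose_one, ← Matrix.mul_assoc] at h
  have hT : Xᵀᴴ = Xᵀ := hX.1.transpose.eq
  have hζT := conjTranspose_transpose_of_antisymm hζ.1
  have hdetX : X.det * (1 - ζᴴ * ζ).det * X.det = 1 := by
    have h := congrArg Matrix.det h2
    rwa [Matrix.det_mul, Matrix.det_mul, Matrix.det_transpose, Matrix.det_one] at h
  have hdet : (Matrix.fromBlocks X (ζ * Xᵀ) (ζᴴ * X) Xᵀ).det = 1 := by
    have h : Matrix.fromBlocks X (ζ * Xᵀ) (ζᴴ * X) Xᵀ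
        = Matrix.fromBlocks 1 ζ ζᴴ 1 * Matrix.fromBlocks X 0 0 Xᵀ := by
      simp [Matrix.fromBlocks_multiply]
    rw [h, Matrix.det_mul, Matrix.det_fromBlocks_one₁₁, Matrix.det_fromBlocks_zero₂₁,
      Matrix.det_transpose, ← hdetX]
    ring
  have hH : (Matrix.fromBlocks X (ζ * Xᵀ) (ζᴴ * X) Xᵀ)ᴴ * hermForm n
      * Matrix.fromBlocks X (ζ * Xᵀ) (ζᴴ * X) Xᵀ = hermForm n := by
    rw [hermForm, Matrix.fromBlocks_conjTranspose, Matrix.fromBlocks_multiply,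
      Matrix.fromBlocks_multiply, Matrix.fromBlocks_inj]
    simp only [Matrix.conjTranspose_mul, Matrix.conjTranspose_conjTranspose, hX.1.eq, hT]
    refine ⟨?_, ?_, ?_, ?_⟩
    · refine Eq.trans ?_ h1
      noncomm_ring
    · noncomm_ring
    · noncomm_ring
    · refine Eq.trans ?_ (congrArg Neg.neg h2)
      noncomm_ring
  have hS : (Matrix.fromBlocks X (ζ * Xᵀ) (ζᴴ * X) Xᵀ)ᵀ * symmForm n
      * Matrix.fromBlocks X (ζ * Xᵀ) (ζᴴ * X) Xᵀ = symmForm n := by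
    rw [symmForm, Matrix.fromBlocks_transpose, Matrix.fromBlocks_multiply,
      Matrix.fromBlocks_multiply, Matrix.fromBlocks_inj]
    simp only [Matrix.transpose_mul, Matrix.transpose_transpose, hζT, hζ.1]
    refine ⟨?_, ?_, ?_, ?_⟩
    · noncomm_ring
    · refine Eq.trans ?_ h2
      noncomm_ring
    · refine Eq.trans ?_ h1
      noncomm_ring
    · noncomm_ring
  have hd0 : ∀ g : SOStar n, mat g = Matrix.fromBlocks X (ζ * Xᵀ) (ζᴴ * X) Xᵀ →
      denom g 0 = Xᵀ ∧ numer g 0 = ζ * Xᵀ := fun g hg => by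
    rw [denom, numer, hg, Matrix.toBlocks_fromBlocks₂₁, Matrix.toBlocks_fromBlocks₂₂,
      Matrix.toBlocks_fromBlocks₁₁, Matrix.toBlocks_fromBlocks₁₂]
    simp
  let g : SOStar n := ⟨⟨Matrix.fromBlocks X (ζ * Xᵀ) (ζᴴ * X) Xᵀ, hdet⟩, hH, hS⟩
  have hg := hd0 g rfl
  have huX : IsUnit (Xᵀ).det := by
    rw [← hg.1]
    exact isUnit_det_denom g zero_mem_domain
  refine ⟨g, ⟨X, hX, hXX, by rw [hXc]; rfl⟩, ?_, ?_⟩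
  · change numer g 0 * (denom g 0)⁻¹ = ζ
    rw [hg.1, hg.2, Matrix.mul_nonsing_inv_cancel_right _ _ huX]
  · rw [hg.1, Matrix.det_transpose]
    -- The equation only gives `(det X · normFactor ζ)² = 1`; nonnegativity of `det X` selects the
    -- root `1`.
    obtain ⟨r, hr, hrX⟩ := RCLike.nonneg_iff_exists_ofReal.mp hX.det_nonneg
    have hN := normFactor_pos hζ
    rw [← normFactor_mul_self hζ, ← hrX] at hdetX
    rw [← hrX]
    refine eq_inv_of_mul_eq_one_left ?_
    have h3 : (r * normFactor ζ) * (r * normFactor ζ) = 1 := by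
      have : ((r * normFactor ζ * (r * normFactor ζ) : ℝ) : ℂ) = 1 := by
        rw [← hdetX]
        push_cast
        simp only [Complex.coe_algebraMap]
        ring
      exact_mod_cast this
    rcases mul_self_eq_one_iff.mp h3 with h4 | h4
    · exact (Complex.ofReal_mul r (normFactor ζ)).symm.trans (by rw [h4, Complex.ofReal_one])
    · have := mul_nonneg hr hN.le
      linarith

lemma expFam_zero_matrix : expFam (0 : Matrix (Fin n) (Fin n) ℂ) = vacuum n := by
  ext i
  rw [expFam]
  rcases h : ∑ a, i.1 a with _ | k
  · rw [expCoeff_zero]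
  · have h0 : vacuum n i = 0 := by
      by_contra h0
      have := (hasDeg_vacuum i h0).1
      omega
    rw [h0]
    simp [expCoeff, raise]

lemma toFock_vacuum : toFock (vacuum n) = expFock 0 := by
  rw [← expFam_zero_matrix, toFock_expFam zero_mem_domain]

lemma vacuum_mem : toFock (vacuum n) ∈ intertwiners n := by
  rw [toFock_vacuum]
  exact expFock_mem zero_mem_domain

lemma rep_vacuum {ζ : Matrix (Fin n) (Fin n) ℂ} (hζ : ζ ∈ domain n) {g : SOStar n}
    (h1 : act g 0 = ζ) (h2 : (denom g 0).det = (normFactor ζ : ℂ)⁻¹) :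
    ((rep n g ⟨toFock (vacuum n), vacuum_mem⟩ : intertwiners n) : Fock n) = ket ζ := by
  have e : (⟨toFock (vacuum n), vacuum_mem⟩ : intertwiners n) = expVec ⟨0, zero_mem_domain⟩ :=
    Subtype.ext toFock_vacuum
  rw [e, rep_expVec, ket_eq hζ]
  change (denom g 0).det⁻¹ • expFock (act g 0) = _
  rw [h1, h2, inv_inv]

lemma rep_ket (g : SOStar n) {ζ : Matrix (Fin n) (Fin n) ℂ} (hζ : ζ ∈ domain n) :
    ∃ θ : ℝ, ((rep n g ⟨ket ζ, ket_mem hζ⟩ : intertwiners n) : Fock n)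
      = Complex.exp (θ * Complex.I) • ket (act g ζ) := by
  have hg := act_mem_domain g hζ
  have hN : (normFactor (act g ζ) : ℂ) ≠ 0 := by exact_mod_cast (normFactor_pos hg).ne'
  have e : (⟨ket ζ, ket_mem hζ⟩ : intertwiners n) = (normFactor ζ : ℂ) • expVec ⟨ζ, hζ⟩ :=
    Subtype.ext (ket_eq hζ)
  obtain ⟨c, hc⟩ : ∃ c : ℂ,
      ((rep n g ⟨ket ζ, ket_mem hζ⟩ : intertwiners n) : Fock n) = c • ket (act g ζ) := by
    refine ⟨normFactor ζ * (denom g ζ).det⁻¹ * (normFactor (act g ζ) : ℂ)⁻¹, ?_⟩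
    rw [e, map_smul, rep_expVec, ket_eq hg, smul_smul, inv_mul_cancel_right₀ hN, mul_smul]
    rfl
  -- Both states are unit vectors and the operator is isometric, so the proportionality factor is a
  -- phase.
  have h1 : ‖c‖ = 1 := by
    have h2 : ‖((rep n g ⟨ket ζ, ket_mem hζ⟩ : intertwiners n) : Fock n)‖ = 1 :=
      ((rep n g).norm_map _).trans (norm_ket hζ)
    rwa [hc, norm_smul, norm_ket hg, mul_one] at h2
  refine ⟨c.arg, ?_⟩
  have h2 := Complex.norm_mul_exp_arg_mul_I c
  rw [h1, Complex.ofReal_one, one_mul] at h2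
  rw [hc, h2]

end SOStarCoherent

end

theorem mainTheorem10 (n : ℕ) :
    -- the series that defines `exp (½ F̃_ζ) |0⟩` converges in the Hilbert space
    (∀ ζ ∈ domain n, (∀ k : ℕ, Memℓp (expTerm ζ k) 2) ∧
      Summable fun k : ℕ => ((k.factorial : ℂ)⁻¹) • toFock (expTerm ζ k)) ∧
    -- the states are intertwiners, and they are the Perelomov states of the vacuum: `|ζ⟩ = g_ζ |0⟩`,
    -- with the group acting by `g |ζ⟩ = e^{iθ} |g(ζ)⟩`
    (∃ hmem : ∀ ζ ∈ domain n, ket ζ ∈ intertwiners n,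
      ∃ hvac : toFock (vacuum n) ∈ intertwiners n,
      ∃ π : SOStar n →* (intertwiners n ≃ₗᵢ[ℂ] intertwiners n), IsIntertwinerRep π ∧
        (∀ ζ ∈ domain n, ∃ g : SOStar n, IsSection ζ g ∧
          ((π g ⟨toFock (vacuum n), hvac⟩ : intertwiners n) : Fock n) = ket ζ) ∧
        (∀ (g : SOStar n) (ζ : Matrix (Fin n) (Fin n) ℂ) (hζ : ζ ∈ domain n),
          IsUnit (denom g ζ) ∧ act g ζ ∈ domain n ∧
          ∃ θ : ℝ, ((π g ⟨ket ζ, hmem ζ hζ⟩ : intertwiners n) : Fock n)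
            = Complex.exp (θ * Complex.I) • ket (act g ζ))) ∧
    (∀ ω ∈ domain n, ∀ ζ ∈ domain n,
      -- overlaps
      (1 - ωᴴ * ζ).det ≠ 0 ∧
      inner ℂ (ket ω) (ket ζ) = (normFactor ζ : ℂ) * (normFactor ω : ℂ) / (1 - ωᴴ * ζ).det ∧
      ‖inner ℂ (ket ω) (ket ζ)‖ ≤ 1 ∧ (‖inner ℂ (ket ω) (ket ζ)‖ = 1 ↔ ω = ζ) ∧
      -- matrix elements of the generators
      ∀ a b : Fin n,
        MatrixElementEq ω (opE a b) ζ
          (inner ℂ (ket ω) (ket ζ) * (1 + (2 : ℂ) • (ωᴴ * ζ * (1 - ωᴴ * ζ)⁻¹) : Matrix (Fin n) (Fin n) ℂ) a b) ∧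
        MatrixElementEq ω (opF a b) ζ
          (inner ℂ (ket ω) (ket ζ) * ((2 : ℂ) • (ζ * (1 - ωᴴ * ζ)⁻¹)) a b) ∧
        MatrixElementEq ω (opFt a b) ζ
          (inner ℂ (ket ω) (ket ζ) * ((2 : ℂ) • ((1 - ωᴴ * ζ)⁻¹ * ω.map conj)) a b)) := by
  refine ⟨fun ζ hζ => ⟨memlp_expTerm hζ.1, ?_⟩,
    ⟨fun ζ hζ => ket_mem hζ, vacuum_mem, rep n, isIntertwinerRep_rep n, fun ζ hζ => ?_,
      fun g ζ hζ => ⟨isUnit_denom g hζ, act_mem_domain g hζ, rep_ket g hζ⟩⟩,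
    fun ω hω ζ hζ => ⟨det_one_sub_ne_zero hω hζ, inner_ket hω hζ, norm_inner_ket_le hω hζ,
      norm_inner_ket_eq_one_iff hω hζ, fun a b => ⟨matrixElementEq_opE hω hζ a b,
        matrixElementEq_opF hω hζ a b, matrixElementEq_opFt hω hζ a b⟩⟩⟩
  · simpa only [smul_toFock_expTerm hζ.1] using summable_toFock_expCoeff hζ
  · obtain ⟨g, hg, h1, h2⟩ := exists_isSection hζ
    exact ⟨g, hg, rep_vacuum hζ h1 h2⟩
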